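/- **Setting.** $m\ge 1$ stations share a slotted multiple-access channel: a slot is successful iff exactly one packet is transmitted in it, and then this packet is delivered. A *symmetric acknowledgement-based protocol* is one randomized program run by all stations (no ids, private independent random choices, common clock; $m$ and the rate may be known, and $w$ for adversarial injection); a station's feedback is only whether its own transmission succeeded. Injection is either * *stochastic of rate at most $\lambda$*: finitely many generators, each injecting in every slot at most one packet, at a random station, identically distributed over the slots, independent over generators and slots, with an expected total number of packets per slot at most $\lambda$; or * *by a $(w,\lambda)$-bounded adversary* ($w\ge 1$): a fixed injection sequence in which every interval of $w$ slots has at most $w\lambda$ injected packets. A protocol is *stable* (for an injection model) if there is a finite $B$ such that for all injections of the model the expected number of undelivered packets at every time is at most $B$ and the expected latency of every packet (given that it is injected) is at most $B$. **Static algorithm** for given reals $\phi\ge 1$, $\delta>0$ and an integer $n\ge 2$. Put $q=\frac1{\mathrm e(1+\delta)}$, $s=2\phi\ln n\cdot\frac{2\mathrm e^2(1+\delta)^2}{\delta^2}$ and $\xi=\max\{0,\lceil \ln(s/n)/\ln(1-q)\rceil\}$. Stage 1: for $i=1,\dots,\xi$, each remaining packet chooses independently and uniformly a delay in $\{0,\dots,\lfloor(1-q)^{i-1}n\rfloor\}$,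 and packets with the same delay are transmitted in the same slot. Stage 2: in each of $\lceil s\,\mathrm e(\phi+1)\ln n\rceil$ slots each remaining packet is transmitted independently with probability $1/s$. Delivered packets drop out. **Claim.** 1. For every $\delta>0$ there is a constant $C$ such that for all $\phi\ge1$ and $n\ge 2$ the static algorithm takes at most $(1+\delta)\mathrm e\,n+C\phi^2\ln^2 n$ slots. For all $\delta>0$ and $\phi\ge1$ and all sufficiently large $n$, when run on any number $k\le n$ of packets it delivers all of them with probability at least $1-n^{-\phi}$. 2. Let $0\le\lambda<1/\mathrm e$ and $m\ge1$. There is a symmetric acknowledgement-based protocol that is stable under stochastic injection of rate at most $\lambda$; and for every $w\ge 1$ there is one that is stable against all $(w,\lambda)$-bounded adversaries. The bound $B$ depends only on $m,\lambda$ (and $w$). In both cases the protocol can be chosen of the following form, with suitable parameters $T,\phi\ge1,\delta>0,n\ge2,n'\ge2$ such that the two executions described now fit into $T$ slots. Time is divided into frames of $T$ slots. In the main phase of a frame, the static algorithm with parameter $n$ is run on all packets injected in the previous frame; packets it does not deliver *fail*. In the following clean-up phase each station with failed packets selects, with probability $1/m$ independently, the one whose failure is longest ago, and the static algorithm with parameter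 $n'$ is run on the selected packets. -/

import Mathlib

open MeasureTheory ProbabilityTheory
open scoped ENNReal NNReal

universe u

/-! ### The static algorithm

A packet running the algorithm draws a random set of steps (its *pattern*), independently of the
other packets, and attempts transmission in exactly these steps until it is delivered.  Drawing all
the random choices in advance is the same as drawing them when they are needed.  The distribution of
the pattern is the same for every packet, and the only feedback used is a packet's own success. -/

namespace StaticMAC

/-- The rate `1 / (e (1 + δ))`. -/
noncomputable def rate (δ : ℝ) : ℝ := 1 / (Real.exp 1 * (1 + δ))

/-- `s = 2 φ ln n * (2 e² (1 + δ)² / δ²)`. -/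
noncomputable def s (φ δ : ℝ) (n : ℕ) : ℝ :=
  2 * φ * Real.log n * (2 * Real.exp 1 ^ 2 * (1 + δ) ^ 2 / δ ^ 2)

/-- The number `ξ` of iterations of the first stage, the least natural number for which
`(1 - 1 / (e (1 + δ))) ^ ξ * n ≤ s`. -/
noncomputable def xi (φ δ : ℝ) (n : ℕ) : ℕ :=
  ⌈Real.log (s φ δ n / n) / Real.log (1 - rate δ)⌉₊

/-- Largest delay in the iteration with index `i = 0, 1, …` of the first stage. -/
noncomputable def maxDelay (δ : ℝ) (n i : ℕ) : ℕ := ⌊(1 - rate δ) ^ i * n⌋₊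

/-- First step of the iteration with index `i` of the first stage; an iteration with largest delay
`d` takes the `d + 1` steps that belong to the delays `0, …, d`. -/
noncomputable def offset (δ : ℝ) (n i : ℕ) : ℕ := ∑ j ∈ Finset.range i, (maxDelay δ n j + 1)

/-- The number of steps of the second stage. -/
noncomputable def stage2Length (φ δ : ℝ) (n : ℕ) : ℕ :=
  ⌈s φ δ n * Real.exp 1 * (φ + 1) * Real.log n⌉₊

/-- The total number of steps. -/
noncomputable def length (φ δ : ℝ) (n : ℕ) : ℕ :=
  offset δ n (xi φ δ n) + stage2Length φ δ n

/-- A coin that shows `true` with probability `p` (for `0 ≤ p ≤ 1`). -/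
noncomputable def coin (p : ℝ) : PMF Bool :=
  PMF.ofFintype (fun b => ((if b then min p.toNNReal 1 else 1 - min p.toNNReal 1 : ℝ≥0) : ℝ≥0∞)) (by
    rw [Fintype.sum_bool, ← ENNReal.coe_add]
    simp)

/-- The attempts of one packet in the first `i` iterations of the first stage: in each iteration one
step, given by a uniformly random delay. -/
noncomputable def stage1 (δ : ℝ) (n : ℕ) : ℕ → PMF (Finset ℕ)
  | 0 => PMF.pure ∅
  | i + 1 =>
      (stage1 δ n i).bind fun S =>
        (PMF.uniformOfFinset (Finset.range (maxDelay δ n i + 1)) (by simp)).map fun d =>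
          insert (offset δ n i + d) S

/-- The attempts of one packet in the first stage and in the first `l` steps of the second stage, in
each of which an attempt is made with probability `1 / s`. -/
noncomputable def stage2 (φ δ : ℝ) (n : ℕ) : ℕ → PMF (Finset ℕ)
  | 0 => stage1 δ n (xi φ δ n)
  | l + 1 =>
      (stage2 φ δ n l).bind fun S =>
        (coin (1 / s φ δ n)).map fun b =>
          if b then insert (offset δ n (xi φ δ n) + l) S else S

/-- The random pattern of one packet in the static algorithm for (at most) `n` packets. -/
noncomputable def pattern (φ δ : ℝ) (n : ℕ) : PMF (Finset ℕ) :=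
  stage2 φ δ n (stage2Length φ δ n)

/-- The packets that are not yet delivered before step `t` when packet `p` has the pattern `S p`.
In a step a packet is delivered iff it is the only one that makes an attempt. -/
def remaining {k : ℕ} (S : Fin k → Finset ℕ) : ℕ → Finset (Fin k)
  | 0 => Finset.univ
  | t + 1 =>
      let A := (remaining S t).filter fun p => t ∈ S p
      if A.card = 1 then remaining S t \ A else remaining S t

/-- The probability that the static algorithm with parameter `n`, run on `k` packets, delivers all
of them within its `length φ δ n` steps. -/
noncomputable def successProb (φ δ : ℝ) (n k : ℕ) : ℝ :=
  (Measure.pi fun _ : Fin k => (pattern φ δ n).toMeasure).real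
    {S | remaining S (length φ δ n) = ∅}

end StaticMAC

/-! ### Symmetric acknowledgement-based protocols on the multiple-access channel -/

/-- A symmetric acknowledgement-based protocol with a global clock: the program that every station
runs.  Stations have no ids.  The packets of a station are numbered `0, 1, 2, …` locally in the order
of their injection.  In slot `t` a station in the local state `x` attempts to transmit its packets in
`action t x`.  After that it learns the number `a` of packets that were injected at this station
during the slot and whether its own transmission was successful (`ack`), and it moves to a random
state with law `update t x a ack`. -/
structure SymmetricProtocol where
  State : Type
  countable : Countable State
  init : State
  action : ℕ → State → Finset ℕ
  update : ℕ → State → ℕ → Bool → PMF State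

namespace SymmetricProtocol

variable (P : SymmetricProtocol) {m : ℕ}

/-- What is known about one station: its local state, the number of packets injected there so far,
and the numbers of those among them that are not yet delivered. -/
structure Station where
  state : P.State
  injected : ℕ
  pending : Finset ℕ

instance : Countable P.Station := by
  have := P.countable
  exact Function.Injective.countable
    (f := fun x : P.Station => (x.state, x.injected, x.pending)) (by
      rintro ⟨_, _, _⟩ ⟨_, _, _⟩ h
      simpa using h)

instance : MeasurableSpace P.Station := ⊤

/-- The undelivered packets that station `e` attempts to transmit in slot `t`. -/
def attempts (t : ℕ) (c : Fin m → P.Station) (e : Fin m) : Finset ℕ :=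
  P.action t (c e).state ∩ (c e).pending

/-- The multiple-access channel: a slot is successful iff exactly one packet is transmitted. -/
def Success (t : ℕ) (c : Fin m → P.Station) : Prop :=
  ∑ e, (P.attempts t c e).card = 1

open Classical in
/-- Station `e` is acknowledged iff the slot is successful and the transmission was its own. -/
noncomputable def ack (t : ℕ) (c : Fin m → P.Station) (e : Fin m) : Bool :=
  decide (P.Success t c ∧ (P.attempts t c e).Nonempty)

/-- The packets of station `e` that are undelivered after slot `t`, in which `a e` packets are
injected at station `e`. -/
noncomputable def pendingAfter (t : ℕ) (a : Fin m → ℕ) (c : Fin m → P.Station) (e : Fin m) :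
    Finset ℕ :=
  (if P.ack t c e then (c e).pending \ P.attempts t c e else (c e).pending) ∪
    Finset.Ico (c e).injected ((c e).injected + a e)

/-- One time slot; the stations use independent random choices. -/
noncomputable def stepMeasure (t : ℕ) (a : Fin m → ℕ) (c : Fin m → P.Station) :
    Measure (Fin m → P.Station) :=
  Measure.pi fun e =>
    ((P.update t (c e).state (a e) (P.ack t c e)).map fun x =>
      (⟨x, (c e).injected + a e, P.pendingAfter t a c e⟩ : P.Station)).toMeasure

instance (t : ℕ) (a : Fin m → ℕ) (c : Fin m → P.Station) :
    IsProbabilityMeasure (P.stepMeasure t a c) := by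
  unfold stepMeasure; infer_instance

/-- One time slot as a Markov kernel from the history to the next configuration. -/
noncomputable def stepKernel (a : ℕ → Fin m → ℕ) (t : ℕ) :
    Kernel (Finset.Iic t → Fin m → P.Station) (Fin m → P.Station) :=
  (Kernel.ofFunOfCountable (P.stepMeasure t (a t))).comap
    (fun h => h ⟨t, Finset.mem_Iic.2 le_rfl⟩) (measurable_pi_apply _)

instance (a : ℕ → Fin m → ℕ) (t : ℕ) : IsMarkovKernel (P.stepKernel a t) :=
  ⟨fun h => by
    rw [stepKernel, Kernel.comap_apply]
    exact inferInstanceAs (IsProbabilityMeasure (P.stepMeasure t (a t) _))⟩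

/-- The law of the sequence of configurations (the one with index `t` is that before slot `t`) on a
channel with `m` stations, when `a t e` packets are injected at station `e` in slot `t`. -/
noncomputable def law (a : ℕ → Fin m → ℕ) : Measure (ℕ → Fin m → P.Station) :=
  Kernel.trajMeasure (X := fun _ => Fin m → P.Station)
    (Measure.dirac fun _ => ⟨P.init, 0, ∅⟩) (P.stepKernel a)

variable {P}

/-- The number of undelivered packets before slot `t`. -/
def queueLength (τ : ℕ → Fin m → P.Station) (t : ℕ) : ℕ := ∑ e, (τ t e).pending.card

/-- The latency of the packet with number `j` of station `e` that is injected in slot `t`: the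
number of slots from `t` until the slot in which it is delivered (`∞` if it is never delivered). -/
noncomputable def latency (τ : ℕ → Fin m → P.Station) (e : Fin m) (j t : ℕ) : ℝ≥0∞ :=
  ⨅ (d : ℕ) (_ : j ∉ (τ (t + d + 1) e).pending), (d : ℝ≥0∞)

/-- The number of the first packet injected at station `e` in slot `t`. -/
def firstIndex (a : ℕ → Fin m → ℕ) (t : ℕ) (e : Fin m) : ℕ := ∑ i ∈ Finset.range t, a i e

end SymmetricProtocol

/-! ### Injection models and stability -/

/-- Stochastic injection of rate at most `lam` by `k` generators: `inj t g` is the station at which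
generator `g` injects a packet in slot `t` (`none` if it injects no packet).  The distribution does
not depend on `t`; different generators and different slots are independent.  All entries of the
interference matrix being `1`, the rate is the expected total number of packets per slot. -/
structure IsStochasticInjection {Ω : Type u} [MeasurableSpace Ω] (μ : Measure Ω) {m k : ℕ}
    (inj : ℕ → Fin k → Ω → Option (Fin m)) (lam : ℝ) : Prop where
  measurable : ∀ t g x, MeasurableSet {ω | inj t g ω = x}
  identDistrib : ∀ t t' g x, μ {ω | inj t g ω = x} = μ {ω | inj t' g ω = x}
  indep : iIndepFun (m := fun _ => ⊤) (fun q : ℕ × Fin k => inj q.1 q.2) μ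
  rate_le : ∀ t, ∑ e, ∑ g, μ.real {ω | inj t g ω = some e} ≤ lam

/-- The number of packets injected at station `e` in slot `t`. -/
def arrivals {m k : ℕ} (x : ℕ → Fin k → Option (Fin m)) (t : ℕ) (e : Fin m) : ℕ :=
  (Finset.univ.filter fun g => x t g = some e).card

/-- The local number, at station `e`, of a packet that generator `g` injects there in slot `t`;
packets injected in the same slot are ordered by their generators. -/
def packetIndex {m k : ℕ} (x : ℕ → Fin k → Option (Fin m)) (t : ℕ) (g : Fin k) (e : Fin m) : ℕ :=
  SymmetricProtocol.firstIndex (arrivals x) t e +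
    (Finset.univ.filter fun g' => g' < g ∧ x t g' = some e).card

/-- Stability under stochastic injection of rate `lam` on a channel with `m` stations: the expected
number of undelivered packets at any time, and the expected latency of any packet, given that it is
injected, are bounded. -/
def StochasticallyStable (P : SymmetricProtocol) (m : ℕ) (lam : ℝ) : Prop :=
  ∃ B : ℝ≥0, ∀ (Ω : Type u) [MeasurableSpace Ω] (μ : Measure Ω) [IsProbabilityMeasure μ] (k : ℕ)
    (inj : ℕ → Fin k → Ω → Option (Fin m)), IsStochasticInjection μ inj lam →
    (∀ t, ∫⁻ ω, ∫⁻ τ, (SymmetricProtocol.queueLength τ t : ℝ≥0∞)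
        ∂(P.law (arrivals fun t g => inj t g ω)) ∂μ ≤ B) ∧
    ∀ t g e,
      ∫⁻ ω in {ω | inj t g ω = some e},
        ∫⁻ τ, SymmetricProtocol.latency τ e (packetIndex (fun t g => inj t g ω) t g e) t
          ∂(P.law (arrivals fun t g => inj t g ω)) ∂μ
        ≤ B * μ {ω | inj t g ω = some e}

/-- `a t e` packets are injected at station `e` in slot `t`; in every interval of `w` slots at most
`w * lam` packets are injected in total. -/
def IsBoundedAdversary {m : ℕ} (w : ℕ) (lam : ℝ) (a : ℕ → Fin m → ℕ) : Prop :=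
  ∀ t, ((∑ i ∈ Finset.Ico t (t + w), ∑ e, a i e : ℕ) : ℝ) ≤ w * lam

/-- Stability against every `(w, lam)`-bounded adversary on a channel with `m` stations: the expected
number of undelivered packets at any time and the expected latency of any packet are bounded. -/
def AdversariallyStable (P : SymmetricProtocol) (m w : ℕ) (lam : ℝ) : Prop :=
  ∃ B : ℝ≥0, ∀ a : ℕ → Fin m → ℕ, IsBoundedAdversary w lam a →
    (∀ t, ∫⁻ τ, (SymmetricProtocol.queueLength τ t : ℝ≥0∞) ∂(P.law a) ≤ B) ∧
    ∀ t e, ∀ i < a t e,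
      ∫⁻ τ, SymmetricProtocol.latency τ e (SymmetricProtocol.firstIndex a t e + i) t ∂(P.law a) ≤ B

/-! ### The dynamic protocol that is built from the static algorithm

Time is divided into frames of `T` slots.  In the main phase of a frame the static algorithm with
parameter `n` is executed on all packets that were injected in the previous frame; packets that it
does not deliver have *failed*.  In the clean-up phase every station that has failed packets selects,
with probability `1 / m`, the one whose failure is longest ago, and the static algorithm with
parameter `n'` is executed on the selected packets. -/

namespace FrameProtocol

/-- The local state: the number of packets injected so far, those injected in the current frame, the
packets on which the static algorithm is being executed, with the slots of the frame in which they
make an attempt, and the queue of failed packets. -/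
structure LocalState where
  injected : ℕ
  waiting : List ℕ
  active : List (ℕ × Finset ℕ)
  failed : List ℕ

instance : Countable LocalState :=
  Function.Injective.countable
    (f := fun x : LocalState => (x.injected, x.waiting, x.active, x.failed)) (by
      rintro ⟨_, _, _, _⟩ ⟨_, _, _, _⟩ h
      simpa using h)

/-- Independent random patterns with law `p` for all packets of a list. -/
noncomputable def drawAll (p : PMF (Finset ℕ)) : List ℕ → PMF (List (ℕ × Finset ℕ))
  | [] => PMF.pure []
  | j :: l => p.bind fun S => (drawAll p l).map fun r => (j, S) :: r

/-- The active packets that make an attempt in slot `t`. -/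
def action (T t : ℕ) (x : LocalState) : Finset ℕ :=
  ((x.active.filter fun q => t % T ∈ q.2).map Prod.fst).toFinset

/-- The beginning of a frame. -/
noncomputable def startFrame (φ δ : ℝ) (n : ℕ) (x : LocalState) : PMF LocalState :=
  (drawAll (StaticMAC.pattern φ δ n) x.waiting).map fun r =>
    { x with waiting := [], active := r }

/-- The end of the main phase and the beginning of the clean-up phase, in slot `L` of a frame. -/
noncomputable def startCleanUp (m : ℕ) (φ δ : ℝ) (n' L : ℕ) (x : LocalState) : PMF LocalState :=
  match x.failed ++ x.active.map Prod.fst with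
  | [] => PMF.pure { x with active := [], failed := [] }
  | j :: l =>
      (StaticMAC.coin (1 / m)).bind fun b =>
        if b then
          (StaticMAC.pattern φ δ n').map fun S =>
            { x with active := [(j, S.image (L + ·))], failed := j :: l }
        else PMF.pure { x with active := [], failed := j :: l }

/-- Remove a delivered packet and store the new ones. -/
def record (T t : ℕ) (x : LocalState) (a : ℕ) (ack : Bool) : LocalState where
  injected := x.injected + a
  waiting := x.waiting ++ List.range' x.injected a
  active := if ack then x.active.filter fun q => q.1 ∉ action T t x else x.active
  failed := if ack then x.failed.filter fun j => j ∉ action T t x else x.failed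

/-- The transition at the end of slot `t`. -/
noncomputable def update (m T : ℕ) (φ δ : ℝ) (n n' : ℕ) (t : ℕ) (x : LocalState) (a : ℕ)
    (ack : Bool) : PMF LocalState :=
  if (t + 1) % T = 0 then startFrame φ δ n (record T t x a ack)
  else if (t + 1) % T = StaticMAC.length φ δ n then
    startCleanUp m φ δ n' (StaticMAC.length φ δ n) (record T t x a ack)
  else PMF.pure (record T t x a ack)

end FrameProtocol

/-- The dynamic protocol for `m` stations with frame length `T`, which executes the static algorithm
with parameter `n` in the main phase and with parameter `n'` in the clean-up phase of each frame. -/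
noncomputable def frameProtocol (m T : ℕ) (φ δ : ℝ) (n n' : ℕ) : SymmetricProtocol where
  State := FrameProtocol.LocalState
  countable := inferInstance
  init := ⟨0, [], [], []⟩
  action := FrameProtocol.action T
  update := FrameProtocol.update m T φ δ n n'

/-- `P` is built from the static algorithm, with parameters for which both phases are nondegenerate
and fit into a frame. -/
def UsesStaticAlgorithm (P : SymmetricProtocol) (m : ℕ) : Prop :=
  ∃ (T : ℕ) (φ δ : ℝ) (n n' : ℕ), 1 ≤ φ ∧ 0 < δ ∧ 2 ≤ n ∧ 2 ≤ n' ∧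
    StaticMAC.length φ δ n + StaticMAC.length φ δ n' ≤ T ∧ P = frameProtocol m T φ δ n n'

set_option linter.unusedSectionVars false

/-! ### Concentration for functions of independent variables -/

section BoundedDifferences

variable {α : Type*} [MeasurableSpace α] [DiscreteMeasurableSpace α] [Countable α]

/-! Static algorithm. Let `k ≤ x` packets enter an iteration with `D = ⌊x⌋ + 1` delays. A packet has
a delay of its own with probability `(1 - 1/D)^(k-1) ≥ 1/e`, so at least `k/e` deliveries are
expected. Changing one delay changes the number of deliveries by at most 2, so by McDiarmid's
inequality fewer than `k/(e(1+δ))` deliveries are exponentially unlikely in `k`. As long as `x > s`,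
the bound on the number of packets therefore shrinks by the factor `1 - q` up to an error
`n^(-5φ/4)` (`measure_stage1_le`), and the lengths of the iterations form a geometric series with
sum at most `e(1+δ)n`. With at most `s` packets left, each slot of the second stage multiplies their
expected number by at most `1 - 1/(es)` (`lintegral_stage2_le`), and Markov's inequality finishes.

Dynamic protocol. Choose `lam < c < 1/e`, `n = ⌈cT⌉`, `φ = 2` and `δ` with `e(1+δ)c < 1`, so that
both phases fit into a long frame. A main phase on at most `n` packets then has a failure with
probability at most `n^(-2)`. The parameter `n'` is so large that a clean-up phase succeeds with
probability at least `1/2`, whichever stations take part. Hence a station with failed packets loses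
its oldest one with probability at least `1/(2m)` per frame (`Suitable.le_cleanLaw`).

Queues are controlled by the expected potential `exp(θ ℓ)`, `θ = 1/n`, where `ℓ` is the number of
failed packets of a station. Clean-up contracts it by `1 - 2/K`, `K = 8mn`, up to an additive 1, and
the main phase expands it by at most `1 + 1/K` on average, so `K` is an invariant bound
(`one_add_shrink_mul_le`). Against an adversary no frame brings more than `n` packets. For
stochastic injection a Chernoff bound controls the frames that do, and the expansion factor of a
frame is independent of the potential before it (`lintegral_potentialBound_le`).

Latencies use that the failed packets form a first-in-first-out queue: `2m` times the position of a
packet is a supermartingale that loses at least 1 on average per frame while the packet is pending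
(`Suitable.frameExpectation_rank_add_le`). The expected number of such frames is therefore at most
`2m` times an expected queue length.

Everything is computed from one-time marginals (`lintegral_law`). A frame amounts to two rounds of
random draws with deterministic steps in between (`frameResult_spec`). -/

theorem integrable_of_abs_le_of_discrete {β : Type*} [MeasurableSpace β]
    [DiscreteMeasurableSpace β] [Countable β] {μ : Measure β} [IsFiniteMeasure μ] {f : β → ℝ} {M : ℝ}
    (h : ∀ x, |f x| ≤ M) : Integrable f μ :=
  Integrable.of_bound (Measurable.of_discrete (f := f)).aestronglyMeasurable M
    (Filter.Eventually.of_forall h)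

/-- Hoeffding's lemma for a function whose oscillation is at most `c`. -/
theorem integral_exp_sub_integral_le {μ : Measure α} [IsProbabilityMeasure μ] {g : α → ℝ} {c M : ℝ}
    (hM : ∀ x, |g x| ≤ M) (hc : ∀ x y, |g x - g y| ≤ c) (t : ℝ) :
    ∫ x, Real.exp (t * (g x - ∫ y, g y ∂μ)) ∂μ ≤ Real.exp (t ^ 2 * c ^ 2 / 8) := by
  have : Nonempty α := by
    by_contra h
    rw [not_nonempty_iff] at h
    have := measure_univ (μ := μ)
    simp [Set.univ_eq_empty_iff.2 h] at this
  have hbdd : BddBelow (Set.range g) := ⟨-M, by rintro _ ⟨x, rfl⟩; exact (abs_le.1 (hM x)).1⟩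
  -- Oscillation at most `c` puts all values into an interval of length `c` that starts at the
  -- infimum, as Hoeffding's lemma requires.
  have hmem : ∀ x, g x ∈ Set.Icc (⨅ y, g y) ((⨅ y, g y) + c) := fun x => by
    refine ⟨ciInf_le hbdd x, ?_⟩
    have : g x - c ≤ ⨅ y, g y := le_ciInf fun y => by
      have := (abs_le.1 (hc x y)).2
      linarith
    linarith
  have h := (hasSubgaussianMGF_of_mem_Icc (μ := μ) (X := g)
    (Measurable.of_discrete (f := g)).aemeasurable (Filter.Eventually.of_forall hmem)).mgf_le t
  rw [mgf] at h
  refine h.trans (le_of_eq ?_)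
  congr 1
  push_cast
  rw [add_sub_cancel_left, Real.norm_eq_abs, div_pow, sq_abs]
  ring

/-- Induction on the number of coordinates. Averaging over all but the first coordinate gives a
function `g` of oscillation at most `c 0`, to which Hoeffding's lemma applies; with the first
coordinate fixed, the induction hypothesis controls the deviation from `g`. The bound `M` only
provides integrability. -/
theorem integral_exp_sub_integral_pi_fin_le {n : ℕ} (μ : Fin n → Measure α)
    [∀ i, IsProbabilityMeasure (μ i)] {f : (Fin n → α) → ℝ} {c : Fin n → ℝ} {M : ℝ}
    (hM : ∀ x, |f x| ≤ M) (hc : ∀ i x a, |f (Function.update x i a) - f x| ≤ c i) (t : ℝ) :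
    ∫ x, Real.exp (t * (f x - ∫ y, f y ∂Measure.pi μ)) ∂Measure.pi μ ≤
      Real.exp (t ^ 2 * (∑ i, c i ^ 2) / 8) := by
  induction n generalizing M with
  | zero =>
    have : ∀ x y : Fin 0 → α, f x = f y := fun x y => by rw [Subsingleton.elim x y]
    have h : ∀ x, f x - ∫ y, f y ∂Measure.pi μ = 0 := fun x => by
      rw [integral_congr_ae (Filter.Eventually.of_forall fun y => this y x)]
      simp
    simp [h]
  | succ n ih =>
    let ν : Measure (Fin n → α) := Measure.pi fun j => μ j.succ
    have hmp := (measurePreserving_piFinSuccAbove μ 0).symm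
    have key : ∀ F : (Fin (n + 1) → α) → ℝ, ∀ K, (∀ x, |F x| ≤ K) →
        ∫ x, F x ∂Measure.pi μ = ∫ a, ∫ y, F (Fin.cons a y) ∂ν ∂μ 0 := by
      intro F K hK
      rw [← hmp.integral_comp']
      rw [integral_prod _ (integrable_of_abs_le_of_discrete (M := K) fun x => hK _)]
      simp [MeasurableEquiv.piFinSuccAbove, Fin.consEquiv, ν]
    let g : α → ℝ := fun a => ∫ y, f (Fin.cons a y) ∂ν
    have hgM : ∀ a, |g a| ≤ M := fun a => by
      have := norm_integral_le_of_norm_le_const (μ := ν) (f := fun y => f (Fin.cons a y)) (C := M)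
        (Filter.Eventually.of_forall fun y => hM _)
      simpa using this
    have hgc : ∀ a b, |g a - g b| ≤ c 0 := fun a b => by
      have : g a - g b = ∫ y, (f (Fin.cons a y) - f (Fin.cons b y)) ∂ν :=
        (integral_sub (integrable_of_abs_le_of_discrete fun x => hM _)
          (integrable_of_abs_le_of_discrete fun x => hM _)).symm
      rw [this]
      have := norm_integral_le_of_norm_le_const (μ := ν)
        (f := fun y => f (Fin.cons a y) - f (Fin.cons b y)) (C := c 0)
        (Filter.Eventually.of_forall fun y => by
          have := hc 0 (Fin.cons b y) a
          rwa [Fin.update_cons_zero] at this)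
      simpa using this
    have hE : ∫ y, f y ∂Measure.pi μ = ∫ a, g a ∂μ 0 := key f M hM
    have hEM : |∫ a, g a ∂μ 0| ≤ M := by
      have := norm_integral_le_of_norm_le_const (μ := μ 0) (f := g) (C := M)
        (Filter.Eventually.of_forall hgM)
      simpa using this
    have hexp : ∀ u v : ℝ, |u| ≤ M → |v| ≤ M → |Real.exp (t * (u - v))| ≤ Real.exp (|t| * (2 * M)) := by
      intro u v hu hv
      rw [abs_of_pos (Real.exp_pos _)]
      refine Real.exp_le_exp.2 ((le_abs_self _).trans ?_)
      rw [abs_mul]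
      gcongr
      rw [abs_le] at hu hv ⊢
      constructor <;> linarith [hu.1, hu.2, hv.1, hv.2]
    rw [hE, key _ (Real.exp (|t| * (2 * M))) fun x => hexp _ _ (hM x) hEM]
    -- Split the deviation into `f - g a`, covered by the induction hypothesis, and `g a` minus the
    -- mean, which is constant in `y`.
    have hin : ∀ a, ∫ y, Real.exp (t * (f (Fin.cons a y) - ∫ a, g a ∂μ 0)) ∂ν ≤
        Real.exp (t * (g a - ∫ a, g a ∂μ 0)) * Real.exp (t ^ 2 * (∑ i : Fin n, c i.succ ^ 2) / 8) := by
      intro a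
      have := ih (fun j => μ j.succ) (f := fun y => f (Fin.cons a y)) (c := fun i => c i.succ)
        (M := M) (fun y => hM _) (fun i y b => by
          have := hc i.succ (Fin.cons a y) b
          rwa [← Fin.cons_update] at this)
      rw [← mul_le_mul_iff_right₀ (Real.exp_pos (t * (g a - ∫ a, g a ∂μ 0))),
        ← integral_const_mul] at this
      refine le_trans (le_of_eq (integral_congr_ae (Filter.Eventually.of_forall fun y => ?_))) this
      simp only
      rw [← Real.exp_add]
      congr 1
      simp only [g, ν]
      ring
    have hnn : ∀ a, |∫ y, Real.exp (t * (f (Fin.cons a y) - ∫ a, g a ∂μ 0)) ∂ν| ≤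
        Real.exp (|t| * (2 * M)) := fun a => by
      have := norm_integral_le_of_norm_le_const (μ := ν)
        (f := fun y => Real.exp (t * (f (Fin.cons a y) - ∫ a, g a ∂μ 0)))
        (C := Real.exp (|t| * (2 * M)))
        (Filter.Eventually.of_forall fun y => hexp _ _ (hM _) hEM)
      simpa using this
    calc _ ≤ ∫ a, Real.exp (t * (g a - ∫ a, g a ∂μ 0)) *
          Real.exp (t ^ 2 * (∑ i : Fin n, c i.succ ^ 2) / 8) ∂μ 0 :=
          integral_mono (integrable_of_abs_le_of_discrete hnn)
            ((integrable_of_abs_le_of_discrete fun a => hexp _ _ (hgM a) hEM).mul_const _) hin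
      _ ≤ Real.exp (t ^ 2 * c 0 ^ 2 / 8) *
          Real.exp (t ^ 2 * (∑ i : Fin n, c i.succ ^ 2) / 8) := by
          rw [integral_mul_const]
          gcongr
          exact integral_exp_sub_integral_le hgM hgc t
      _ = _ := by
          rw [← Real.exp_add, Fin.sum_univ_succ]
          congr 1
          ring

variable {ι : Type*} [Fintype ι] [DecidableEq ι]

theorem integral_exp_sub_integral_pi_le (μ : Measure α) [IsProbabilityMeasure μ]
    {f : (ι → α) → ℝ} {c : ι → ℝ} {M : ℝ} (hM : ∀ x, |f x| ≤ M)
    (hc : ∀ i x a, |f (Function.update x i a) - f x| ≤ c i) (t : ℝ) :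
    ∫ x, Real.exp (t * (f x - ∫ y, f y ∂Measure.pi fun _ => μ)) ∂Measure.pi (fun _ => μ) ≤
      Real.exp (t ^ 2 * (∑ i, c i ^ 2) / 8) := by
  let e := Fintype.equivFin ι
  have hmp := measurePreserving_piCongrLeft (fun _ : ι => μ) e.symm
  have h2 : ∀ F : (ι → α) → ℝ, ∫ x, F x ∂Measure.pi (fun _ : ι => μ) =
      ∫ x, F (fun i => x (e i)) ∂Measure.pi fun _ : Fin (Fintype.card ι) => μ := by
    intro F
    rw [← hmp.integral_comp']
    congr 1
    ext x
    congr 1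
    ext i
    have := MeasurableEquiv.piCongrLeft_apply_apply e.symm (β := fun _ => α) x (e i)
    rwa [e.symm_apply_apply] at this
  rw [h2, h2, ← e.symm.sum_comp]
  refine integral_exp_sub_integral_pi_fin_le (fun _ => μ) (M := M) (fun x => hM _) (fun i x a => ?_) t
  convert hc (e.symm i) (fun i => x (e i)) a using 4
  ext j
  by_cases h : e j = i
  · subst h; simp
  · rw [Function.update_of_ne h, Function.update_of_ne]
    rintro rfl
    simp at h

/-- McDiarmid's inequality for the lower tail. -/
theorem measureReal_le_integral_sub_le (μ : Measure α) [IsProbabilityMeasure μ]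
    {f : (ι → α) → ℝ} {c : ι → ℝ} {M : ℝ} (hM : ∀ x, |f x| ≤ M)
    (hc : ∀ i x a, |f (Function.update x i a) - f x| ≤ c i) (hpos : 0 < ∑ i, c i ^ 2)
    {r : ℝ} (hr : 0 ≤ r) :
    (Measure.pi fun _ => μ).real {x | f x ≤ (∫ y, f y ∂Measure.pi fun _ => μ) - r} ≤
      Real.exp (-2 * r ^ 2 / ∑ i, c i ^ 2) := by
  set π : Measure (ι → α) := Measure.pi fun _ => μ
  set E := ∫ y, f y ∂π
  set V := ∑ i, c i ^ 2
  have hb : ∀ x, |f x - E| ≤ M + |E| := fun x => (abs_sub _ _).trans (by gcongr; exact hM x)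
  -- `|t| = 4r/V` minimises the Chernoff exponent `-|t| r + t² V / 8`, with minimum `-2r²/V`.
  have h := measure_le_le_exp_mul_mgf (μ := π) (X := fun x => f x - E) (t := -(4 * r / V)) (-r)
    (by have : 0 ≤ 4 * r / V := by positivity
        linarith)
    (integrable_of_abs_le_of_discrete (M := Real.exp (|-(4 * r / V)| * (M + |E|))) fun x => by
      rw [abs_of_pos (Real.exp_pos _)]
      refine Real.exp_le_exp.2 ((le_abs_self _).trans ?_)
      rw [abs_mul]
      gcongr
      exact hb x)
  have hset : {x | f x ≤ E - r} = {x | f x - E ≤ -r} := by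
    ext x
    simp only [Set.mem_ofPred_eq]
    constructor <;> intro h <;> linarith
  rw [hset]
  refine h.trans ?_
  calc _ ≤ Real.exp (- -(4 * r / V) * -r) * Real.exp ((-(4 * r / V)) ^ 2 * V / 8) := by
        gcongr
        exact integral_exp_sub_integral_pi_le μ hM hc _
    _ = _ := by
        rw [← Real.exp_add]
        congr 1
        field_simp
        ring

end BoundedDifferences

/-! ### Products of discrete laws -/

section Discrete

variable {α β γ : Type*} [MeasurableSpace α] [DiscreteMeasurableSpace α] [Countable α]
  [MeasurableSpace β] [DiscreteMeasurableSpace β] [Countable β]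
  [MeasurableSpace γ] [DiscreteMeasurableSpace γ] [Countable γ]

theorem lintegral_toMeasure (p : PMF α) (f : α → ℝ≥0∞) :
    ∫⁻ a, f a ∂p.toMeasure = ∑' a, p a * f a := by
  rw [lintegral_countable']
  refine tsum_congr fun a => ?_
  rw [p.toMeasure_apply_singleton a (measurableSet_singleton a), mul_comm]

theorem lintegral_toMeasure_map (p : PMF α) (g : α → β) (f : β → ℝ≥0∞) :
    ∫⁻ b, f b ∂(p.map g).toMeasure = ∫⁻ a, f (g a) ∂p.toMeasure := by
  rw [← PMF.toMeasure_map g p Measurable.of_discrete,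
    lintegral_map Measurable.of_discrete Measurable.of_discrete]

theorem lintegral_toMeasure_bind (p : PMF α) (q : α → PMF β) (f : β → ℝ≥0∞) :
    ∫⁻ b, f b ∂(p.bind q).toMeasure = ∫⁻ a, ∫⁻ b, f b ∂(q a).toMeasure ∂p.toMeasure := by
  simp_rw [lintegral_toMeasure, PMF.bind_apply, ← ENNReal.tsum_mul_right, ← ENNReal.tsum_mul_left]
  rw [ENNReal.tsum_comm]
  simp_rw [mul_assoc]

/-- Two measures on a countable discrete space coincide if they have the same integrals. -/
theorem ext_of_lintegral_discrete {μ ν : Measure α}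
    (h : ∀ f : α → ℝ≥0∞, ∫⁻ a, f a ∂μ = ∫⁻ a, f a ∂ν) : μ = ν := by
  ext s hs
  have := h (s.indicator 1)
  rwa [lintegral_indicator_one hs, lintegral_indicator_one hs] at this

theorem toMeasure_bind_map (q : PMF α) (r : PMF β) (g : α → β → γ) :
    (q.bind fun a => r.map (g a)).toMeasure =
      (q.toMeasure.prod r.toMeasure).map fun x => g x.1 x.2 := by
  refine ext_of_lintegral_discrete fun f => ?_
  rw [lintegral_toMeasure_bind, lintegral_map Measurable.of_discrete Measurable.of_discrete,
    lintegral_prod _ Measurable.of_discrete.aemeasurable]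
  simp_rw [lintegral_toMeasure_map]

variable {ι : Type*} [Fintype ι]

theorem lintegral_pi_prod (μ : ι → Measure α) (ν : ι → Measure β) [∀ i, IsProbabilityMeasure (μ i)]
    [∀ i, IsProbabilityMeasure (ν i)] (f : (ι → α × β) → ℝ≥0∞) :
    ∫⁻ x, f x ∂Measure.pi (fun i => (μ i).prod (ν i)) =
      ∫⁻ a, ∫⁻ b, f (fun i => (a i, b i)) ∂Measure.pi ν ∂Measure.pi μ := by
  rw [← (measurePreserving_arrowProdEquivProdArrow α β ι μ ν).symm.lintegral_comp_emb
    (MeasurableEquiv.measurableEmbedding _), lintegral_prod _ Measurable.of_discrete.aemeasurable]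
  rfl

theorem lintegral_pi_map {X : ι → Type*} [∀ i, MeasurableSpace (X i)]
    (μ : ∀ i, Measure (X i)) [∀ i, IsProbabilityMeasure (μ i)] {g : ∀ i, X i → β}
    (hg : ∀ i, Measurable (g i)) (f : (ι → β) → ℝ≥0∞) :
    ∫⁻ x, f x ∂Measure.pi (fun i => (μ i).map (g i)) = ∫⁻ x, f (fun i => g i (x i)) ∂Measure.pi μ := by
  have : ∀ i, IsProbabilityMeasure ((μ i).map (g i)) := fun i =>
    Measure.isProbabilityMeasure_map (hg i).aemeasurable
  rw [← Measure.pi_map_pi fun i => (hg i).aemeasurable,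
    lintegral_map Measurable.of_discrete (by fun_prop)]

/-- Independent draws from a law that is generated in two independent steps. -/
theorem lintegral_pi_bind_map (q : PMF α) (r : PMF β) (g : α → β → γ) (f : (ι → γ) → ℝ≥0∞) :
    ∫⁻ x, f x ∂Measure.pi (fun _ : ι => (q.bind fun a => r.map (g a)).toMeasure) =
      ∫⁻ a, ∫⁻ b, f (fun i => g (a i) (b i)) ∂Measure.pi (fun _ : ι => r.toMeasure)
        ∂Measure.pi (fun _ : ι => q.toMeasure) := by
  simp_rw [toMeasure_bind_map]
  rw [lintegral_pi_map (fun _ : ι => q.toMeasure.prod r.toMeasure)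
    (g := fun _ x => g x.1 x.2) (fun _ => Measurable.of_discrete), lintegral_pi_prod]

end Discrete

/-! ### The length of the static algorithm -/

namespace StaticMAC

variable {φ δ : ℝ} {n : ℕ}

theorem rate_pos (hδ : 0 < δ) : 0 < rate δ := by unfold rate; positivity

theorem rate_le (hδ : 0 < δ) : rate δ ≤ Real.exp (-1) := by
  rw [rate, Real.exp_neg, one_div]
  have := Real.exp_pos 1
  gcongr
  nlinarith

theorem exp_neg_one_lt : Real.exp (-1) < 0.368 := Real.exp_neg_one_lt_d9.trans (by norm_num)

theorem rate_lt_one (hδ : 0 < δ) : rate δ < 1 :=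
  (rate_le hδ).trans_lt (exp_neg_one_lt.trans (by norm_num))

theorem one_sub_rate_mem (hδ : 0 < δ) : 0 < 1 - rate δ ∧ 1 - rate δ < 1 :=
  ⟨by linarith [rate_lt_one hδ], by linarith [rate_pos hδ]⟩

theorem inv_rate : (rate δ)⁻¹ = Real.exp 1 * (1 + δ) := by simp [rate]

/-- Indeed `s ≥ 16 ln 2`. Thus `1/s` is a genuine probability, and every iteration of the first
stage has at least two delays. -/
theorem one_lt_s (hδ : 0 < δ) (hφ : 1 ≤ φ) (hn : 2 ≤ n) : 1 < s φ δ n := by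
  have h1 : 1 ≤ (1 + δ) ^ 2 / δ ^ 2 := by
    rw [one_le_div (by positivity)]
    gcongr
    linarith
  have h2 : Real.log 2 ≤ Real.log n := Real.log_le_log (by norm_num) (by exact_mod_cast hn)
  have h3 : 2 < Real.exp 1 := by linarith [Real.exp_one_gt_d9]
  have h4 := Real.log_two_gt_d9
  calc (1 : ℝ) < 2 * 1 * Real.log 2 * (2 * 2 ^ 2 * 1) := by linarith
    _ ≤ 2 * φ * Real.log n * (2 * Real.exp 1 ^ 2 * ((1 + δ) ^ 2 / δ ^ 2)) := by gcongr
    _ = s φ δ n := by unfold s; ring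

/-- Since `-ln(1-q) ≥ q` and `ln s ≥ 0`, the quotient under the ceiling is at most `ln n / q`; there
are only logarithmically many iterations. -/
theorem natCast_xi_le (hδ : 0 < δ) (hφ : 1 ≤ φ) (hn : 2 ≤ n) :
    (xi φ δ n : ℝ) ≤ Real.log n / rate δ + 1 := by
  have hs := one_lt_s hδ hφ hn
  have hn0 : (0 : ℝ) < n := by exact_mod_cast (by omega : 0 < n)
  have hlogn : 0 ≤ Real.log n := Real.log_nonneg (by exact_mod_cast (by omega : 1 ≤ n))
  obtain ⟨h0, h1⟩ := one_sub_rate_mem hδ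
  have hq := rate_pos hδ
  have hle : Real.log (1 - rate δ) ≤ -rate δ := by
    have := Real.log_le_sub_one_of_pos h0
    linarith
  have hx : Real.log (s φ δ n / n) / Real.log (1 - rate δ) ≤ Real.log n / rate δ := by
    rw [Real.log_div (by linarith) hn0.ne', ← neg_div_neg_eq]
    have hlogs : 0 ≤ Real.log (s φ δ n) := Real.log_nonneg hs.le
    calc _ ≤ Real.log n / -Real.log (1 - rate δ) := by
          gcongr
          · linarith
          · linarith
      _ ≤ _ := by
          gcongr
          linarith
  have h2 : (0 : ℝ) ≤ Real.log n / rate δ := by positivity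
  calc (xi φ δ n : ℝ) ≤ (⌈Real.log n / rate δ⌉₊ : ℝ) := by
        unfold xi
        exact_mod_cast Nat.ceil_mono hx
    _ ≤ _ := (Nat.ceil_lt_add_one h2).le

/-- The geometric series sums to at most `1/q = e(1+δ)`. The extra `i` counts the delay `0` of each
iteration. -/
theorem natCast_offset_le (hδ : 0 < δ) (i : ℕ) :
    (offset δ n i : ℝ) ≤ (1 + δ) * Real.exp 1 * n + i := by
  obtain ⟨h0, h1⟩ := one_sub_rate_mem hδ
  have hg : ∑ j ∈ Finset.range i, (1 - rate δ) ^ j ≤ (rate δ)⁻¹ := by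
    rw [← one_div, le_div_iff₀ (rate_pos hδ)]
    have h := geom_sum_mul_neg (1 - rate δ) i
    have := pow_pos h0 i
    rw [sub_sub_cancel] at h
    linarith
  calc (offset δ n i : ℝ) ≤ ∑ j ∈ Finset.range i, ((1 - rate δ) ^ j * n + 1) := by
        unfold offset maxDelay
        push_cast
        gcongr with j
        exact Nat.floor_le (by positivity)
    _ = (∑ j ∈ Finset.range i, (1 - rate δ) ^ j) * n + i := by
        rw [Finset.sum_add_distrib, Finset.sum_mul]
        simp
    _ ≤ (rate δ)⁻¹ * n + i := by gcongr
    _ = _ := by rw [inv_rate]; ring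

theorem exists_length_le (hδ : 0 < δ) : ∃ C : ℝ, 0 ≤ C ∧ ∀ φ : ℝ, 1 ≤ φ → ∀ n : ℕ, 2 ≤ n →
    (length φ δ n : ℝ) ≤ (1 + δ) * Real.exp 1 * n + C * (φ ^ 2 * Real.log n ^ 2) := by
  let D : ℝ := 2 * (2 * Real.exp 1 ^ 2 * (1 + δ) ^ 2 / δ ^ 2) * Real.exp 1 * 2
  -- `2/q` pays for `ln n / q`, `8` for the two roundings up, and `D` for the second stage; all use
  -- `ln n ≥ 1/2` and `φ ≥ 1`.
  refine ⟨2 * (rate δ)⁻¹ + 8 + D, by have := rate_pos hδ; positivity, fun φ hφ n hn => ?_⟩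
  have hn0 : (0 : ℝ) < n := by exact_mod_cast (by omega : 0 < n)
  have hlog : (1 : ℝ) / 2 ≤ Real.log n := by
    have h2 : Real.log 2 ≤ Real.log n := Real.log_le_log (by norm_num) (by exact_mod_cast hn)
    linarith [Real.log_two_gt_d9]
  have hs := one_lt_s hδ hφ hn
  have hst : (stage2Length φ δ n : ℝ) ≤ s φ δ n * Real.exp 1 * (φ + 1) * Real.log n + 1 :=
    (Nat.ceil_lt_add_one (by positivity)).le
  have hφ2 : 1 ≤ φ ^ 2 := by nlinarith
  have hq := inv_pos.2 (rate_pos hδ)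
  have hxi := natCast_xi_le hδ hφ hn
  have hlen : (length φ δ n : ℝ) = offset δ n (xi φ δ n) + stage2Length φ δ n := by
    simp [length]
  have hD : s φ δ n * Real.exp 1 * (φ + 1) * Real.log n ≤ D * (φ ^ 2 * Real.log n ^ 2) := by
    calc _ ≤ s φ δ n * Real.exp 1 * (2 * φ) * Real.log n := by
          gcongr
          linarith
      _ = _ := by simp only [s, D]; ring
  have hL2 : Real.log n ≤ 2 * (φ ^ 2 * Real.log n ^ 2) := by
    calc Real.log n ≤ 2 * (1 * Real.log n ^ 2) := by nlinarith
      _ ≤ _ := by gcongr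
  have h1 : 1 ≤ 4 * (φ ^ 2 * Real.log n ^ 2) := by linarith
  have hx : Real.log n / rate δ ≤ 2 * (rate δ)⁻¹ * (φ ^ 2 * Real.log n ^ 2) := by
    rw [div_eq_mul_inv]
    calc _ ≤ (2 * (φ ^ 2 * Real.log n ^ 2)) * (rate δ)⁻¹ := by gcongr
      _ = _ := by ring
  have := natCast_offset_le (n := n) hδ (xi φ δ n)
  linarith

end StaticMAC

/-! ### The delivery process on a set of packets -/

namespace StaticMAC

section Delivery

variable {ι : Type*} [DecidableEq ι]

/-- The packets of `R` that remain after step `t`. -/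
def deliver (S : ι → Finset ℕ) (t : ℕ) (R : Finset ι) : Finset ι :=
  if (R.filter fun p => t ∈ S p).card = 1 then R \ R.filter fun p => t ∈ S p else R

/-- The packets of `A` that remain after the steps `t, …, t + i - 1`. -/
def remFrom (A : Finset ι) (S : ι → Finset ℕ) (t : ℕ) : ℕ → Finset ι
  | 0 => A
  | i + 1 => deliver S (t + i) (remFrom A S t i)

theorem deliver_subset (S : ι → Finset ℕ) (t : ℕ) (R : Finset ι) : deliver S t R ⊆ R := by
  unfold deliver
  split_ifs
  · exact Finset.sdiff_subset
  · exact subset_rfl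

theorem remFrom_succ_subset (A : Finset ι) (S : ι → Finset ℕ) (t i : ℕ) :
    remFrom A S t (i + 1) ⊆ remFrom A S t i := deliver_subset _ _ _

theorem remFrom_anti (A : Finset ι) (S : ι → Finset ℕ) (t : ℕ) {i j : ℕ} (h : i ≤ j) :
    remFrom A S t j ⊆ remFrom A S t i := by
  induction j, h using Nat.le_induction with
  | base => exact subset_rfl
  | succ j _ ih => exact (remFrom_succ_subset A S t j).trans ih

theorem remFrom_subset (A : Finset ι) (S : ι → Finset ℕ) (t i : ℕ) : remFrom A S t i ⊆ A :=
  remFrom_anti A S t (Nat.zero_le i)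

theorem remFrom_add (A : Finset ι) (S : ι → Finset ℕ) (t i j : ℕ) :
    remFrom A S t (i + j) = remFrom (remFrom A S t i) S (t + i) j := by
  induction j with
  | zero => rfl
  | succ j ih => rw [← add_assoc, remFrom, remFrom, ih, add_assoc]

theorem deliver_congr {S S' : ι → Finset ℕ} {t t' : ℕ} {R : Finset ι}
    (h : ∀ p ∈ R, t ∈ S p ↔ t' ∈ S' p) : deliver S t R = deliver S' t' R := by
  unfold deliver
  rw [Finset.filter_congr h]

theorem remFrom_congr {A : Finset ι} {S S' : ι → Finset ℕ} {t t' i : ℕ}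
    (h : ∀ p ∈ A, ∀ j < i, t + j ∈ S p ↔ t' + j ∈ S' p) :
    remFrom A S t i = remFrom A S' t' i := by
  induction i with
  | zero => rfl
  | succ i ih =>
    rw [remFrom, remFrom, ih fun p hp j hj => h p hp j (by omega)]
    exact deliver_congr fun p hp => h p (remFrom_subset _ _ _ _ hp) i (by omega)

/-- The process sees only patterns, not names of packets. This transfers the analysis with
independent coordinates to the packets in the stations. -/
theorem remFrom_map {κ : Type*} [DecidableEq κ] (e : κ ↪ ι) (A : Finset κ) (S : ι → Finset ℕ)
    (t i : ℕ) : remFrom (A.map e) S t i = (remFrom A (fun p => S (e p)) t i).map e := by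
  induction i with
  | zero => rfl
  | succ i ih =>
    rw [remFrom, remFrom, ih]
    unfold deliver
    rw [Finset.filter_map, Finset.card_map]
    simp only [Function.comp_def]
    split_ifs
    · rw [Finset.map_sdiff]
    · rfl

theorem remaining_eq_remFrom {k : ℕ} (S : Fin k → Finset ℕ) (t : ℕ) :
    remaining S t = remFrom Finset.univ S 0 t := by
  induction t with
  | zero => rfl
  | succ t ih => rw [remaining, remFrom, ih, deliver, zero_add]

/-- In an iteration of the first stage exactly the packets with a unique delay are delivered. -/
theorem remFrom_delays {R : Finset ι} {S : ι → Finset ℕ} {o : ℕ} (hS : ∀ p, S p ⊆ Finset.range o)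
    (d : ι → ℕ) (i : ℕ) :
    remFrom R (fun p => insert (o + d p) (S p)) o i =
      R.filter fun p => d p < i → ¬ ∀ q ∈ R, q ≠ p → d q ≠ d p := by
  induction i with
  | zero => simp [remFrom]
  | succ i ih =>
    have hmem : ∀ p, o + i ∈ insert (o + d p) (S p) ↔ d p = i := fun p => by
      have : o + i ∉ S p := fun h => by have := Finset.mem_range.1 (hS p h); omega
      simp only [Finset.mem_insert, this, or_false]
      omega
    -- Packets with delay `i` have made no attempt in this iteration before step `o + i`, so all of
    -- them are still present.
    have hA : ((R.filter fun p => d p < i → ¬ ∀ q ∈ R, q ≠ p → d q ≠ d p).filter fun p =>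
        o + i ∈ insert (o + d p) (S p)) = R.filter fun p => d p = i := by
      ext p
      simp only [Finset.mem_filter, hmem]
      constructor
      · rintro ⟨⟨h, -⟩, rfl⟩; exact ⟨h, rfl⟩
      · rintro ⟨h, rfl⟩; exact ⟨⟨h, fun h => absurd h (lt_irrefl _)⟩, rfl⟩
    rw [remFrom, ih, deliver, hA]
    ext p
    split_ifs with h1
    · obtain ⟨x, hx⟩ := Finset.card_eq_one.1 h1
      have hx' : ∀ q, (q ∈ R ∧ d q = i) ↔ q = x := fun q => by
        simpa using Finset.ext_iff.1 hx q
      simp only [Finset.mem_sdiff, Finset.mem_filter]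
      constructor
      · rintro ⟨⟨hp, h⟩, h'⟩
        refine ⟨hp, fun hlt => h ?_⟩
        have : d p ≠ i := fun h => h' ⟨hp, h⟩
        omega
      · rintro ⟨hp, h⟩
        refine ⟨⟨hp, fun hlt => h (by omega)⟩, fun ⟨_, hpi⟩ => ?_⟩
        refine h (by omega) fun q hq hqp hqd => hqp ?_
        rw [(hx' q).1 ⟨hq, hqd.trans hpi⟩, (hx' p).1 ⟨hp, hpi⟩]
    · simp only [Finset.mem_filter]
      refine and_congr_right fun hp => ⟨fun h hlt hu => ?_, fun h hlt => h (by omega)⟩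
      rcases Nat.lt_succ_iff_lt_or_eq.1 hlt with hlt | heq
      · exact h hlt hu
      · apply h1
        rw [Finset.card_eq_one]
        refine ⟨p, Finset.ext fun q => ?_⟩
        simp only [Finset.mem_filter, Finset.mem_singleton]
        constructor
        · rintro ⟨hq, hqi⟩
          by_contra hne
          exact hu q hq hne (hqi.trans heq.symm)
        · rintro rfl; exact ⟨hp, heq⟩

/-- The packets of `R` whose delay differs from the delays of the others. -/
def uniqueDelay (R : Finset ι) (d : ι → ℕ) : Finset ι :=
  R.filter fun p => ∀ q ∈ R, q ≠ p → d q ≠ d p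

theorem uniqueDelay_subset (R : Finset ι) (d : ι → ℕ) : uniqueDelay R d ⊆ R :=
  Finset.filter_subset _ _

theorem card_remFrom_add_card_uniqueDelay {R : Finset ι} {S : ι → Finset ℕ} {o : ℕ}
    (hS : ∀ p, S p ⊆ Finset.range o) {d : ι → ℕ} {i : ℕ} (hd : ∀ p, d p < i) :
    (remFrom R (fun p => insert (o + d p) (S p)) o i).card + (uniqueDelay R d).card = R.card := by
  rw [remFrom_delays hS, add_comm, ← Finset.card_filter_add_card_filter_not (s := R)
    fun p => ∀ q ∈ R, q ≠ p → d q ≠ d p, uniqueDelay]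
  congr 2
  exact Finset.filter_congr fun p _ => ⟨fun h => h (hd p), fun h _ => h⟩

/-- A packet `p ≠ i` that is unique under `d` but not under `d'` can only collide with `i`, so `d p
= d' i`; at most one packet unique under `d` has this delay. The packet `i` itself is the second
possible loss. -/
theorem card_uniqueDelay_le_add_two {R : Finset ι} {d d' : ι → ℕ} {i : ι}
    (h : ∀ j, j ≠ i → d j = d' j) :
    (uniqueDelay R d).card ≤ (uniqueDelay R d').card + 2 := by
  have hsub : uniqueDelay R d ⊆ (uniqueDelay R d' ∪ {i}) ∪
      (uniqueDelay R d).filter fun p => d p = d' i := by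
    intro p hp
    simp only [Finset.mem_union, Finset.mem_singleton, Finset.mem_filter]
    by_contra hcon
    push Not at hcon
    obtain ⟨⟨h1, h2⟩, h3⟩ := hcon
    simp only [uniqueDelay, Finset.mem_filter] at hp h1
    refine h1 ⟨hp.1, fun q hq hqp hqd => ?_⟩
    by_cases hqi : q = i
    · subst hqi
      exact h3 (by simpa only [uniqueDelay, Finset.mem_filter] using hp)
        ((h p h2).trans hqd.symm)
    · exact hp.2 q hq hqp ((h q hqi).trans (hqd.trans (h p h2).symm))
  have hone : ((uniqueDelay R d).filter fun p => d p = d' i).card ≤ 1 := by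
    rw [Finset.card_le_one]
    intro p hp q hq
    simp only [uniqueDelay, Finset.mem_filter] at hp hq
    by_contra hne
    exact hq.1.2 p hp.1.1 hne (hp.2.trans hq.2.symm)
  calc _ ≤ _ := Finset.card_le_card hsub
    _ ≤ ((uniqueDelay R d').card + 1) + 1 :=
        (Finset.card_union_le _ _).trans (add_le_add
          ((Finset.card_union_le _ _).trans (by simp)) hone)

theorem abs_card_uniqueDelay_update_sub_le (R : Finset ι) (i : ι) (d : ι → ℕ) (a : ℕ) :
    |((uniqueDelay R (Function.update d i a)).card : ℝ) - (uniqueDelay R d).card| ≤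
      if i ∈ R then 2 else 0 := by
  split_ifs with hi
  · have h1 := card_uniqueDelay_le_add_two (R := R) (d := Function.update d i a) (d' := d) (i := i)
      fun j hj => Function.update_of_ne hj _ _
    have h2 := card_uniqueDelay_le_add_two (R := R) (d := d) (d' := Function.update d i a) (i := i)
      fun j hj => (Function.update_of_ne hj _ _).symm
    have h1' : ((uniqueDelay R (Function.update d i a)).card : ℝ) ≤ (uniqueDelay R d).card + 2 := by
      exact_mod_cast h1
    have h2' : ((uniqueDelay R d).card : ℝ) ≤ (uniqueDelay R (Function.update d i a)).card + 2 := by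
      exact_mod_cast h2
    rw [abs_le]
    constructor <;> linarith
  · have : uniqueDelay R (Function.update d i a) = uniqueDelay R d := by
      unfold uniqueDelay
      refine Finset.filter_congr fun p hp => forall₂_congr fun q hq => ?_
      rw [Function.update_of_ne (by rintro rfl; exact hi hq),
        Function.update_of_ne (by rintro rfl; exact hi hp)]
    simp [this]

end Delivery

end StaticMAC

/-! ### Independent draws -/

section Draws

variable {α : Type*} [MeasurableSpace α] [DiscreteMeasurableSpace α] [Countable α]
variable {ι : Type*} [Fintype ι] [DecidableEq ι]

/-- The probability that `p` is the only element of `R` whose draw lies in `B`. -/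
theorem measureReal_pi_only (μ : Measure α) [IsProbabilityMeasure μ] (B : Set α) (R : Finset ι)
    {p : ι} (hp : p ∈ R) :
    (Measure.pi fun _ : ι => μ).real {x | x p ∈ B ∧ ∀ q ∈ R, q ≠ p → x q ∉ B} =
      μ.real B * (1 - μ.real B) ^ (R.card - 1) := by
  have hset : {x : ι → α | x p ∈ B ∧ ∀ q ∈ R, q ≠ p → x q ∉ B} =
      Set.univ.pi fun q => if q = p then B else if q ∈ R then Bᶜ else Set.univ := by
    ext x
    simp only [Set.mem_ofPred_eq, Set.mem_univ_pi]
    constructor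
    · rintro ⟨h1, h2⟩ q
      split_ifs with h3 h4
      · rwa [h3]
      · exact h2 q h4 h3
      · trivial
    · intro h
      refine ⟨by simpa using h p, fun q hq hqp => ?_⟩
      have := h q
      rwa [if_neg hqp, if_pos hq] at this
  rw [hset, measureReal_def, Measure.pi_pi, ENNReal.toReal_prod,
    ← Finset.mul_prod_erase _ _ (Finset.mem_univ p), if_pos rfl, ← measureReal_def]
  congr 1
  have : ∀ q ∈ Finset.univ.erase p,
      (μ (if q = p then B else if q ∈ R then Bᶜ else Set.univ)).toReal =
        if q ∈ R.erase p then 1 - μ.real B else 1 := by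
    intro q hq
    have hqp := Finset.ne_of_mem_erase hq
    rw [if_neg hqp, ← measureReal_def]
    by_cases hqR : q ∈ R
    · rw [if_pos hqR, if_pos (Finset.mem_erase.2 ⟨hqp, hqR⟩)]
      exact probReal_compl_eq_one_sub (MeasurableSet.of_discrete)
    · rw [if_neg hqR, if_neg fun h => hqR (Finset.mem_of_mem_erase h)]
      simp
  rw [Finset.prod_congr rfl this, Finset.prod_ite, Finset.prod_const, Finset.prod_const_one, mul_one]
  congr 1
  rw [← Finset.card_erase_of_mem hp]
  congr 1
  ext q
  simp only [Finset.mem_filter, Finset.mem_erase, Finset.mem_univ, and_true]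
  tauto

theorem ae_pi_of_forall_support {ι' : Type*} [Fintype ι'] (p : PMF α) {Q : α → Prop}
    (h : ∀ a ∈ p.support, Q a) :
    ∀ᵐ x ∂Measure.pi (fun _ : ι' => p.toMeasure), ∀ i, Q (x i) := by
  rw [ae_all_iff]
  intro i
  refine (Measure.quasiMeasurePreserving_eval (fun _ : ι' => p.toMeasure) i).ae (p := Q) ?_
  rw [ae_iff, p.toMeasure_apply_eq_zero_iff MeasurableSet.of_discrete, Set.disjoint_left]
  exact fun a ha hn => hn (h a ha)

/-- `(1 - 1 / x) ^ k ≥ 1 / e` for `k ≤ x - 1`. -/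
theorem exp_neg_one_le_one_sub_inv_pow {x : ℝ} (hx : 1 < x) {k : ℕ} (hk : (k : ℝ) ≤ x - 1) :
    Real.exp (-1) ≤ (1 - 1 / x) ^ k := by
  -- Write `1 - 1/x` as the inverse of `1 + 1/(x-1)` and use `1 + y ≤ exp y`.
  have h1 : Real.exp (-(1 / (x - 1))) ≤ 1 - 1 / x := by
    have h2 : 1 - 1 / x = (1 / (x - 1) + 1)⁻¹ := by
      have h3 : x - 1 ≠ 0 := by linarith
      have h4 : x ≠ 0 := by linarith
      rw [div_add_one h3, inv_div, add_sub_cancel, sub_div, div_self h4]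
    rw [h2, Real.exp_neg]
    have h3 : 0 < 1 / (x - 1) := by
      have : 0 < x - 1 := by linarith
      positivity
    exact inv_anti₀ (by linarith) (Real.add_one_le_exp _)
  calc Real.exp (-1) ≤ Real.exp (-(1 / (x - 1)) * k) := by
        rw [Real.exp_le_exp]
        have h : 0 < x - 1 := by linarith
        have : k / (x - 1) ≤ 1 := (div_le_one h).2 hk
        calc (-1 : ℝ) ≤ -(k / (x - 1)) := by linarith
          _ = _ := by ring
    _ = Real.exp (-(1 / (x - 1))) ^ k := by rw [← Real.exp_nat_mul, mul_comm]
    _ ≤ _ := by gcongr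

end Draws

/-! ### One iteration of the first stage, one step of the second stage -/

namespace StaticMAC

variable {ι : Type*} [Fintype ι] [DecidableEq ι]

theorem measureReal_uniform_singleton {D v : ℕ} (h : (Finset.range D).Nonempty) (hv : v < D) :
    (PMF.uniformOfFinset (Finset.range D) h).toMeasure.real {v} = 1 / D := by
  rw [measureReal_def, PMF.toMeasure_apply_singleton _ _ (measurableSet_singleton v),
    PMF.uniformOfFinset_apply_of_mem _ (Finset.mem_range.2 hv)]
  simp

/-- The expected number of unique delays. -/
theorem le_integral_card_uniqueDelay {D : ℕ} (hD : 1 < D) (h : (Finset.range D).Nonempty)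
    {R : Finset ι} (hR : R.card ≤ D) :
    (R.card : ℝ) * Real.exp (-1) ≤ ∫ d, ((uniqueDelay R d).card : ℝ)
      ∂Measure.pi fun _ : ι => (PMF.uniformOfFinset (Finset.range D) h).toMeasure := by
  set μ := (PMF.uniformOfFinset (Finset.range D) h).toMeasure
  set π := Measure.pi fun _ : ι => μ
  have hcard : ∀ d : ι → ℕ, ((uniqueDelay R d).card : ℝ) =
      ∑ p ∈ R, Set.indicator {d : ι → ℕ | ∀ q ∈ R, q ≠ p → d q ≠ d p} (fun _ => (1 : ℝ)) d := by
    intro d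
    rw [uniqueDelay, Finset.card_filter]
    push_cast
    refine Finset.sum_congr rfl fun p _ => ?_
    by_cases hu : ∀ q ∈ R, q ≠ p → d q ≠ d p
    · rw [if_pos hu, Set.indicator_of_mem (by exact hu)]
    · rw [if_neg hu, Set.indicator_of_notMem (by exact hu)]
  simp_rw [hcard]
  rw [integral_finsetSum _ fun p _ => integrable_of_abs_le_of_discrete (M := 1) fun d => by
    by_cases hd : d ∈ {d : ι → ℕ | ∀ q ∈ R, q ≠ p → d q ≠ d p} <;> simp [hd]]
  rw [← nsmul_eq_mul]
  refine Finset.card_nsmul_le_sum _ _ _ fun p hp => ?_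
  rw [integral_indicator_const _ MeasurableSet.of_discrete, smul_eq_mul, mul_one]
  -- The packet `p` is unique as soon as it is alone at some value `v`. These events are disjoint,
  -- and summing over the `D` values cancels the factor `1/D`.
  have hdisj : Set.PairwiseDisjoint (↑(Finset.range D))
      fun v => {d : ι → ℕ | d p ∈ ({v} : Set ℕ) ∧ ∀ q ∈ R, q ≠ p → d q ∉ ({v} : Set ℕ)} := by
    intro v _ w _ hvw
    rw [Function.onFun, Set.disjoint_left]
    rintro d ⟨hd, -⟩ ⟨hd', -⟩
    exact hvw (hd.symm.trans hd')
  have hsub : (⋃ v ∈ Finset.range D,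
      {d : ι → ℕ | d p ∈ ({v} : Set ℕ) ∧ ∀ q ∈ R, q ≠ p → d q ∉ ({v} : Set ℕ)}) ⊆
        {d : ι → ℕ | ∀ q ∈ R, q ≠ p → d q ≠ d p} := by
    intro d hd
    simp only [Set.mem_iUnion] at hd
    obtain ⟨v, -, hv, hd⟩ := hd
    intro q hq hqp he
    exact hd q hq hqp (he.trans hv)
  refine le_trans ?_ (measureReal_mono hsub)
  rw [measureReal_biUnion_finset hdisj fun _ _ => MeasurableSet.of_discrete]
  have hterm : ∀ v ∈ Finset.range D,
      π.real {d : ι → ℕ | d p ∈ ({v} : Set ℕ) ∧ ∀ q ∈ R, q ≠ p → d q ∉ ({v} : Set ℕ)} =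
        1 / D * (1 - 1 / D) ^ (R.card - 1) := fun v hv => by
    rw [measureReal_pi_only μ _ R hp, measureReal_uniform_singleton h (Finset.mem_range.1 hv)]
  rw [Finset.sum_congr rfl hterm, Finset.sum_const, Finset.card_range, nsmul_eq_mul, ← mul_assoc,
    mul_one_div_cancel (by positivity), one_mul]
  refine exp_neg_one_le_one_sub_inv_pow (by exact_mod_cast hD) ?_
  rw [le_sub_iff_add_le]
  have : R.card - 1 + 1 ≤ D := by omega
  exact_mod_cast this

theorem uniform_mem_lt {D v : ℕ} (h : (Finset.range D).Nonempty)
    (hv : v ∈ (PMF.uniformOfFinset (Finset.range D) h).support) : v < D := by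
  simpa using hv

/-- If at most `x` packets take part in an iteration of the first stage with largest delay `⌊x⌋`,
more than `(1 - q) x` of them remain with an exponentially small probability only. -/
theorem measure_iteration_le {δ x : ℝ} (hδ : 0 < δ) (hx : 1 < x) {o D : ℕ} (hD : D = ⌊x⌋₊ + 1)
    (h : (Finset.range D).Nonempty) {S : ι → Finset ℕ} (hS : ∀ p, S p ⊆ Finset.range o)
    {R : Finset ι} (hR : (R.card : ℝ) ≤ x) :
    (Measure.pi fun _ : ι => (PMF.uniformOfFinset (Finset.range D) h).toMeasure)
        {d | (1 - rate δ) * x < (remFrom R (fun p => insert (o + d p) (S p)) o D).card} ≤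
      ENNReal.ofReal
        (Real.exp (-((1 - rate δ) * x * (δ ^ 2 / (2 * Real.exp 1 ^ 2 * (1 + δ) ^ 2))))) := by
  set μ := (PMF.uniformOfFinset (Finset.range D) h).toMeasure
  set π := Measure.pi fun _ : ι => μ
  obtain ⟨hq0, hq1⟩ := one_sub_rate_mem hδ
  have hRD : R.card ≤ D := by
    have := Nat.le_floor hR
    omega
  have hD1 : 1 < D := by
    have : 1 ≤ ⌊x⌋₊ := Nat.le_floor (by exact_mod_cast hx.le)
    omega
  have hae : ∀ᵐ d ∂π, ∀ p, d p < D := ae_pi_of_forall_support _ fun v hv => uniform_mem_lt h hv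
  have hrem : ∀ d : ι → ℕ, (∀ p, d p < D) →
      ((remFrom R (fun p => insert (o + d p) (S p)) o D).card : ℝ) =
        R.card - (uniqueDelay R d).card := by
    intro d hd
    have h1 := card_remFrom_add_card_uniqueDelay (R := R) hS hd
    exact eq_sub_of_add_eq (by exact_mod_cast h1)
  -- If `R` is already small enough, the event is null. Otherwise `|R| > (1-q)x`, which is needed
  -- because the tail bound is exponential in `|R|` and not in `x`.
  by_cases hsmall : (R.card : ℝ) ≤ (1 - rate δ) * x
  · refine le_trans (le_of_eq ?_) zero_le
    refine measure_mono_null (fun d hd => ?_) (ae_iff.1 hae)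
    simp only [Set.mem_ofPred_eq] at hd ⊢
    intro hd'
    rw [hrem d hd'] at hd
    have : (0 : ℝ) ≤ (uniqueDelay R d).card := by positivity
    linarith
  push Not at hsmall
  have hRpos : (0 : ℝ) < R.card := lt_trans (by positivity) hsmall
  -- The gap between the expected `|R|/e` deliveries and the `q |R|` that suffice.
  let r : ℝ := R.card * (δ / (Real.exp 1 * (1 + δ)))
  have hr0 : 0 ≤ r := by positivity
  have hV : ∑ i, (if i ∈ R then (2 : ℝ) else 0) ^ 2 = 4 * R.card := by
    rw [← Finset.sum_subset (Finset.subset_univ R) fun i _ hi => by simp [hi],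
      Finset.sum_congr rfl fun i hi => by rw [if_pos hi], Finset.sum_const, nsmul_eq_mul]
    ring
  have hmd := measureReal_le_integral_sub_le μ (f := fun d : ι → ℕ => ((uniqueDelay R d).card : ℝ))
    (c := fun i => if i ∈ R then 2 else 0) (M := R.card)
    (fun d => by
      rw [abs_of_nonneg (by positivity)]
      exact_mod_cast Finset.card_le_card (uniqueDelay_subset R d))
    (fun i d a => abs_card_uniqueDelay_update_sub_le R i d a) (by rw [hV]; positivity) hr0
  have hE := le_integral_card_uniqueDelay hD1 h hRD
  have hsub : π {d | (1 - rate δ) * x < (remFrom R (fun p => insert (o + d p) (S p)) o D).card} ≤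
      π {d | ((uniqueDelay R d).card : ℝ) ≤
        (∫ d, ((uniqueDelay R d).card : ℝ) ∂π) - r} := by
    refine measure_mono_ae ?_
    filter_upwards [hae] with d hd hlt
    change _ < _ at hlt
    change _ ≤ _
    rw [hrem d hd] at hlt
    -- If more than `(1-q)x ≥ (1-q)|R|` packets remain, fewer than `q|R|` were delivered.
    have h1 : (uniqueDelay R d).card ≤ rate δ * R.card := by nlinarith
    have h2 : rate δ * R.card = R.card * Real.exp (-1) - r := by
      simp only [rate, r, Real.exp_neg]
      have := Real.exp_pos 1
      field_simp
      ring
    linarith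
  refine hsub.trans ?_
  rw [← ofReal_measureReal]
  refine ENNReal.ofReal_le_ofReal (hmd.trans ?_)
  rw [Real.exp_le_exp, hV]
  calc -2 * r ^ 2 / (4 * R.card) = -(R.card * (δ ^ 2 / (2 * Real.exp 1 ^ 2 * (1 + δ) ^ 2))) := by
        simp only [r]
        have := Real.exp_pos 1
        field_simp
        ring
    _ ≤ _ := by gcongr

theorem measureReal_coin_true {p : ℝ} (h0 : 0 ≤ p) (h1 : p ≤ 1) :
    (coin p).toMeasure.real {true} = p := by
  rw [measureReal_def, PMF.toMeasure_apply_singleton _ _ (measurableSet_singleton true), coin,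
    PMF.ofFintype_apply]
  have : p.toNNReal ≤ 1 := Real.toNNReal_le_one.2 h1
  simp [h0, this]

/-- The expected number of packets that remain after a step of the second stage. -/
theorem lintegral_card_deliver_le {s : ℝ} (hs : 1 < s) {t : ℕ} {S : ι → Finset ℕ}
    (hS : ∀ p, S p ⊆ Finset.range t) {R : Finset ι} (hR : (R.card : ℝ) ≤ s) :
    ∫⁻ b, ((deliver (fun p => if b p then insert t (S p) else S p) t R).card : ℝ≥0∞)
        ∂Measure.pi (fun _ : ι => (coin (1 / s)).toMeasure) ≤
      ENNReal.ofReal (1 - 1 / (s * Real.exp 1)) * R.card := by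
  set μ := (coin (1 / s)).toMeasure
  set π := Measure.pi fun _ : ι => μ
  have hs0 : 0 < s := by linarith
  let E : ι → Set (ι → Bool) := fun p =>
    {b | b p ∈ ({true} : Set Bool) ∧ ∀ q ∈ R, q ≠ p → b q ∉ ({true} : Set Bool)}
  -- The indicators add up to 1 exactly when one packet is alone in its attempt, and that packet is
  -- then removed.
  have hle : ∀ b : ι → Bool,
      ((deliver (fun p => if b p then insert t (S p) else S p) t R).card : ℝ) ≤
        R.card - ∑ p ∈ R, (E p).indicator (fun _ => (1 : ℝ)) b := by
    intro b
    have hmem : ∀ p, (t ∈ if b p then insert t (S p) else S p) ↔ b p = true := fun p => by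
      have : t ∉ S p := fun h => lt_irrefl _ (Finset.mem_range.1 (hS p h))
      by_cases hb : b p <;> simp [hb, this]
    unfold deliver
    simp only [hmem]
    by_cases hone : ∃ p ∈ R, b ∈ E p
    · obtain ⟨p, hp, hbp, hq⟩ := hone
      have hf : (R.filter fun p => b p = true) = {p} := by
        ext q
        simp only [Finset.mem_filter, Finset.mem_singleton]
        constructor
        · rintro ⟨hqR, hbq⟩
          by_contra hne
          exact hq q hqR hne hbq
        · rintro rfl; exact ⟨hp, hbp⟩
      have hsum : ∑ q ∈ R, (E q).indicator (fun _ => (1 : ℝ)) b = 1 := by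
        rw [Finset.sum_eq_single p]
        · rw [Set.indicator_of_mem]
          exact ⟨hbp, hq⟩
        · intro q hqR hqp
          rw [Set.indicator_of_notMem]
          rintro ⟨hbq, -⟩
          exact hq q hqR hqp hbq
        · exact fun h => absurd hp h
      rw [hf, Finset.card_singleton, if_pos rfl, hsum, Finset.card_sdiff_of_subset (by simpa using hp),
        Finset.card_singleton, Nat.cast_sub (Finset.card_pos.2 ⟨p, hp⟩), Nat.cast_one]
    · push Not at hone
      rw [Finset.sum_eq_zero fun p hp => Set.indicator_of_notMem (hone p hp) _, sub_zero]
      split_ifs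
      · exact_mod_cast Finset.card_le_card Finset.sdiff_subset
      · exact le_rfl
  have hint : ∀ p, Integrable ((E p).indicator fun _ => (1 : ℝ)) π := fun p =>
    integrable_of_abs_le_of_discrete (M := 1) fun b => by by_cases hb : b ∈ E p <;> simp [hb]
  have hI : Integrable (fun b : ι → Bool =>
      (R.card : ℝ) - ∑ p ∈ R, (E p).indicator (fun _ => (1 : ℝ)) b) π :=
    (integrable_const _).sub (integrable_finsetSum _ fun p _ => hint p)
  have hval : ∫ b, ((R.card : ℝ) - ∑ p ∈ R, (E p).indicator (fun _ => (1 : ℝ)) b) ∂π ≤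
      (1 - 1 / (s * Real.exp 1)) * R.card := by
    rw [integral_sub (integrable_const _) (integrable_finsetSum _ fun p _ => hint p),
      integral_finsetSum _ fun p _ => hint p]
    -- At most `s` packets compete, so the others are all silent with probability `(1 - 1/s)^(|R|-1)
    -- ≥ 1/e`.
    have hterm : ∀ p ∈ R, 1 / (s * Real.exp 1) ≤ ∫ b, (E p).indicator (fun _ => (1 : ℝ)) b ∂π := by
      intro p hp
      rw [integral_indicator_const _ MeasurableSet.of_discrete, smul_eq_mul, mul_one,
        measureReal_pi_only μ _ R hp,
        measureReal_coin_true (by positivity) ((div_le_one hs0).2 hs.le)]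
      have := exp_neg_one_le_one_sub_inv_pow hs (k := R.card - 1) (by
        have h1 : 1 ≤ R.card := Finset.card_pos.2 ⟨p, hp⟩
        rw [Nat.cast_sub h1, Nat.cast_one]
        linarith)
      calc 1 / (s * Real.exp 1) = 1 / s * Real.exp (-1) := by rw [Real.exp_neg]; field_simp
        _ ≤ _ := by gcongr
    have := Finset.card_nsmul_le_sum _ _ _ hterm
    rw [nsmul_eq_mul] at this
    simp only [integral_const, probReal_univ, one_smul]
    linarith
  calc _ ≤ ∫⁻ b, ENNReal.ofReal
          ((R.card : ℝ) - ∑ p ∈ R, (E p).indicator (fun _ => (1 : ℝ)) b) ∂π := by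
        refine lintegral_mono fun b => ?_
        rw [← ENNReal.ofReal_natCast]
        exact ENNReal.ofReal_le_ofReal (hle b)
    _ = ENNReal.ofReal (∫ b, ((R.card : ℝ) - ∑ p ∈ R, (E p).indicator (fun _ => (1 : ℝ)) b) ∂π) := by
        rw [ofReal_integral_eq_lintegral_ofReal hI]
        exact Filter.Eventually.of_forall fun b => le_trans (by positivity) (hle b)
    _ ≤ _ := by
        refine (ENNReal.ofReal_le_ofReal hval).trans (le_of_eq ?_)
        rw [ENNReal.ofReal_mul' (by positivity), ENNReal.ofReal_natCast]

end StaticMAC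

/-! ### The success probability of the static algorithm -/

namespace StaticMAC

theorem offset_succ (δ : ℝ) (n i : ℕ) : offset δ n (i + 1) = offset δ n i + (maxDelay δ n i + 1) :=
  Finset.sum_range_succ _ _

/-- Attempts drawn so far lie in the past of `offset`. Hence later draws do not alter the process up
to that step, and the stages can be treated one after the other. -/
theorem subset_of_mem_support_stage1 {δ : ℝ} {n i : ℕ} :
    ∀ S ∈ (stage1 δ n i).support, S ⊆ Finset.range (offset δ n i) := by
  induction i with
  | zero => simp [stage1]
  | succ i ih =>
    intro S hS
    simp only [stage1, PMF.mem_support_bind_iff, PMF.mem_support_map_iff] at hS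
    obtain ⟨S', hS', d, hd, rfl⟩ := hS
    have hd' := uniform_mem_lt _ hd
    rw [offset_succ]
    refine Finset.insert_subset (Finset.mem_range.2 (by omega)) ((ih _ hS').trans ?_)
    exact Finset.range_subset_range.2 (by omega)

theorem subset_of_mem_support_stage2 {φ δ : ℝ} {n l : ℕ} :
    ∀ S ∈ (stage2 φ δ n l).support, S ⊆ Finset.range (offset δ n (xi φ δ n) + l) := by
  induction l with
  | zero => exact subset_of_mem_support_stage1
  | succ l ih =>
    intro S hS
    simp only [stage2, PMF.mem_support_bind_iff, PMF.mem_support_map_iff] at hS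
    obtain ⟨S', hS', b, -, rfl⟩ := hS
    have h := (ih _ hS').trans (Finset.range_subset_range.2 (Nat.le_succ _))
    split_ifs
    · exact Finset.insert_subset (Finset.mem_range.2 (by omega)) h
    · exact h

/-- Dividing by the negative `ln(1-q)` reverses the inequality. So every iteration that is executed
still has room for more than `s` packets, enough for concentration. -/
theorem s_lt_of_lt_xi {φ δ : ℝ} {n i : ℕ} (hδ : 0 < δ) (hφ : 1 ≤ φ) (hn : 2 ≤ n)
    (hi : i < xi φ δ n) : s φ δ n < (1 - rate δ) ^ i * n := by
  obtain ⟨h0, h1⟩ := one_sub_rate_mem hδ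
  have hn0 : (0 : ℝ) < n := by exact_mod_cast (by omega : 0 < n)
  have hs := one_lt_s hδ hφ hn
  have hlog : Real.log (1 - rate δ) < 0 := Real.log_neg h0 h1
  rw [xi, Nat.lt_ceil, lt_div_iff_of_neg hlog, ← Real.log_pow,
    Real.log_lt_log_iff (by positivity) (by positivity), div_lt_iff₀ hn0] at hi
  exact hi

theorem pow_xi_le {φ δ : ℝ} {n : ℕ} (hδ : 0 < δ) (hφ : 1 ≤ φ) (hn : 2 ≤ n) :
    (1 - rate δ) ^ xi φ δ n * n ≤ s φ δ n := by
  obtain ⟨h0, h1⟩ := one_sub_rate_mem hδ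
  have hn0 : (0 : ℝ) < n := by exact_mod_cast (by omega : 0 < n)
  have hs := one_lt_s hδ hφ hn
  have hlog : Real.log (1 - rate δ) < 0 := Real.log_neg h0 h1
  have h := Nat.le_ceil (Real.log (s φ δ n / n) / Real.log (1 - rate δ))
  rw [div_le_iff_of_neg hlog] at h
  rw [← le_div_iff₀ hn0, ← Real.log_le_log_iff (by positivity) (by positivity), Real.log_pow]
  exact h

variable {ι : Type*} [Fintype ι] [DecidableEq ι]

/-- Union bound over the iterations. Given that the bound holds before an iteration, `x > s` and the
definition of `s` turn the tail of `measure_iteration_le` into at most `exp(-(1-q) 2φ ln n)`. -/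
theorem measure_stage1_le {φ δ : ℝ} {n : ℕ} (hδ : 0 < δ) (hφ : 1 ≤ φ) (hn : 2 ≤ n)
    {A : Finset ι} (hA : A.card ≤ n) {i : ℕ} (hi : i ≤ xi φ δ n) :
    (Measure.pi fun _ : ι => (stage1 δ n i).toMeasure)
        {S | (1 - rate δ) ^ i * n < (remFrom A S 0 (offset δ n i)).card} ≤
      i * ENNReal.ofReal ((n : ℝ) ^ (-(5 / 4 * φ))) := by
  have hn0 : (0 : ℝ) < n := by exact_mod_cast (by omega : 0 < n)
  obtain ⟨hq0, hq1⟩ := one_sub_rate_mem hδ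
  induction i with
  | zero =>
    have : {S : ι → Finset ℕ | (1 - rate δ) ^ 0 * n < (remFrom A S 0 (offset δ n 0)).card} = ∅ := by
      ext S
      simpa [remFrom, offset] using hA
    rw [this]
    simp
  | succ i ih =>
    specialize ih (by omega)
    set B : ℕ → Set (ι → Finset ℕ) := fun i =>
      {S | (1 - rate δ) ^ i * n < (remFrom A S 0 (offset δ n i)).card} with hB
    set ε := ENNReal.ofReal ((n : ℝ) ^ (-(5 / 4 * φ)))
    have hs := one_lt_s hδ hφ hn
    have hx := s_lt_of_lt_xi hδ hφ hn (show i < xi φ δ n by omega)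
    set x : ℝ := (1 - rate δ) ^ i * n
    change (Measure.pi fun _ : ι => (stage1 δ n (i + 1)).toMeasure) (B (i + 1)) ≤ _
    change (Measure.pi fun _ : ι => (stage1 δ n i).toMeasure) (B i) ≤ _ at ih
    have hne : (Finset.range (maxDelay δ n i + 1)).Nonempty := by simp
    have hstep : ∀ S : ι → Finset ℕ, (∀ p, S p ⊆ Finset.range (offset δ n i)) →
        ∫⁻ d, (B (i + 1)).indicator 1 (fun p => insert (offset δ n i + d p) (S p))
          ∂Measure.pi (fun _ : ι =>
            (PMF.uniformOfFinset (Finset.range (maxDelay δ n i + 1)) hne).toMeasure) ≤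
          (B i).indicator 1 S + ε := by
      intro S hS
      by_cases hSB : S ∈ B i
      · rw [Set.indicator_of_mem hSB]
        refine le_trans ?_ le_self_add
        refine (lintegral_mono (g := fun _ => 1) fun d =>
          Set.indicator_le_self' (fun _ _ => zero_le_one) _).trans (by simp)
      · rw [Set.indicator_of_notMem hSB, zero_add]
        simp only [hB, Set.mem_ofPred_eq, not_lt] at hSB
        have := measure_iteration_le (ι := ι) hδ (hs.trans hx) (D := maxDelay δ n i + 1) rfl hne hS hSB
        have heq : ∀ d : ι → ℕ, (B (i + 1)).indicator (1 : (ι → Finset ℕ) → ℝ≥0∞)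
            (fun p => insert (offset δ n i + d p) (S p)) =
            Set.indicator {d | (1 - rate δ) * x < (remFrom (remFrom A S 0 (offset δ n i))
              (fun p => insert (offset δ n i + d p) (S p)) (offset δ n i)
                (maxDelay δ n i + 1)).card} 1 d := by
          intro d
          have hrem : remFrom A (fun p => insert (offset δ n i + d p) (S p)) 0 (offset δ n i) =
              remFrom A S 0 (offset δ n i) := remFrom_congr fun p _ j hj => by
            rw [zero_add, Finset.mem_insert]
            exact or_iff_right (by omega)
          have hiff : (fun p => insert (offset δ n i + d p) (S p)) ∈ B (i + 1) ↔
              d ∈ {d : ι → ℕ | (1 - rate δ) * x < (remFrom (remFrom A S 0 (offset δ n i))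
              (fun p => insert (offset δ n i + d p) (S p)) (offset δ n i)
                (maxDelay δ n i + 1)).card} := by
            simp only [hB, Set.mem_ofPred_eq]
            rw [offset_succ, remFrom_add, zero_add, hrem, pow_succ', mul_assoc]
          simp only [Set.indicator_apply, hiff, Pi.one_apply]
        simp_rw [heq]
        rw [lintegral_indicator_one MeasurableSet.of_discrete]
        refine this.trans (ENNReal.ofReal_le_ofReal ?_)
        rw [Real.rpow_def_of_pos hn0, Real.exp_le_exp]
        have hlog : 0 ≤ Real.log n := Real.log_nonneg (by exact_mod_cast (by omega : 1 ≤ n))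
        have hsv : s φ δ n * (δ ^ 2 / (2 * Real.exp 1 ^ 2 * (1 + δ) ^ 2)) = 2 * φ * Real.log n := by
          simp only [s]
          have := Real.exp_pos 1
          field_simp
        -- As `q ≤ 1/e < 3/8`, the exponent `2(1-q)φ` is at least `5φ/4`. The excess over `φ` later
        -- absorbs the number of iterations.
        have hq : (5 : ℝ) / 8 ≤ 1 - rate δ := by
          linarith [rate_le hδ, exp_neg_one_lt]
        have hφ0 : 0 ≤ φ := by linarith
        have : (5 : ℝ) / 4 * φ * Real.log n ≤
            (1 - rate δ) * x * (δ ^ 2 / (2 * Real.exp 1 ^ 2 * (1 + δ) ^ 2)) := by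
          calc _ = 5 / 8 * (s φ δ n * (δ ^ 2 / (2 * Real.exp 1 ^ 2 * (1 + δ) ^ 2))) := by
                rw [hsv]; ring
            _ ≤ (1 - rate δ) * (x * (δ ^ 2 / (2 * Real.exp 1 ^ 2 * (1 + δ) ^ 2))) := by gcongr
            _ = _ := by ring
        linarith
    rw [← lintegral_indicator_one MeasurableSet.of_discrete, stage1, lintegral_pi_bind_map]
    calc _ ≤ ∫⁻ S, ((B i).indicator 1 S + ε)
          ∂Measure.pi (fun _ : ι => (stage1 δ n i).toMeasure) := by
          refine lintegral_mono_ae ?_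
          filter_upwards [ae_pi_of_forall_support (ι' := ι) (stage1 δ n i)
            subset_of_mem_support_stage1] with S hS
          exact hstep S hS
      _ ≤ i * ε + ε := by
          rw [lintegral_add_right _ measurable_const,
            lintegral_indicator_one MeasurableSet.of_discrete]
          gcongr
          simp
      _ = _ := by push_cast; ring

/-- The truncation depends on the first stage only, so it is unaffected by further steps; on it at
most `s` packets ever compete and each step contracts the expectation. -/
theorem lintegral_stage2_le {φ δ : ℝ} {n : ℕ} (hδ : 0 < δ) (hφ : 1 ≤ φ) (hn : 2 ≤ n)
    (A : Finset ι) (l : ℕ) :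
    ∫⁻ S, (if ((remFrom A S 0 (offset δ n (xi φ δ n))).card : ℝ) ≤ s φ δ n then
        ((remFrom A S 0 (offset δ n (xi φ δ n) + l)).card : ℝ≥0∞) else 0)
        ∂Measure.pi (fun _ : ι => (stage2 φ δ n l).toMeasure) ≤
      ENNReal.ofReal (1 - 1 / (s φ δ n * Real.exp 1)) ^ l * ENNReal.ofReal (s φ δ n) := by
  set o := offset δ n (xi φ δ n)
  have hs := one_lt_s hδ hφ hn
  induction l with
  | zero =>
    rw [pow_zero, one_mul]
    refine (lintegral_mono (g := fun _ => ENNReal.ofReal (s φ δ n)) fun S => ?_).trans (by simp)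
    simp only
    split_ifs with h
    · rw [add_zero, ← ENNReal.ofReal_natCast]
      exact ENNReal.ofReal_le_ofReal h
    · exact zero_le
  | succ l ih =>
    rw [stage2]
    change ∫⁻ S, _ ∂Measure.pi (fun _ : ι => ((stage2 φ δ n l).bind fun S =>
      (coin (1 / s φ δ n)).map fun b => if b then insert (o + l) S else S).toMeasure) ≤ _
    rw [lintegral_pi_bind_map (g := fun (S : Finset ℕ) (b : Bool) => if b then insert (o + l) S else S)]
    have hle : ∀ S : ι → Finset ℕ, (∀ p, S p ⊆ Finset.range (o + l)) →
        ∫⁻ b : ι → Bool, (if ((remFrom A (fun p => if b p then insert (o + l) (S p) else S p)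
            0 o).card : ℝ) ≤ s φ δ n then
          ((remFrom A (fun p => if b p then insert (o + l) (S p) else S p)
            0 (o + (l + 1))).card : ℝ≥0∞) else 0)
          ∂Measure.pi (fun _ : ι => (coin (1 / s φ δ n)).toMeasure) ≤
        ENNReal.ofReal (1 - 1 / (s φ δ n * Real.exp 1)) *
          (if ((remFrom A S 0 o).card : ℝ) ≤ s φ δ n then
            ((remFrom A S 0 (o + l)).card : ℝ≥0∞) else 0) := by
      intro S hS
      have hrem : ∀ j ≤ o + l, ∀ b : ι → Bool,
          remFrom A (fun p => if b p then insert (o + l) (S p) else S p) 0 j = remFrom A S 0 j :=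
        fun j hj b => remFrom_congr fun p _ i hi => by
          split_ifs
          · rw [zero_add, Finset.mem_insert]
            exact or_iff_right (by omega)
          · rfl
      simp only [hrem o (by omega)]
      split_ifs with h
      · have hcard : ((remFrom A S 0 (o + l)).card : ℝ) ≤ s φ δ n :=
          le_trans (by exact_mod_cast Finset.card_le_card (remFrom_anti A S 0 (by omega))) h
        refine le_trans (le_of_eq ?_) (lintegral_card_deliver_le hs hS hcard)
        refine lintegral_congr fun b => ?_
        rw [← add_assoc, remFrom, hrem _ le_rfl, zero_add]
      · simp
    calc _ ≤ ∫⁻ S, ENNReal.ofReal (1 - 1 / (s φ δ n * Real.exp 1)) *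
          (if ((remFrom A S 0 o).card : ℝ) ≤ s φ δ n then
            ((remFrom A S 0 (o + l)).card : ℝ≥0∞) else 0)
            ∂Measure.pi (fun _ : ι => (stage2 φ δ n l).toMeasure) := by
          refine lintegral_mono_ae ?_
          filter_upwards [ae_pi_of_forall_support (ι' := ι) (stage2 φ δ n l)
            subset_of_mem_support_stage2] with S hS
          exact hle S hS
      _ ≤ _ := by
          rw [lintegral_const_mul _ Measurable.of_discrete, pow_succ', mul_assoc]
          gcongr

/-- The law of the first stage is the image of that of the whole pattern, in the sense that the
steps of the second stage do not change the packets that remain before it. -/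
theorem measure_stage2_eq {φ δ : ℝ} {n : ℕ} (A : Finset ι) (l : ℕ) (Q : Finset ι → Prop) :
    (Measure.pi fun _ : ι => (stage2 φ δ n l).toMeasure)
        {S | Q (remFrom A S 0 (offset δ n (xi φ δ n)))} =
      (Measure.pi fun _ : ι => (stage1 δ n (xi φ δ n)).toMeasure)
        {S | Q (remFrom A S 0 (offset δ n (xi φ δ n)))} := by
  induction l with
  | zero => rfl
  | succ l ih =>
    rw [← ih, ← lintegral_indicator_one MeasurableSet.of_discrete,
      ← lintegral_indicator_one MeasurableSet.of_discrete, stage2]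
    set o := offset δ n (xi φ δ n)
    rw [lintegral_pi_bind_map (g := fun (S : Finset ℕ) (b : Bool) => if b then insert (o + l) S else S)]
    refine lintegral_congr fun S => ?_
    refine (lintegral_congr (g := fun _ => Set.indicator {S | Q (remFrom A S 0 o)} 1 S)
      fun b => ?_).trans (by simp)
    have hrem : remFrom A (fun p => if b p then insert (o + l) (S p) else S p) 0 o =
        remFrom A S 0 o := remFrom_congr fun p _ i hi => by
      split_ifs
      · rw [zero_add, Finset.mem_insert]
        exact or_iff_right (by omega)
      · rfl
    change Set.indicator {S | Q (remFrom A S 0 o)} (1 : (ι → Finset ℕ) → ℝ≥0∞)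
      (fun p => if b p then insert (o + l) (S p) else S p) = Set.indicator _ 1 S
    have hQ' : Q (remFrom A (fun p => if b p then insert (o + l) (S p) else S p) 0 o) ↔
        Q (remFrom A S 0 o) := by rw [hrem]
    by_cases hQ : Q (remFrom A S 0 o)
    · rw [Set.indicator_of_mem (by exact hQ'.2 hQ), Set.indicator_of_mem (by exact hQ)]
      rfl
    · rw [Set.indicator_of_notMem (by exact fun h => hQ (hQ'.1 h)), Set.indicator_of_notMem (by exact hQ)]

/-- The probability that the static algorithm does not deliver all packets. -/
theorem measure_pattern_failure_le {φ δ : ℝ} {n : ℕ} (hδ : 0 < δ) (hφ : 1 ≤ φ) (hn : 2 ≤ n)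
    {A : Finset ι} (hA : A.card ≤ n) :
    (Measure.pi fun _ : ι => (pattern φ δ n).toMeasure)
        {S | remFrom A S 0 (length φ δ n) ≠ ∅} ≤
      ENNReal.ofReal (xi φ δ n * (n : ℝ) ^ (-(5 / 4 * φ)) + s φ δ n * (n : ℝ) ^ (-(φ + 1))) := by
  have hn0 : (0 : ℝ) < n := by exact_mod_cast (by omega : 0 < n)
  have hs := one_lt_s hδ hφ hn
  set o := offset δ n (xi φ δ n)
  set π := Measure.pi fun _ : ι => (pattern φ δ n).toMeasure
  have h1 : π {S | s φ δ n < (remFrom A S 0 o).card} ≤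
      ENNReal.ofReal (xi φ δ n * (n : ℝ) ^ (-(5 / 4 * φ))) := by
    have h := measure_stage2_eq (φ := φ) (δ := δ) (n := n) A (stage2Length φ δ n)
      fun R => s φ δ n < R.card
    refine h.trans_le ?_
    rw [ENNReal.ofReal_mul (by positivity), ENNReal.ofReal_natCast]
    refine (measure_mono fun S hS => ?_).trans (measure_stage1_le hδ hφ hn hA le_rfl)
    exact (pow_xi_le hδ hφ hn).trans_lt hS
  -- Markov's inequality for the number of remaining packets, with `(1 - 1/(es))^l ≤ exp(-l/(es))`
  -- and `l ≥ es(φ+1) ln n`.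
  have h2 : π {S | ((remFrom A S 0 o).card : ℝ) ≤ s φ δ n ∧ remFrom A S 0 (length φ δ n) ≠ ∅} ≤
      ENNReal.ofReal (s φ δ n * (n : ℝ) ^ (-(φ + 1))) := by
    have h := lintegral_stage2_le hδ hφ hn A (stage2Length φ δ n)
    rw [← lintegral_indicator_one MeasurableSet.of_discrete]
    refine (lintegral_mono fun S => ?_).trans (h.trans ?_)
    · rw [Set.indicator_apply]
      split_ifs with h3 h4 h4
      · have : remFrom A S 0 (length φ δ n) ≠ ∅ := h3.2
        have : 1 ≤ (remFrom A S 0 (length φ δ n)).card :=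
          Finset.card_pos.2 (Finset.nonempty_iff_ne_empty.2 this)
        simp only [Pi.one_apply]
        exact_mod_cast this
      · exact absurd h3.1 h4
      · exact zero_le
      · exact zero_le
    · have hse : 0 < s φ δ n * Real.exp 1 := by positivity
      have hle1 : 0 ≤ 1 - 1 / (s φ δ n * Real.exp 1) := by
        rw [sub_nonneg, div_le_one hse]
        have := Real.add_one_le_exp 1
        nlinarith
      rw [← ENNReal.ofReal_pow hle1, ← ENNReal.ofReal_mul (by positivity)]
      refine ENNReal.ofReal_le_ofReal ?_
      rw [mul_comm]
      gcongr
      calc _ ≤ Real.exp (-(1 / (s φ δ n * Real.exp 1))) ^ stage2Length φ δ n := by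
            gcongr
            have := Real.add_one_le_exp (-(1 / (s φ δ n * Real.exp 1)))
            linarith
        _ = Real.exp (-(stage2Length φ δ n / (s φ δ n * Real.exp 1))) := by
            rw [← Real.exp_nat_mul]
            congr 1
            ring
        _ ≤ _ := by
            rw [Real.rpow_def_of_pos hn0, Real.exp_le_exp]
            have h := Nat.le_ceil (s φ δ n * Real.exp 1 * (φ + 1) * Real.log n)
            have : (φ + 1) * Real.log n ≤ stage2Length φ δ n / (s φ δ n * Real.exp 1) := by
              rw [le_div_iff₀ hse]
              refine le_trans (le_of_eq ?_) h
              ring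
            linarith
  rw [ENNReal.ofReal_add (by positivity) (by positivity)]
  refine (measure_mono (t := {S | s φ δ n < (remFrom A S 0 o).card} ∪
    {S | ((remFrom A S 0 o).card : ℝ) ≤ s φ δ n ∧ remFrom A S 0 (length φ δ n) ≠ ∅})
    fun S hS => ?_).trans ((measure_union_le _ _).trans (add_le_add h1 h2))
  rcases lt_or_ge (s φ δ n) (remFrom A S 0 o).card with h | h
  · exact Or.inl h
  · exact Or.inr ⟨h, hS⟩

/-- The failure probability is at most `n ^ (-φ)` for large `n`. -/
theorem exists_forall_measure_pattern_failure_le {φ δ : ℝ} (hδ : 0 < δ) (hφ : 1 ≤ φ) :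
    ∃ n₀ : ℕ, 2 ≤ n₀ ∧ ∀ n : ℕ, n₀ ≤ n →
      xi φ δ n * (n : ℝ) ^ (-(5 / 4 * φ)) + s φ δ n * (n : ℝ) ^ (-(φ + 1)) ≤ (n : ℝ) ^ (-φ) := by
  let a : ℝ := (rate δ)⁻¹
  let c : ℝ := 2 * φ * (2 * Real.exp 1 ^ 2 * (1 + δ) ^ 2 / δ ^ 2)
  have hφ4 : 0 < φ / 4 := by linarith
  have hcast : Filter.Tendsto (fun n : ℕ => (n : ℝ)) Filter.atTop Filter.atTop :=
    tendsto_natCast_atTop_atTop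
  have h1 : Filter.Tendsto (fun x : ℝ => Real.log x * x ^ (-(φ / 4))) Filter.atTop (nhds 0) := by
    have := (isLittleO_log_rpow_atTop hφ4).tendsto_div_nhds_zero
    refine this.congr' ?_
    filter_upwards [Filter.eventually_gt_atTop 0] with x hx
    rw [Real.rpow_neg hx.le, div_eq_mul_inv]
  have h2 : Filter.Tendsto (fun x : ℝ => x ^ (-(φ / 4))) Filter.atTop (nhds 0) :=
    tendsto_rpow_neg_atTop hφ4
  have h3 : Filter.Tendsto (fun x : ℝ => Real.log x * x ^ (-1 : ℝ)) Filter.atTop (nhds 0) := by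
    have := (isLittleO_log_rpow_atTop one_pos).tendsto_div_nhds_zero
    refine this.congr' ?_
    filter_upwards [Filter.eventually_gt_atTop 0] with x hx
    rw [Real.rpow_neg hx.le, div_eq_mul_inv]
  -- The failure bound divided by `n^(-φ)`, with `ξ` replaced by `a ln n + 1` and `s = c ln n`.
  have h4 : Filter.Tendsto (fun x : ℝ => a * (Real.log x * x ^ (-(φ / 4))) + x ^ (-(φ / 4)) +
      c * (Real.log x * x ^ (-1 : ℝ))) Filter.atTop (nhds (a * 0 + 0 + c * 0)) :=
    ((h1.const_mul a).add h2).add (h3.const_mul c)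
  have h5 := (h4.comp hcast).eventually_le_const (u := 1) (by norm_num)
  obtain ⟨N, hN⟩ := Filter.eventually_atTop.1 h5
  refine ⟨max N 2, le_max_right _ _, fun n hn => ?_⟩
  have hn2 : 2 ≤ n := le_trans (le_max_right _ _) hn
  have hn0 : (0 : ℝ) < n := by exact_mod_cast (by omega : 0 < n)
  have h6 := hN n (le_trans (le_max_left _ _) hn)
  simp only [Function.comp_apply] at h6
  have hxi := natCast_xi_le hδ hφ hn2
  have e1 : (n : ℝ) ^ (-(5 / 4 * φ)) = (n : ℝ) ^ (-(φ / 4)) * (n : ℝ) ^ (-φ) := by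
    rw [← Real.rpow_add hn0]; congr 1; ring
  have e2 : (n : ℝ) ^ (-(φ + 1)) = (n : ℝ) ^ (-1 : ℝ) * (n : ℝ) ^ (-φ) := by
    rw [← Real.rpow_add hn0]; congr 1; ring
  calc _ ≤ (Real.log n / rate δ + 1) * (n : ℝ) ^ (-(5 / 4 * φ)) +
        s φ δ n * (n : ℝ) ^ (-(φ + 1)) := by gcongr
    _ = (a * (Real.log n * (n : ℝ) ^ (-(φ / 4))) + (n : ℝ) ^ (-(φ / 4)) +
      c * (Real.log n * (n : ℝ) ^ (-1 : ℝ))) * (n : ℝ) ^ (-φ) := by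
        rw [e1, e2]
        simp only [a, c, s]
        ring
    _ ≤ 1 * (n : ℝ) ^ (-φ) := by gcongr
    _ = _ := one_mul _

/-- The threshold is uniform in the index type and the set `A`: the main phase is indexed by waiting
packets, the clean-up phase runs on a random set of stations. -/
theorem exists_forall_measure_pattern_le {φ δ : ℝ} (hδ : 0 < δ) (hφ : 1 ≤ φ) :
    ∃ n₀ : ℕ, 2 ≤ n₀ ∧ ∀ n : ℕ, n₀ ≤ n → ∀ (ι : Type) [Fintype ι] [DecidableEq ι] (A : Finset ι),
      A.card ≤ n → (Measure.pi fun _ : ι => (pattern φ δ n).toMeasure)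
        {S | remFrom A S 0 (length φ δ n) ≠ ∅} ≤ ENNReal.ofReal ((n : ℝ) ^ (-φ)) := by
  obtain ⟨n₀, h2, h⟩ := exists_forall_measure_pattern_failure_le hδ hφ
  exact ⟨n₀, h2, fun n hn ι _ _ A hA => (measure_pattern_failure_le hδ hφ (h2.trans hn) hA).trans
    (ENNReal.ofReal_le_ofReal (h n hn))⟩

theorem exists_forall_le_successProb {φ δ : ℝ} (hδ : 0 < δ) (hφ : 1 ≤ φ) :
    ∃ n₀ : ℕ, ∀ n : ℕ, n₀ ≤ n → ∀ k : ℕ, k ≤ n → 1 - 1 / (n : ℝ) ^ φ ≤ successProb φ δ n k := by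
  obtain ⟨n₀, -, h⟩ := exists_forall_measure_pattern_le hδ hφ
  refine ⟨n₀, fun n hn k hk => ?_⟩
  have h1 := h n hn (Fin k) Finset.univ (by simpa using hk)
  have hset : {S : Fin k → Finset ℕ | remaining S (length φ δ n) = ∅} =
      {S | remFrom Finset.univ S 0 (length φ δ n) ≠ ∅}ᶜ := by
    ext S
    simp [remaining_eq_remFrom]
  rw [successProb, hset, probReal_compl_eq_one_sub MeasurableSet.of_discrete, one_div,
    ← Real.rpow_neg (by positivity), measureReal_def]
  gcongr
  exact ENNReal.toReal_le_of_le_ofReal (by positivity) h1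

end StaticMAC

/-! ### One-time marginals of a protocol -/

namespace SymmetricProtocol

variable {P : SymmetricProtocol} {m : ℕ}

theorem lintegral_law_zero (a : ℕ → Fin m → ℕ) (G : (Fin m → P.Station) → ℝ≥0∞) :
    ∫⁻ τ, G (τ 0) ∂P.law a = G fun _ => ⟨P.init, 0, ∅⟩ := by
  have h : (P.law a).map (fun τ => τ 0) = Measure.dirac fun _ => ⟨P.init, 0, ∅⟩ := by
    have hf : (fun τ : ℕ → Fin m → P.Station => τ 0) =
        (fun h : Finset.Iic 0 → Fin m → P.Station => h ⟨0, by simp⟩) ∘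
          Preorder.frestrictLe (π := fun _ => Fin m → P.Station) 0 := rfl
    rw [hf, ← Measure.map_map (measurable_pi_apply _) (by fun_prop), law, Kernel.trajMeasure,
      Measure.map_comp _ _ (by fun_prop), Kernel.traj_map_frestrictLe, Kernel.partialTraj_self,
      Measure.id_comp, Measure.map_map (measurable_pi_apply _) (by fun_prop)]
    rw [Measure.map_dirac' ((measurable_pi_apply _).comp (by fun_prop))]
    rfl
  rw [← lintegral_map (f := G) (g := fun τ : ℕ → Fin m → P.Station => τ 0)
    Measurable.of_discrete (measurable_pi_apply 0), h, lintegral_dirac]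

/-- Queue lengths and pending probabilities depend only on the law at a single time. This Markov
recursion replaces all further work with trajectories. -/
theorem lintegral_law_succ (a : ℕ → Fin m → ℕ) (t : ℕ) (G : (Fin m → P.Station) → ℝ≥0∞) :
    ∫⁻ τ, G (τ (t + 1)) ∂P.law a = ∫⁻ τ, ∫⁻ c, G c ∂P.stepMeasure t (a t) (τ t) ∂P.law a := by
  have h := Kernel.map_frestrictLe_trajMeasure_compProd_eq_map_trajMeasure
    (X := fun _ => Fin m → P.Station) (μ₀ := Measure.dirac fun _ => ⟨P.init, 0, ∅⟩)
    (κ := P.stepKernel a) (a := t)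
  have hG : Measurable G := Measurable.of_discrete
  have h1 := congrArg (fun μ => ∫⁻ x, G x.2 ∂μ) h
  beta_reduce at h1
  have hG2 : Measurable fun x : (Finset.Iic t → Fin m → P.Station) × (Fin m → P.Station) => G x.2 :=
    hG.comp measurable_snd
  rw [lintegral_map hG2 (by fun_prop), Measure.lintegral_compProd hG2,
    lintegral_map hG.lintegral_kernel (by fun_prop)] at h1
  exact h1.symm

/-- The latency is at most the number of slots before which the packet is pending. -/
theorem latency_le_tsum (τ : ℕ → Fin m → P.Station) (e : Fin m) (j t : ℕ) :
    latency τ e j t ≤ ∑' d : ℕ, if j ∈ (τ (t + d + 1) e).pending then 1 else 0 := by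
  by_cases h : ∃ d, j ∉ (τ (t + d + 1) e).pending
  · classical
    have hmin := fun k (hk : k < Nat.find h) => Nat.find_min h hk
    have hspec := Nat.find_spec h
    calc latency τ e j t ≤ (Nat.find h : ℝ≥0∞) := iInf₂_le (Nat.find h) hspec
      _ = ∑ d ∈ Finset.range (Nat.find h), if j ∈ (τ (t + d + 1) e).pending then 1 else 0 := by
          rw [Finset.sum_congr rfl fun d hd =>
            if_pos (not_not.1 (hmin d (Finset.mem_range.1 hd)))]
          simp
      _ ≤ _ := ENNReal.sum_le_tsum _
  · push Not at h
    simp [h]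

theorem lintegral_latency_le (a : ℕ → Fin m → ℕ) (e : Fin m) (j t : ℕ) :
    ∫⁻ τ, latency τ e j t ∂P.law a ≤
      ∑' d : ℕ, ∫⁻ τ, (if j ∈ (τ (t + d + 1) e).pending then 1 else 0) ∂P.law a := by
  refine (lintegral_mono fun τ => latency_le_tsum τ e j t).trans (le_of_eq ?_)
  refine lintegral_tsum fun d => Measurable.aemeasurable ?_
  exact (Measurable.of_discrete (f := fun c : Fin m → P.Station =>
    if j ∈ (c e).pending then (1 : ℝ≥0∞) else 0)).comp (measurable_pi_apply _)

end SymmetricProtocol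

theorem pi_pure_toMeasure {ι β : Type*} [Fintype ι] [MeasurableSpace β] [DiscreteMeasurableSpace β]
    [Countable β] (c : ι → β) :
    Measure.pi (fun i => (PMF.pure (c i)).toMeasure) = Measure.dirac c := by
  simp_rw [PMF.toMeasure_pure]
  refine Measure.pi_eq fun s _ => ?_
  rw [Measure.dirac_apply' _ MeasurableSet.of_discrete]
  simp_rw [Measure.dirac_apply' _ MeasurableSet.of_discrete]
  by_cases h : c ∈ Set.univ.pi s
  · rw [Set.indicator_of_mem h, Finset.prod_eq_one fun i _ =>
      Set.indicator_of_mem (Set.mem_univ_pi.1 h i) _]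
    rfl
  · rw [Set.indicator_of_notMem h]
    simp only [Set.mem_univ_pi, not_forall] at h
    obtain ⟨i, hi⟩ := h
    exact (Finset.prod_eq_zero (Finset.mem_univ i) (Set.indicator_of_notMem hi _)).symm

/-! ### The frame protocol: deterministic steps and random draws -/

namespace FrameProtocol

open StaticMAC

section Steps

variable (m T : ℕ) (φ δ : ℝ) (n n' : ℕ)

/-- The configurations of the frame protocol. -/
abbrev Config := Fin m → (frameProtocol m T φ δ n n').Station

variable {m T φ δ n n'}

/-- The station with the local state `x`, `i` injected packets and the undelivered packets `Q`. -/
def mkStation (x : LocalState) (i : ℕ) (Q : Finset ℕ) : (frameProtocol m T φ δ n n').Station :=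
  ⟨x, i, Q⟩

/-- The local state of a station. -/
def st (c : Config m T φ δ n n') (e : Fin m) : LocalState := (c e).state

/-- The configuration after slot `t`, before the random draws. -/
noncomputable def recordAll (t : ℕ) (a : Fin m → ℕ) (c : Config m T φ δ n n') :
    Config m T φ δ n n' := fun e =>
  mkStation (record T t (st c e) (a e) ((frameProtocol m T φ δ n n').ack t c e))
    ((c e).injected + a e) ((frameProtocol m T φ δ n n').pendingAfter t a c e)

variable (m T φ δ n n') in
/-- The random draw of a station before slot `t`. -/
noncomputable def draw (t : ℕ) (x : LocalState) : PMF LocalState :=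
  if t % T = 0 then startFrame φ δ n x
  else if t % T = StaticMAC.length φ δ n then startCleanUp m φ δ n' (StaticMAC.length φ δ n) x
  else PMF.pure x

/-- The random draws of all stations before slot `t`. -/
noncomputable def drawMeasure (t : ℕ) (c : Config m T φ δ n n') : Measure (Config m T φ δ n n') :=
  Measure.pi fun e =>
    ((draw m T φ δ n n' t (st c e)).map fun x =>
      mkStation (m := m) (T := T) (φ := φ) (δ := δ) (n := n) (n' := n')
        x (c e).injected (c e).pending).toMeasure

instance (t : ℕ) (c : Config m T φ δ n n') : IsProbabilityMeasure (drawMeasure t c) := by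
  unfold drawMeasure; infer_instance

variable (m T φ δ n n') in
/-- The initial configuration. -/
def initConfig : Config m T φ δ n n' := fun _ => ⟨(⟨0, [], [], []⟩ : LocalState), 0, ∅⟩

/-- The law of the configuration before slot `t` and before the random draws. -/
noncomputable def pre (a : ℕ → Fin m → ℕ) : ℕ → Measure (Config m T φ δ n n')
  | 0 => Measure.dirac (initConfig m T φ δ n n')
  | t + 1 => ((pre a t).bind (drawMeasure t)).map (recordAll t (a t))

instance (a : ℕ → Fin m → ℕ) (t : ℕ) :
    IsProbabilityMeasure (pre (T := T) (φ := φ) (δ := δ) (n := n) (n' := n') a t) := by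
  induction t with
  | zero => unfold pre; infer_instance
  | succ t ih =>
    unfold pre
    have : IsProbabilityMeasure ((pre (T := T) (φ := φ) (δ := δ) (n := n) (n' := n') a t).bind
        (drawMeasure t)) := isProbabilityMeasure_bind Measurable.of_discrete.aemeasurable
        (Filter.Eventually.of_forall fun _ => inferInstance)
    exact Measure.isProbabilityMeasure_map Measurable.of_discrete.aemeasurable

theorem lintegral_pre_succ (a : ℕ → Fin m → ℕ) (t : ℕ) (G : Config m T φ δ n n' → ℝ≥0∞) :
    ∫⁻ b, G b ∂pre a (t + 1) =
      ∫⁻ b, ∫⁻ c, G (recordAll t (a t) c) ∂drawMeasure t b ∂pre a t := by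
  rw [pre, lintegral_map Measurable.of_discrete Measurable.of_discrete,
    Measure.lintegral_bind Measurable.of_discrete.aemeasurable Measurable.of_discrete.aemeasurable]

/-- The protocol makes no draw before slot 0, but with nothing waiting such a draw is trivial. So
slot 0 needs no exception. -/
theorem drawMeasure_initConfig : drawMeasure 0 (initConfig m T φ δ n n') =
    Measure.dirac (initConfig m T φ δ n n') := by
  rw [← pi_pure_toMeasure]
  unfold drawMeasure
  congr 1
  ext1 e
  congr 1
  have : draw m T φ δ n n' 0 (st (initConfig m T φ δ n n') e) = PMF.pure ⟨0, [], [], []⟩ := by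
    simp [draw, startFrame, st, initConfig, drawAll, PMF.pure_map]
  rw [this, PMF.pure_map]
  rfl

/-- The transition at the end of slot `t` is a deterministic record of slot `t` followed by the draw
belonging to slot `t + 1`. Cutting between the two moves each frame's draws into that frame. -/
theorem lintegral_law (a : ℕ → Fin m → ℕ) (t : ℕ) (G : Config m T φ δ n n' → ℝ≥0∞) :
    ∫⁻ τ, G (τ t) ∂(frameProtocol m T φ δ n n').law a =
      ∫⁻ b, ∫⁻ c, G c ∂drawMeasure t b ∂pre a t := by
  induction t generalizing G with
  | zero =>
    rw [SymmetricProtocol.lintegral_law_zero, pre, lintegral_dirac, drawMeasure_initConfig,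
      lintegral_dirac]
    rfl
  | succ t ih =>
    rw [SymmetricProtocol.lintegral_law_succ,
      ih fun c => ∫⁻ c', G c' ∂(frameProtocol m T φ δ n n').stepMeasure t (a t) c,
      lintegral_pre_succ]
    rfl

/-- Random draws change only the local states. -/
theorem ae_drawMeasure (t : ℕ) (c : Config m T φ δ n n') :
    ∀ᵐ c' ∂drawMeasure t c, ∀ e, (c' e).injected = (c e).injected ∧
      (c' e).pending = (c e).pending := by
  rw [ae_all_iff]
  intro e
  refine (Measure.quasiMeasurePreserving_eval (fun e =>
    ((draw m T φ δ n n' t (st c e)).map fun x =>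
      mkStation (m := m) (T := T) (φ := φ) (δ := δ) (n := n) (n' := n')
        x (c e).injected (c e).pending).toMeasure) e).ae
    (p := fun x : (frameProtocol m T φ δ n n').Station =>
      x.injected = (c e).injected ∧ x.pending = (c e).pending) ?_
  rw [ae_iff, PMF.toMeasure_apply_eq_zero_iff _ MeasurableSet.of_discrete, Set.disjoint_left]
  intro x hx hn
  rw [PMF.mem_support_map_iff] at hx
  obtain ⟨y, -, rfl⟩ := hx
  exact hn ⟨rfl, rfl⟩

theorem lintegral_drawMeasure_pending (t : ℕ) (c : Config m T φ δ n n')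
    (G : (Fin m → Finset ℕ) → ℝ≥0∞) :
    ∫⁻ c', G (fun e => (c' e).pending) ∂drawMeasure t c = G fun e => (c e).pending := by
  rw [lintegral_congr_ae (g := fun _ => G fun e => (c e).pending)]
  · simp
  · filter_upwards [ae_drawMeasure t c] with c' hc'
    rw [funext fun e => (hc' e).2]

theorem lintegral_law_pending (a : ℕ → Fin m → ℕ) (t : ℕ) (G : (Fin m → Finset ℕ) → ℝ≥0∞) :
    ∫⁻ τ, G (fun e => (τ t e).pending) ∂(frameProtocol m T φ δ n n').law a =
      ∫⁻ b, G (fun e => (b e).pending) ∂pre (T := T) (φ := φ) (δ := δ) (n := n) (n' := n') a t := by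
  rw [lintegral_law a t fun c => G fun e => (c e).pending]
  simp_rw [lintegral_drawMeasure_pending]

/-- The configuration after the slots `t, …, t + i - 1` without random draws in between. -/
noncomputable def recordSteps (a : ℕ → Fin m → ℕ) (t : ℕ) :
    ℕ → Config m T φ δ n n' → Config m T φ δ n n'
  | 0, c => c
  | i + 1, c => recordAll (t + i) (a (t + i)) (recordSteps a t i c)

theorem drawMeasure_of_ne {t : ℕ} (h0 : t % T ≠ 0) (h1 : t % T ≠ StaticMAC.length φ δ n)
    (c : Config m T φ δ n n') : drawMeasure t c = Measure.dirac c := by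
  rw [← pi_pure_toMeasure]
  unfold drawMeasure
  congr 1
  ext1 e
  congr 1
  rw [draw, if_neg h0, if_neg h1, PMF.pure_map]
  rfl

/-- Only the slots with residue `0` and `length φ δ n` draw anything. After the draw at `t` the next
`i + 1` slots are therefore a deterministic map. -/
theorem lintegral_pre_add (a : ℕ → Fin m → ℕ) (t i : ℕ)
    (h : ∀ k, 0 < k → k < i + 1 → (t + k) % T ≠ 0 ∧ (t + k) % T ≠ StaticMAC.length φ δ n)
    (G : Config m T φ δ n n' → ℝ≥0∞) :
    ∫⁻ b, G b ∂pre a (t + (i + 1)) =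
      ∫⁻ b, ∫⁻ c, G (recordSteps a t (i + 1) c) ∂drawMeasure t b ∂pre a t := by
  induction i generalizing G with
  | zero => exact lintegral_pre_succ a t G
  | succ i ih =>
    obtain ⟨h0, h1⟩ := h (i + 1) (by omega) (by omega)
    rw [← add_assoc, lintegral_pre_succ]
    simp_rw [drawMeasure_of_ne h0 h1, lintegral_dirac]
    rw [ih (fun k hk hk' => h k hk (by omega)) fun c => G (recordAll (t + (i + 1)) (a (t + (i + 1))) c)]
    rfl

end Steps

end FrameProtocol

/-! ### One execution of the static algorithm inside a frame -/

namespace FrameProtocol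

open StaticMAC

variable {m T : ℕ} {φ δ : ℝ} {n n' : ℕ}

/-- The packets in the lists `base e`. -/
def packets (base : Fin m → List ℕ) : Finset (Σ _ : Fin m, ℕ) :=
  Finset.univ.sigma fun e => (base e).toFinset

theorem mem_packets {base : Fin m → List ℕ} {e : Fin m} {j : ℕ} :
    (⟨e, j⟩ : Σ _ : Fin m, ℕ) ∈ packets base ↔ j ∈ base e := by simp [packets]

/-- The patterns of all packets as one family. -/
def patterns (S : Fin m → ℕ → Finset ℕ) : (Σ _ : Fin m, ℕ) → Finset ℕ := fun p => S p.1 p.2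

/-- In the configuration `c` the packets in `base` are about to execute the static algorithm with
the patterns `S`. -/
structure Ready (base : Fin m → List ℕ) (S : Fin m → ℕ → Finset ℕ) (c : Config m T φ δ n n') :
    Prop where
  injected : ∀ e, (st c e).injected = (c e).injected
  active : ∀ e, (st c e).active = (base e).map fun j => (j, S e j)
  mem_pending : ∀ e, ∀ j ∈ base e, j ∈ (c e).pending
  lt_injected : ∀ e, ∀ j ∈ (c e).pending, j < (c e).injected

/-- The configuration `c` has developed from `c₀` by the execution of the static algorithm on the
packets in `base`, of which those in `R` remain, and the injection of `x e` packets at `e`. -/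
structure Running (base : Fin m → List ℕ) (S : Fin m → ℕ → Finset ℕ) (c₀ : Config m T φ δ n n')
    (R : Finset (Σ _ : Fin m, ℕ)) (x : Fin m → ℕ) (c : Config m T φ δ n n') : Prop where
  injected : ∀ e, (c e).injected = (c₀ e).injected + x e
  st_injected : ∀ e, (st c e).injected = (c₀ e).injected + x e
  waiting : ∀ e, (st c e).waiting = (st c₀ e).waiting ++ List.range' (c₀ e).injected (x e)
  active : ∀ e, (st c e).active =
    ((base e).filter fun j => (⟨e, j⟩ : Σ _ : Fin m, ℕ) ∈ R).map fun j => (j, S e j)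
  failed : ∀ e, (st c e).failed =
    (st c₀ e).failed.filter fun j => j ∈ base e → (⟨e, j⟩ : Σ _ : Fin m, ℕ) ∈ R
  pending : ∀ e, (c e).pending =
    ((c₀ e).pending.filter fun j => j ∈ base e → (⟨e, j⟩ : Σ _ : Fin m, ℕ) ∈ R) ∪
      Finset.Ico (c₀ e).injected ((c₀ e).injected + x e)

variable {base : Fin m → List ℕ} {S : Fin m → ℕ → Finset ℕ} {c₀ c : Config m T φ δ n n'}

theorem Ready.running (h : Ready base S c) : Running base S c (packets base) 0 c where
  injected _ := rfl
  st_injected := h.injected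
  waiting e := by simp
  active e := by
    rw [h.active, List.filter_eq_self.2]
    intro j hj
    simpa [mem_packets] using hj
  failed e := by
    rw [eq_comm, List.filter_eq_self]
    intro j _
    simp [mem_packets]
  pending e := by
    ext j
    simp [mem_packets]

/-- The attempts on the channel are exactly those of the packets in `R` whose pattern contains `r`,
so the slot acts on `R` as `deliver` does. Freshly injected packets have larger numbers and never
interfere. -/
theorem Running.step {R : Finset (Σ _ : Fin m, ℕ)} {x : Fin m → ℕ} (h₀ : Ready base S c₀)
    (hR : R ⊆ packets base) (h : Running base S c₀ R x c) {t r : ℕ} (ht : t % T = r)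
    (a : Fin m → ℕ) :
    Running base S c₀ (deliver (patterns S) r R) (x + a) (recordAll t a c) := by
  let P := frameProtocol m T φ δ n n'
  have hact : ∀ e j, j ∈ action T t (st c e) ↔ (⟨e, j⟩ : Σ _ : Fin m, ℕ) ∈ R ∧ r ∈ S e j := by
    intro e j
    simp only [action, h.active, List.mem_toFinset, List.mem_map, List.mem_filter, ht,
      decide_eq_true_eq]
    constructor
    · rintro ⟨q, ⟨⟨i, ⟨-, hi⟩, rfl⟩, hr⟩, rfl⟩
      exact ⟨hi, hr⟩
    · rintro ⟨hj, hr⟩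
      exact ⟨(j, S e j), ⟨⟨j, ⟨mem_packets.1 (hR hj), hj⟩, rfl⟩, hr⟩, rfl⟩
  have hatt : ∀ e, P.attempts t c e = action T t (st c e) := by
    intro e
    refine Finset.inter_eq_left.2 fun j hj => ?_
    have hj' := ((hact e j).1 hj).1
    rw [h.pending, Finset.mem_union, Finset.mem_filter]
    exact Or.inl ⟨h₀.mem_pending e j (mem_packets.1 (hR hj')), fun _ => hj'⟩
  have hfil : (R.filter fun p => r ∈ patterns S p) =
      Finset.univ.sigma fun e => P.attempts t c e := by
    ext ⟨e, j⟩
    simp only [Finset.mem_sigma, Finset.mem_univ, true_and, hatt, hact]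
    exact Finset.mem_filter
  have hsucc : P.Success t c ↔ (R.filter fun p => r ∈ patterns S p).card = 1 := by
    rw [hfil, Finset.card_sigma]
    rfl
  have hack : ∀ e, P.ack t c e = true ↔ P.Success t c ∧ (P.attempts t c e).Nonempty := by
    intro e
    simp [SymmetricProtocol.ack]
  -- In a successful slot the only attempting packet belongs to the acknowledged station, so
  -- deleting all attempts of that station deletes just this packet.
  have hR' : ∀ e j, (⟨e, j⟩ : Σ _ : Fin m, ℕ) ∈ deliver (patterns S) r R ↔
      (⟨e, j⟩ : Σ _ : Fin m, ℕ) ∈ R ∧ ¬ (P.ack t c e = true ∧ j ∈ action T t (st c e)) := by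
    intro e j
    unfold deliver
    split_ifs with h1
    · rw [Finset.mem_sdiff]
      refine and_congr_right fun hj => not_congr ?_
      rw [Finset.mem_filter, hact, hack, hatt, hsucc]
      constructor
      · rintro ⟨-, hr⟩
        exact ⟨⟨h1, j, (hact e j).2 ⟨hj, hr⟩⟩, hj, hr⟩
      · rintro ⟨-, hj, hr⟩
        exact ⟨hj, hr⟩
    · rw [hack, hsucc]
      simp [h1]
  have hst : ∀ e, st (recordAll t a c) e = record T t (st c e) (a e) (P.ack t c e) := fun _ => rfl
  have hpend : ∀ e, (recordAll t a c e).pending = P.pendingAfter t a c e := fun _ => rfl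
  have hinj : ∀ e, (recordAll t a c e).injected = (c e).injected + a e := fun _ => rfl
  refine ⟨fun e => ?_, fun e => ?_, fun e => ?_, fun e => ?_, fun e => ?_, fun e => ?_⟩
  · rw [hinj, h.injected, Pi.add_apply, add_assoc]
  · rw [hst, record, h.st_injected, Pi.add_apply, add_assoc]
  · rw [hst, record, h.waiting, h.st_injected, List.append_assoc, Pi.add_apply,
      ← List.range'_append_1]
  · rw [hst, record]
    by_cases hk : P.ack t c e = true
    · simp only [hk, if_true]
      rw [h.active, List.filter_map, List.filter_filter]
      congr 1
      refine List.filter_congr fun j _ => ?_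
      simp only [Function.comp_apply, hR', hk, true_and, ← Bool.decide_and, and_comm]
    · simp only [hk, Bool.false_eq_true, if_false]
      rw [h.active]
      congr 1
      refine List.filter_congr fun j _ => ?_
      simp only [hR', hk, Bool.false_eq_true, false_and, not_false_eq_true, and_true]
  · rw [hst, record]
    by_cases hk : P.ack t c e = true
    · simp only [hk, if_true]
      rw [h.failed, List.filter_filter]
      refine List.filter_congr fun j _ => ?_
      rw [← Bool.decide_and, decide_eq_decide]
      simp only [hR', hk, true_and, hact]
      have := @mem_packets m base e j
      have := @hR ⟨e, j⟩
      tauto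
    · simp only [hk, Bool.false_eq_true, if_false]
      rw [h.failed]
      refine List.filter_congr fun j _ => ?_
      simp only [hR', hk, Bool.false_eq_true, false_and, not_false_eq_true, and_true]
  · rw [hpend, SymmetricProtocol.pendingAfter, hatt, h.injected, h.pending]
    ext j
    have hb := @mem_packets m base e j
    have hRj := @hR ⟨e, j⟩
    have hlt := h₀.lt_injected e j
    have hmem := h₀.mem_pending e j
    by_cases hk : P.ack t c e = true
    · simp only [if_true, Finset.mem_union, Finset.mem_sdiff, Finset.mem_filter,
        Finset.mem_Ico, hR', hk, true_and, Pi.add_apply, hact]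
      have h1 : (⟨e, j⟩ : Σ _ : Fin m, ℕ) ∈ R → j < (c₀ e).injected := fun hj =>
        hlt (hmem (hb.1 (hRj hj)))
      constructor
      · rintro (⟨⟨h2, h3⟩ | h2, h4⟩ | h2)
        · refine Or.inl ⟨h2, fun h5 => ⟨h3 h5, h4⟩⟩
        · exact Or.inr ⟨h2.1, by omega⟩
        · exact Or.inr ⟨by omega, by omega⟩
      · rintro (⟨h2, h3⟩ | ⟨h2, h3⟩)
        · by_cases h5 : j ∈ base e
          · exact Or.inl ⟨Or.inl ⟨h2, fun _ => (h3 h5).1⟩, (h3 h5).2⟩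
          · exact Or.inl ⟨Or.inl ⟨h2, fun h6 => absurd h6 h5⟩, fun h6 => h5 (hb.1 (hRj h6.1))⟩
        · by_cases h6 : j < (c₀ e).injected + x e
          · refine Or.inl ⟨Or.inr ⟨h2, h6⟩, fun h7 => ?_⟩
            have := h1 h7.1
            omega
          · exact Or.inr ⟨by omega, by omega⟩
    · simp only [Bool.false_eq_true, if_false, Finset.mem_union, Finset.mem_filter, Finset.mem_Ico, hR', hk,
        Bool.false_eq_true, false_and, not_false_eq_true, and_true, Pi.add_apply]
      rw [or_assoc]
      refine or_congr_right ?_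
      omega

/-- The number of packets injected at station `e` in the slots `t, …, t + i - 1`. -/
def injectedIn (a : ℕ → Fin m → ℕ) (t i : ℕ) (e : Fin m) : ℕ := ∑ k ∈ Finset.range i, a (t + k) e

theorem Ready.running_recordSteps (h : Ready base S c) (a : ℕ → Fin m → ℕ) {t r i : ℕ}
    (ht : ∀ k < i, (t + k) % T = r + k) :
    Running base S c (remFrom (packets base) (patterns S) r i) (injectedIn a t i)
      (recordSteps a t i c) := by
  induction i with
  | zero => exact h.running
  | succ i ih =>
    have := (ih fun k hk => ht k (by omega)).step h (remFrom_subset _ _ _ _) (ht i (by omega))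
      (a (t + i))
    have hx : injectedIn a t (i + 1) = injectedIn a t i + a (t + i) := by
      ext e
      exact Finset.sum_range_succ _ _
    rw [hx]
    exact this

end FrameProtocol

/-! ### The random draws of a frame -/

theorem lintegral_pi_sigma {ι β : Type*} [Fintype ι] {κ : ι → Type*} [∀ i, Fintype (κ i)]
    [MeasurableSpace β] [DiscreteMeasurableSpace β] [Countable β] (μ : Measure β)
    [IsProbabilityMeasure μ] (f : (∀ i, κ i → β) → ℝ≥0∞) :
    ∫⁻ x, f x ∂Measure.pi (fun i => Measure.pi fun _ : κ i => μ) =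
      ∫⁻ y, f (fun i j => y ⟨i, j⟩) ∂Measure.pi fun _ : (Σ i, κ i) => μ := by
  have h := Measure.infinitePi_map_piCurry (X := fun (i : ι) (_ : κ i) => β)
    (μ := fun (i : ι) (_ : κ i) => μ)
  simp_rw [Measure.infinitePi_eq_pi] at h
  rw [← h, lintegral_map Measurable.of_discrete (MeasurableEquiv.measurable _)]
  rfl

namespace FrameProtocol

open StaticMAC

theorem toMeasure_drawAll_map {β : Type*} [MeasurableSpace β] [DiscreteMeasurableSpace β]
    [Countable β] (p : PMF (Finset ℕ)) (l : List ℕ) (f : List (ℕ × Finset ℕ) → β) :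
    ((drawAll p l).map f).toMeasure = (Measure.pi fun _ : Fin l.length => p.toMeasure).map
      fun S => f (List.ofFn fun i => (l.get i, S i)) := by
  refine ext_of_lintegral_discrete fun g => ?_
  rw [lintegral_map Measurable.of_discrete Measurable.of_discrete]
  induction l generalizing f with
  | nil => simp [drawAll, PMF.pure_map, PMF.toMeasure_pure]
  | cons j l ih =>
    have hmap : (drawAll p (j :: l)).map f =
        p.bind fun S => (drawAll p l).map fun r => f ((j, S) :: r) := by
      simp [drawAll, PMF.map_bind, PMF.map_comp, Function.comp_def]
    rw [hmap, lintegral_toMeasure_bind]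
    simp_rw [ih fun r => f ((j, _) :: r)]
    change _ = ∫⁻ S : Fin (l.length + 1) → Finset ℕ,
      g (f (List.ofFn fun i => ((j :: l).get i, S i))) ∂Measure.pi fun _ => p.toMeasure
    rw [← (measurePreserving_piFinSuccAbove (fun _ : Fin (l.length + 1) =>
      p.toMeasure) 0).symm.lintegral_comp_emb (MeasurableEquiv.measurableEmbedding _),
      lintegral_prod _ Measurable.of_discrete.aemeasurable]
    simp [MeasurableEquiv.piFinSuccAbove, Fin.consEquiv, List.ofFn_succ]

variable {m T : ℕ} {φ δ : ℝ} {n n' : ℕ}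

/-- The configuration after the draws at the beginning of a frame, with given patterns. -/
def startConfig (b : Config m T φ δ n n') (S : Fin m → ℕ → Finset ℕ) : Config m T φ δ n n' :=
  fun e => mkStation { st b e with
    waiting := [], active := (st b e).waiting.map fun j => (j, S e j) } (b e).injected (b e).pending

/-- The packets waiting at the stations. -/
def waitingLists (b : Config m T φ δ n n') (e : Fin m) : List ℕ := (st b e).waiting

/-- The draws at the beginning of a frame are independent patterns of the waiting packets. -/
theorem exists_lintegral_drawMeasure_start {t : ℕ} (ht : t % T = 0) (b : Config m T φ δ n n')
    (hb : ∀ e, (st b e).waiting.Nodup) :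
    ∃ (Ω : Type) (_ : MeasurableSpace Ω) (ν : Measure Ω) (_ : IsProbabilityMeasure ν)
      (_ : DiscreteMeasurableSpace Ω) (S : Ω → Fin m → ℕ → Finset ℕ),
      (∀ G : Config m T φ δ n n' → ℝ≥0∞,
        ∫⁻ c, G c ∂drawMeasure t b = ∫⁻ ω, G (startConfig b (S ω)) ∂ν) ∧
      ∀ ε : ℝ≥0∞, (∀ (ι : Type) [Fintype ι] [DecidableEq ι] (A : Finset ι), A.card ≤ n →
        (Measure.pi fun _ : ι => (pattern φ δ n).toMeasure)
          {S | remFrom A S 0 (StaticMAC.length φ δ n) ≠ ∅} ≤ ε) →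
        ∑ e, (st b e).waiting.length ≤ n →
        ν {ω | remFrom (packets (waitingLists b)) (patterns (S ω)) 0 (StaticMAC.length φ δ n) ≠ ∅}
          ≤ ε := by
  let κ : Fin m → Type := fun e => Fin (st b e).waiting.length
  have hdec : DecidableEq (Σ e, κ e) := Classical.decEq _
  let W : Fin m → List ℕ := waitingLists b
  -- A packet reads its pattern at its position in the waiting list; the default `∅` belongs to
  -- packets that do not take part.
  let S : ((Σ e, κ e) → Finset ℕ) → Fin m → ℕ → Finset ℕ := fun ω e j =>
    if h : j ∈ W e then ω ⟨e, ⟨(W e).idxOf j, List.idxOf_lt_length_of_mem h⟩⟩ else ∅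
  have hS : ∀ ω e (i : κ e), S ω e ((W e).get i) = ω ⟨e, i⟩ := by
    intro ω e i
    have hmem : (W e).get i ∈ W e := List.get_mem _ _
    simp only [S, hmem, dif_pos]
    congr 2
    exact Fin.ext (List.Nodup.idxOf_getElem (hb e) i.1 i.2)
  refine ⟨(Σ e, κ e) → Finset ℕ, inferInstance,
    Measure.pi fun _ => (pattern φ δ n).toMeasure, inferInstance, inferInstance, S, fun G => ?_,
    fun ε hε hN => ?_⟩
  · have hdraw : ∀ e, draw m T φ δ n n' t (st b e) = startFrame φ δ n (st b e) := fun e => by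
      rw [draw, if_pos ht]
    unfold drawMeasure
    simp only [hdraw, startFrame, PMF.map_comp]
    simp_rw [toMeasure_drawAll_map]
    rw [lintegral_pi_map (fun e => Measure.pi fun _ : κ e => (pattern φ δ n).toMeasure)
      (fun _ => Measurable.of_discrete), lintegral_pi_sigma]
    refine lintegral_congr fun ω => ?_
    congr 1
    ext1 e
    simp only [startConfig, Function.comp_apply]
    congr 2
    refine List.ext_getElem (by simp) fun i h1 h2 => ?_
    simp only [List.getElem_ofFn, List.getElem_map]
    rw [← hS ω e]
    rfl
  -- Without duplicates, positions and packets correspond, so the execution on the packets is one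
  -- with independent patterns indexed by positions.
  · let emb : (Σ e, κ e) ↪ (Σ _ : Fin m, ℕ) :=
      ⟨fun p => ⟨p.1, (W p.1).get p.2⟩, by
        rintro ⟨e, i⟩ ⟨e', i'⟩ h
        simp only [Sigma.mk.injEq, heq_eq_eq] at h
        obtain ⟨rfl, h⟩ := h
        rw [List.nodup_iff_injective_get.1 (hb e) h]⟩
    have hpack : packets W = Finset.univ.map emb := by
      ext ⟨e, j⟩
      rw [mem_packets, Finset.mem_map, List.mem_iff_get]
      constructor
      · rintro ⟨i, rfl⟩
        exact ⟨⟨e, i⟩, Finset.mem_univ _, rfl⟩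
      · rintro ⟨⟨e', i⟩, -, h⟩
        cases h
        exact ⟨i, rfl⟩
    have hcard : (Finset.univ : Finset (Σ e, κ e)).card ≤ n := by
      rw [Finset.card_univ, Fintype.card_sigma]
      simpa [κ] using hN
    refine le_trans (le_of_eq ?_) (hε (Σ e, κ e) Finset.univ hcard)
    congr 1
    ext ω
    have hpat : (fun p => patterns (S ω) (emb p)) = ω := by
      ext1 ⟨e, i⟩
      exact hS ω e i
    rw [Set.mem_ofPred_eq, Set.mem_ofPred_eq]
    change remFrom (packets W) _ _ _ ≠ ∅ ↔ _
    rw [hpack, remFrom_map, hpat]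
    simp

/-- The list of failed packets at the beginning of the clean-up phase. -/
def failedList (x : LocalState) : List ℕ := x.failed ++ x.active.map Prod.fst

/-- The packets that a station selects for the clean-up phase when its coin shows `u`. -/
def selected (u : Bool) (l : List ℕ) : List ℕ := if u then l.head?.toList else []

/-- The configuration after the draws at the beginning of the clean-up phase. -/
def cleanConfig (L : ℕ) (c : Config m T φ δ n n') (u : Fin m → Bool) (S : Fin m → Finset ℕ) :
    Config m T φ δ n n' :=
  fun e => mkStation { st c e with
    active := (selected (u e) (failedList (st c e))).map fun j => (j, (S e).image (L + ·)),
    failed := failedList (st c e) } (c e).injected (c e).pending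

/-- The law of the coins and patterns of the stations for the clean-up phase. -/
noncomputable def cleanLaw (m : ℕ) (φ δ : ℝ) (n' : ℕ) :
    Measure ((Fin m → Bool) × (Fin m → Finset ℕ)) :=
  (Measure.pi fun _ => (coin (1 / m)).toMeasure).prod
    (Measure.pi fun _ => (pattern φ δ n').toMeasure)

instance : IsProbabilityMeasure (cleanLaw m φ δ n') := by unfold cleanLaw; infer_instance

/-- Drawing a coin and a pattern even where they go unused does not change the law, but makes the
draws a product measure that does not depend on the configuration. -/
theorem startCleanUp_eq (L : ℕ) (x : LocalState) :
    startCleanUp m φ δ n' L x = (coin (1 / m)).bind fun u => (pattern φ δ n').map fun S =>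
      { x with
        active := (selected u (failedList x)).map fun j => (j, S.image (L + ·)),
        failed := failedList x } := by
  unfold startCleanUp
  rcases h : x.failed ++ x.active.map Prod.fst with _ | ⟨j, l⟩
  · have hl : failedList x = [] := h
    simp only [hl, selected, List.head?_nil, Option.toList_none, ite_self, List.map_nil]
    have := PMF.map_const (pattern φ δ n') ({ x with active := [], failed := [] } : LocalState)
    unfold Function.const at this
    rw [this, PMF.bind_const]
  · have hl : failedList x = j :: l := h
    simp only [hl]
    congr 1
    ext1 u
    cases u
    · have := PMF.map_const (pattern φ δ n') ({ x with active := [], failed := j :: l } : LocalState)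
      unfold Function.const at this
      simp [selected, this]
    · simp [selected]

theorem lintegral_drawMeasure_cleanUp {t : ℕ} (h0 : StaticMAC.length φ δ n ≠ 0)
    (ht : t % T = StaticMAC.length φ δ n) (c : Config m T φ δ n n')
    (G : Config m T φ δ n n' → ℝ≥0∞) :
    ∫⁻ c', G c' ∂drawMeasure t c =
      ∫⁻ x, G (cleanConfig (StaticMAC.length φ δ n) c x.1 x.2) ∂cleanLaw m φ δ n' := by
  have hdraw : ∀ e, draw m T φ δ n n' t (st c e) =
      startCleanUp m φ δ n' (StaticMAC.length φ δ n) (st c e) := fun e => by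
    rw [draw, if_neg (by rw [ht]; exact h0), if_pos ht]
  unfold drawMeasure cleanLaw
  simp only [hdraw, startCleanUp_eq, PMF.map_bind, PMF.map_comp]
  simp_rw [toMeasure_bind_map]
  rw [lintegral_pi_map (fun _ : Fin m => (coin (1 / m)).toMeasure.prod (pattern φ δ n').toMeasure)
    (fun _ => Measurable.of_discrete), lintegral_pi_prod,
    lintegral_prod _ Measurable.of_discrete.aemeasurable]
  rfl

end FrameProtocol

/-! ### One frame -/

namespace FrameProtocol

open StaticMAC SymmetricProtocol

variable {m T : ℕ} {φ δ : ℝ} {n n' : ℕ}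

/-- The situation at the beginning of the frame with index `f`, before the random draws. -/
structure Boundary (a : ℕ → Fin m → ℕ) (f : ℕ) (b : Config m T φ δ n n') : Prop where
  injected : ∀ e, (b e).injected = firstIndex a (f * T) e
  st_injected : ∀ e, (st b e).injected = firstIndex a (f * T) e
  waiting : ∀ e, (st b e).waiting = List.range' (firstIndex a ((f - 1) * T) e)
    (firstIndex a (f * T) e - firstIndex a ((f - 1) * T) e)
  failed_nodup : ∀ e, (st b e).failed.Nodup
  failed_lt : ∀ e, ∀ j ∈ (st b e).failed, j < firstIndex a ((f - 1) * T) e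
  mem_pending : ∀ e j, j ∈ (b e).pending ↔ j ∈ (st b e).failed ∨ j ∈ (st b e).waiting

/-- For `f = 0` the truncated `f - 1` is `0`, so the range of waiting packets is empty. -/
theorem boundary_initConfig (a : ℕ → Fin m → ℕ) : Boundary a 0 (initConfig m T φ δ n n') := by
  constructor <;> simp [initConfig, st, firstIndex]

theorem firstIndex_mono (a : ℕ → Fin m → ℕ) (e : Fin m) {t t' : ℕ} (h : t ≤ t') :
    firstIndex a t e ≤ firstIndex a t' e :=
  Finset.sum_le_sum_of_subset (Finset.range_subset_range.2 h)

theorem firstIndex_add (a : ℕ → Fin m → ℕ) (e : Fin m) (t i : ℕ) :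
    firstIndex a (t + i) e = firstIndex a t e + injectedIn a t i e :=
  Finset.sum_range_add _ _ _

theorem Boundary.lt_of_mem_pending {a : ℕ → Fin m → ℕ} {f : ℕ} {b : Config m T φ δ n n'}
    (h : Boundary a f b) {e : Fin m} {j : ℕ} (hj : j ∈ (b e).pending) :
    j < firstIndex a (f * T) e := by
  have hmono := firstIndex_mono a e (Nat.mul_le_mul_right T (Nat.sub_le f 1))
  rcases (h.mem_pending e j).1 hj with hj | hj
  · exact (h.failed_lt e j hj).trans_le hmono
  · rw [h.waiting, List.mem_range'_1] at hj
    omega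

theorem Boundary.disjoint {a : ℕ → Fin m → ℕ} {f : ℕ} {b : Config m T φ δ n n'}
    (h : Boundary a f b) {e : Fin m} {j : ℕ} (hj : j ∈ (st b e).failed) :
    j ∉ (st b e).waiting := by
  have := h.failed_lt e j hj
  rw [h.waiting, List.mem_range'_1]
  omega

theorem Boundary.waiting_nodup {a : ℕ → Fin m → ℕ} {f : ℕ} {b : Config m T φ δ n n'}
    (h : Boundary a f b) (e : Fin m) : (st b e).waiting.Nodup := by
  rw [h.waiting]
  exact List.nodup_range'

theorem Boundary.length_waiting {a : ℕ → Fin m → ℕ} {f : ℕ} {b : Config m T φ δ n n'}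
    (h : Boundary a f b) (e : Fin m) : (st b e).waiting.length =
      firstIndex a (f * T) e - firstIndex a ((f - 1) * T) e := by
  rw [h.waiting, List.length_range']

/-- The failed packets after the main phase, when the packets in `R` remain. -/
def failedAfterMain (b : Config m T φ δ n n') (R : Finset (Σ _ : Fin m, ℕ)) (e : Fin m) : List ℕ :=
  (st b e).failed ++ (st b e).waiting.filter fun j => (⟨e, j⟩ : Σ _ : Fin m, ℕ) ∈ R

/-- The stations that select a packet in the clean-up phase. -/
def selecting (u : Fin m → Bool) (l : Fin m → List ℕ) : Finset (Fin m) :=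
  Finset.univ.filter fun e => u e = true ∧ l e ≠ []

/-- The configuration at the end of the frame that begins in slot `t`, as a function of the
patterns of the main phase and of the coins and patterns of the clean-up phase. -/
noncomputable def frameResult (a : ℕ → Fin m → ℕ) (t : ℕ) (b : Config m T φ δ n n')
    (S : Fin m → ℕ → Finset ℕ) (u : Fin m → Bool) (S' : Fin m → Finset ℕ) : Config m T φ δ n n' :=
  recordSteps a (t + StaticMAC.length φ δ n) (T - StaticMAC.length φ δ n)
    (cleanConfig (StaticMAC.length φ δ n)
      (recordSteps a t (StaticMAC.length φ δ n) (startConfig b S)) u S')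

/-- The default `0` is never used, since the list is non-empty in that branch. -/
theorem selected_eq (u : Bool) (l : List ℕ) :
    selected u l = if u = true ∧ l ≠ [] then [l.head?.getD 0] else [] := by
  cases u <;> cases l <;> simp [selected]

theorem mem_of_mem_selected {u : Bool} {l : List ℕ} {j : ℕ} (h : j ∈ selected u l) : j ∈ l := by
  cases u <;> cases l <;> simp_all [selected]

/-- The packets of the clean-up phase that remain, in terms of the stations that select them. -/
theorem remFrom_selected (L i : ℕ) (u : Fin m → Bool) (l : Fin m → List ℕ)
    (S : Fin m → Finset ℕ) (e : Fin m) (j : ℕ) :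
    (⟨e, j⟩ : Σ _ : Fin m, ℕ) ∈ remFrom (packets fun e => selected (u e) (l e))
      (patterns fun e _ => (S e).image (L + ·)) L i ↔
      j = (l e).head?.getD 0 ∧ e ∈ remFrom (selecting u l) S 0 i := by
  -- Each station offers at most its oldest failed packet, so a clean-up phase is an execution of
  -- the static algorithm with the stations as packets.
  let emb : Fin m ↪ (Σ _ : Fin m, ℕ) := ⟨fun e => ⟨e, (l e).head?.getD 0⟩, fun e e' h => by
    simpa using congrArg Sigma.fst h⟩
  have hpack : packets (fun e => selected (u e) (l e)) = (selecting u l).map emb := by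
    ext ⟨e, j⟩
    rw [mem_packets, Finset.mem_map, selected_eq]
    constructor
    · intro h
      split_ifs at h with h1
      · rw [List.mem_singleton] at h
        subst h
        exact ⟨e, by simpa [selecting] using h1, rfl⟩
      · simp at h
    · rintro ⟨e', h, h'⟩
      cases h'
      simp only [selecting, Finset.mem_filter, Finset.mem_univ, true_and] at h
      rw [if_pos h]
      exact List.mem_singleton.2 rfl
  rw [hpack, remFrom_map]
  have hS : remFrom (selecting u l) (fun p => patterns (fun e _ => (S e).image (L + ·)) (emb p)) L i =
      remFrom (selecting u l) S 0 i := remFrom_congr fun p _ k _ => by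
    simp only [patterns, Finset.mem_image, Nat.add_left_cancel_iff, exists_eq_right, zero_add]
    exact Iff.rfl
  rw [hS, Finset.mem_map]
  constructor
  · rintro ⟨e', h, h'⟩
    cases h'
    exact ⟨rfl, h⟩
  · rintro ⟨rfl, h⟩
    exact ⟨e, h, rfl⟩

theorem Boundary.ready {a : ℕ → Fin m → ℕ} {f : ℕ} {b : Config m T φ δ n n'} (h : Boundary a f b)
    (S : Fin m → ℕ → Finset ℕ) : Ready (waitingLists b) S (startConfig b S) where
  injected e := (h.st_injected e).trans (h.injected e).symm
  active _ := rfl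
  mem_pending e _ hj := (h.mem_pending e _).2 (Or.inr hj)
  lt_injected e _ hj := (h.lt_of_mem_pending hj).trans_eq (h.injected e).symm

/-- The deterministic core of a frame, from two runs of `Ready.running_recordSteps`. New failures
are appended behind the old ones and clean-up can only remove the head, so the failed packets form a
first-in-first-out queue. -/
theorem frameResult_spec {a : ℕ → Fin m → ℕ} {f : ℕ} {b : Config m T φ δ n n'}
    (h : Boundary a f b) (hL : StaticMAC.length φ δ n < T)
    (hL' : StaticMAC.length φ δ n + StaticMAC.length φ δ n' ≤ T)
    (S : Fin m → ℕ → Finset ℕ) (u : Fin m → Bool) (S' : Fin m → Finset ℕ) :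
    let l := failedAfterMain b
      (remFrom (packets (waitingLists b)) (patterns S) 0 (StaticMAC.length φ δ n))
    Boundary a (f + 1) (frameResult a (f * T) b S u S') ∧
      (∀ e, (st (frameResult a (f * T) b S u S') e).failed = l e ∨
        (st (frameResult a (f * T) b S u S') e).failed = (l e).tail) ∧
      (remFrom (selecting u l) S' 0 (StaticMAC.length φ δ n') = ∅ → ∀ e, u e = true →
        (st (frameResult a (f * T) b S u S') e).failed = (l e).tail) := by
  intro l
  set L := StaticMAC.length φ δ n with hLdef
  set R := remFrom (packets (waitingLists b)) (patterns S) 0 L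
  have hRsub : R ⊆ packets (waitingLists b) := remFrom_subset _ _ _ _
  have hready := h.ready S
  have hmod : ∀ k < T, (f * T + k) % T = k := fun k hk => by
    rw [Nat.add_comm, Nat.add_mul_mod_self_right, Nat.mod_eq_of_lt hk]
  have hrun := hready.running_recordSteps a (t := f * T) (r := 0) (i := L) fun k hk => by
    rw [zero_add]; exact hmod k (by omega)
  set c := recordSteps a (f * T) L (startConfig b S) with hc
  have hinj₀ : ∀ e, (startConfig b S e).injected = firstIndex a (f * T) e := h.injected
  have hst₀ : ∀ e, (st (startConfig b S) e).failed = (st b e).failed := fun _ => rfl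
  have hwait₀ : ∀ e, (st (startConfig b S) e).waiting = [] := fun _ => rfl
  have hpend₀ : ∀ e, (startConfig b S e).pending = (b e).pending := fun _ => rfl
  have hfl : ∀ e, failedList (st c e) = l e := by
    intro e
    have h1 : (st c e).failed = (st b e).failed := by
      rw [hrun.failed, hst₀, List.filter_eq_self]
      intro j hj
      rw [decide_eq_true_eq]
      exact fun hj' => absurd hj' (h.disjoint hj)
    have h2 : (st c e).active.map Prod.fst =
        (st b e).waiting.filter fun j => (⟨e, j⟩ : Σ _ : Fin m, ℕ) ∈ R := by
      rw [hrun.active, List.map_map]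
      exact List.map_id _
    rw [failedList, h1, h2]
    rfl
  have hmeml : ∀ e j, j ∈ l e ↔ j ∈ (st b e).failed ∨
      (j ∈ (st b e).waiting ∧ (⟨e, j⟩ : Σ _ : Fin m, ℕ) ∈ R) := fun e j => by
    simp only [l, failedAfterMain, List.mem_append, List.mem_filter, decide_eq_true_eq]
    exact Iff.rfl
  have hl_pending : ∀ e j, j ∈ l e ↔ (j ∈ (b e).pending ∧
      (j ∈ waitingLists b e → (⟨e, j⟩ : Σ _ : Fin m, ℕ) ∈ R)) := fun e j => by
    rw [hmeml, h.mem_pending]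
    have := @Boundary.disjoint _ _ _ _ _ _ _ _ _ h e j
    simp only [waitingLists]
    tauto
  have hl_lt : ∀ e, ∀ j ∈ l e, j < firstIndex a (f * T) e := fun e j hj =>
    h.lt_of_mem_pending ((hl_pending e j).1 hj).1
  have hl_nodup : ∀ e, (l e).Nodup := fun e => by
    refine List.Nodup.append (h.failed_nodup e) ((h.waiting_nodup e).filter _) ?_
    intro j hj hj'
    exact h.disjoint hj (List.mem_of_mem_filter hj')
  set base : Fin m → List ℕ := fun e => selected (u e) (l e) with hbase
  set P : Fin m → ℕ → Finset ℕ := fun e _ => (S' e).image (L + ·) with hP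
  set c₁ := cleanConfig L c u S' with hc₁
  have hbase_l : ∀ e, ∀ j ∈ base e, j ∈ l e := fun e j hj => mem_of_mem_selected hj
  have hpend₁ : ∀ e j, j ∈ (c₁ e).pending ↔ j ∈ l e ∨
      (firstIndex a (f * T) e ≤ j ∧ j < firstIndex a (f * T + L) e) := fun e j => by
    have h1 : (c₁ e).pending = (c e).pending := rfl
    rw [h1, hrun.pending, Finset.mem_union, Finset.mem_filter, Finset.mem_Ico, hpend₀, hinj₀,
      ← firstIndex_add, hl_pending]
  have hinj₁ : ∀ e, (c₁ e).injected = firstIndex a (f * T + L) e := fun e => by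
    have h1 : (c₁ e).injected = (c e).injected := rfl
    rw [h1, hrun.injected, hinj₀, ← firstIndex_add]
  have hsti₁ : ∀ e, (st c₁ e).injected = firstIndex a (f * T + L) e := fun e => by
    have h1 : (st c₁ e).injected = (st c e).injected := rfl
    rw [h1, hrun.st_injected, hinj₀, ← firstIndex_add]
  have hfailed₁ : ∀ e, (st c₁ e).failed = l e := hfl
  have hwait₁ : ∀ e, (st c₁ e).waiting = List.range' (firstIndex a (f * T) e)
      (injectedIn a (f * T) L e) := fun e => by
    have h1 : (st c₁ e).waiting = (st c e).waiting := rfl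
    rw [h1, hrun.waiting, hwait₀, hinj₀, List.nil_append]
  have hready₁ : Ready base P c₁ := by
    refine ⟨fun e => (hsti₁ e).trans (hinj₁ e).symm, fun e => ?_, fun e j hj =>
      (hpend₁ e j).2 (Or.inl (hbase_l e j hj)), fun e j hj => ?_⟩
    · have h1 : (st c₁ e).active =
        (selected (u e) (failedList (st c e))).map fun j => (j, (S' e).image (L + ·)) := rfl
      rw [h1, hfl]
    · rw [hinj₁]
      have hm := firstIndex_mono a e (Nat.le_add_right (f * T) L)
      rcases (hpend₁ e j).1 hj with hj | hj
      · exact (hl_lt e j hj).trans_le hm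
      · exact hj.2
  -- The run covers the whole rest of the frame, which may be longer than the algorithm; additional
  -- slots can only shrink the remaining set.
  have hrun₁ := hready₁.running_recordSteps a (t := f * T + L) (r := L) (i := T - L) fun k hk => by
    rw [add_assoc]; exact hmod _ (by omega)
  have hres : frameResult a (f * T) b S u S' = recordSteps a (f * T + L) (T - L) c₁ := rfl
  set b' := recordSteps a (f * T + L) (T - L) c₁
  have hTL : f * T + L + (T - L) = (f + 1) * T := by rw [add_mul, one_mul]; omega
  have hwait' : ∀ e, (st b' e).waiting = List.range' (firstIndex a (f * T) e)
      (firstIndex a ((f + 1) * T) e - firstIndex a (f * T) e) := fun e => by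
    rw [hrun₁.waiting, hwait₁, hinj₁, firstIndex_add, List.range'_append_1, ← hTL, firstIndex_add,
      firstIndex_add]
    congr 1
    omega
  have hrem : ∀ e j, (⟨e, j⟩ : Σ _ : Fin m, ℕ) ∈ remFrom (packets base) (patterns P) L (T - L) ↔
      j = (l e).head?.getD 0 ∧ e ∈ remFrom (selecting u l) S' 0 (T - L) := fun e j =>
    remFrom_selected L (T - L) u l S' e j
  -- The list has no duplicates, so filtering out a delivered head leaves exactly the tail.
  have hfailed' : ∀ e, (st b' e).failed =
      if u e = true ∧ e ∉ remFrom (selecting u l) S' 0 (T - L) then (l e).tail else l e := by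
    intro e
    rw [hrun₁.failed, hfailed₁]
    simp only [hrem]
    have hnd := hl_nodup e
    rcases hle : l e with _ | ⟨i, r⟩
    · simp
    · rw [hle, List.nodup_cons] at hnd
      cases hu : u e
      · simp [hbase, hu, selected]
      · by_cases hmem : e ∈ remFrom (selecting u l) S' 0 (T - L)
        · simp [hbase, hu, hle, selected, hmem]
        · simp only [hbase, hu, hle, selected, hmem, if_true, List.head?_cons, Option.toList_some,
            List.mem_singleton, and_false, not_false_eq_true, true_and, List.tail_cons]
          rw [List.filter_cons_of_neg (by simp), List.filter_eq_self]
          intro j hj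
          rw [decide_eq_true_eq]
          rintro rfl
          exact hnd.1 hj
  rw [hres]
  refine ⟨⟨fun e => ?_, fun e => ?_, fun e => ?_, fun e => ?_, fun e j hj => ?_, fun e j => ?_⟩,
    fun e => ?_, fun hemp e hu => ?_⟩
  · rw [hrun₁.injected, hinj₁, ← firstIndex_add, hTL]
  · rw [hrun₁.st_injected, hinj₁, ← firstIndex_add, hTL]
  · rw [Nat.add_sub_cancel]
    exact hwait' e
  · rw [hrun₁.failed, hfailed₁]
    exact (hl_nodup e).filter _
  · rw [hrun₁.failed, hfailed₁] at hj
    rw [Nat.add_sub_cancel]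
    exact hl_lt e j (List.mem_of_mem_filter hj)
  · rw [hrun₁.pending, hrun₁.failed, hfailed₁, hwait', Finset.mem_union, Finset.mem_filter, hpend₁,
      Finset.mem_Ico, hinj₁, ← firstIndex_add, hTL, List.mem_range'_1, List.mem_filter,
      decide_eq_true_eq]
    have hm1 := firstIndex_mono a e (Nat.le_add_right (f * T) L)
    have hm2 : firstIndex a (f * T + L) e ≤ firstIndex a ((f + 1) * T) e :=
      firstIndex_mono a e (by rw [← hTL]; omega)
    have h2 := hbase_l e j
    have h3 := hl_lt e j
    constructor
    · rintro (⟨h4 | h4, h5⟩ | h4)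
      · exact Or.inl ⟨h4, h5⟩
      · exact Or.inr (by omega)
      · exact Or.inr (by omega)
    · rintro (h4 | h4)
      · exact Or.inl ⟨Or.inl h4.1, h4.2⟩
      · by_cases h5 : j < firstIndex a (f * T + L) e
        · refine Or.inl ⟨Or.inr ⟨h4.1, h5⟩, fun h6 => ?_⟩
          have := h3 (h2 h6)
          omega
        · exact Or.inr (by omega)
  · rw [hfailed']
    split_ifs
    · exact Or.inr rfl
    · exact Or.inl rfl
  · have hnot : e ∉ remFrom (selecting u l) S' 0 (T - L) := fun hmem => by
      have := remFrom_anti (selecting u l) S' 0 (show StaticMAC.length φ δ n' ≤ T - L by omega) hmem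
      rw [hemp] at this
      simp at this
    rw [hfailed', if_pos ⟨hu, hnot⟩]

end FrameProtocol

/-! ### The random transition of a frame -/

namespace FrameProtocol

open StaticMAC SymmetricProtocol

variable (m T : ℕ) (φ δ : ℝ) (n n' : ℕ) (ε : ℝ≥0∞)

/-- Parameters for which the main phase fails with probability at most `ε` for at most `n` packets,
and the clean-up phase with probability at most `1 / 2`. -/
structure Suitable : Prop where
  one_le : 1 ≤ m
  length_pos : 0 < StaticMAC.length φ δ n
  length_lt : StaticMAC.length φ δ n < T
  length_add_le : StaticMAC.length φ δ n + StaticMAC.length φ δ n' ≤ T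
  main : ∀ (ι : Type) [Fintype ι] [DecidableEq ι] (A : Finset ι), A.card ≤ n →
    (Measure.pi fun _ : ι => (pattern φ δ n).toMeasure)
      {S | remFrom A S 0 (StaticMAC.length φ δ n) ≠ ∅} ≤ ε
  cleanUp : ∀ A : Finset (Fin m), (Measure.pi fun _ : Fin m => (pattern φ δ n').toMeasure)
      {S | remFrom A S 0 (StaticMAC.length φ δ n') ≠ ∅} ≤ 1 / 2

variable {m T φ δ n n' ε}

theorem Suitable.pos (h : Suitable m T φ δ n n' ε) : 0 < T :=
  (Nat.zero_le _).trans_lt h.length_lt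

/-- The expectation of `G` at the end of the frame that begins in slot `t` with configuration `b`. -/
noncomputable def frameExpectation (a : ℕ → Fin m → ℕ) (t : ℕ) (b : Config m T φ δ n n')
    (G : Config m T φ δ n n' → ℝ≥0∞) : ℝ≥0∞ :=
  ∫⁻ c, ∫⁻ c', G (recordSteps a (t + StaticMAC.length φ δ n) (T - StaticMAC.length φ δ n) c')
    ∂drawMeasure (t + StaticMAC.length φ δ n) (recordSteps a t (StaticMAC.length φ δ n) c)
    ∂drawMeasure t b

/-- Since `0 < length φ δ n < T`, the two draws of a frame fall into different slots and each is
followed by at least one slot. -/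
theorem Suitable.lintegral_pre_frame (h : Suitable m T φ δ n n' ε) (a : ℕ → Fin m → ℕ) (f : ℕ)
    (G : Config m T φ δ n n' → ℝ≥0∞) :
    ∫⁻ b, G b ∂pre a ((f + 1) * T) = ∫⁻ b, frameExpectation a (f * T) b G ∂pre a (f * T) := by
  have hmod : ∀ k < T, (f * T + k) % T = k := fun k hk => by
    rw [Nat.add_comm, Nat.add_mul_mod_self_right, Nat.mod_eq_of_lt hk]
  have h1 := h.length_pos
  have h2 := h.length_lt
  unfold frameExpectation
  set L := StaticMAC.length φ δ n with hL
  obtain ⟨i, hi⟩ : ∃ i, L = i + 1 := ⟨L - 1, by omega⟩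
  obtain ⟨k, hk⟩ : ∃ k, T - L = k + 1 := ⟨T - L - 1, by omega⟩
  have hT : (f + 1) * T = (f * T + L) + (k + 1) := by rw [add_mul, one_mul]; omega
  rw [hT, lintegral_pre_add a (f * T + L) k fun x hx hx' => by
    rw [add_assoc, hmod _ (by omega), ← hL]; omega]
  have h3 := lintegral_pre_add a (f * T) i (fun x hx hx' => by
    rw [hmod _ (by omega), ← hL]; omega)
    fun c => ∫⁻ c', G (recordSteps a (f * T + L) (k + 1) c') ∂drawMeasure (f * T + L) c
  rw [← hi] at h3
  rw [h3, hk]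

/-- The probability that a station selects and all selected packets are delivered. -/
theorem Suitable.le_cleanLaw (h : Suitable m T φ δ n n' ε) (l : Fin m → List ℕ) (e : Fin m) :
    (2 * (m : ℝ≥0∞))⁻¹ ≤ cleanLaw m φ δ n'
      {x | x.1 e = true ∧ remFrom (selecting x.1 l) x.2 0 (StaticMAC.length φ δ n') = ∅} := by
  have hm : (0 : ℝ) < m := by exact_mod_cast h.one_le
  set π := Measure.pi fun _ : Fin m => (pattern φ δ n').toMeasure
  -- The coins are independent of the patterns and this bound is uniform in `A`, so it survives
  -- conditioning on the coins, which determine the selecting stations.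
  have hhalf : ∀ A : Finset (Fin m), 1 / 2 ≤
      π {S | remFrom A S 0 (StaticMAC.length φ δ n') = ∅} := fun A => by
    have h1 := h.cleanUp A
    have hset : {S : Fin m → Finset ℕ | remFrom A S 0 (StaticMAC.length φ δ n') = ∅} =
        {S | remFrom A S 0 (StaticMAC.length φ δ n') ≠ ∅}ᶜ := by
      ext S
      simp
    rw [hset, prob_compl_eq_one_sub MeasurableSet.of_discrete]
    refine ENNReal.le_sub_of_add_le_left (ne_top_of_le_ne_top (by simp) h1) ?_
    calc _ ≤ (1 / 2 + 1 / 2 : ℝ≥0∞) := by gcongr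
      _ = 1 := ENNReal.add_halves 1
  have hcoin : (Measure.pi fun _ : Fin m => (coin (1 / m)).toMeasure) {u | u e = true} =
      (m : ℝ≥0∞)⁻¹ := by
    have hs : MeasurableSet ({true} : Set Bool) := MeasurableSet.of_discrete
    have h1 := (measurePreserving_eval (fun _ : Fin m => (coin (1 / m)).toMeasure)
      e).measure_preimage hs.nullMeasurableSet
    have h2 := measureReal_coin_true (p := 1 / m) (by positivity)
      (by rw [div_le_one hm]; exact_mod_cast h.one_le)
    have h3 : {u : Fin m → Bool | u e = true} = (Function.eval e : (Fin m → Bool) → Bool) ⁻¹' {true} := rfl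
    rw [h3, h1, ← ofReal_measureReal, h2, one_div, ENNReal.ofReal_inv_of_pos hm,
      ENNReal.ofReal_natCast]
  rw [cleanLaw, Measure.prod_apply MeasurableSet.of_discrete]
  calc (2 * (m : ℝ≥0∞))⁻¹ = (1 / 2) * (m : ℝ≥0∞)⁻¹ := by
        rw [ENNReal.mul_inv (by simp) (by simp), one_div]
    _ = ∫⁻ u, (1 / 2) * ({u : Fin m → Bool | u e = true}.indicator 1 u)
          ∂Measure.pi fun _ : Fin m => (coin (1 / m)).toMeasure := by
        rw [lintegral_const_mul _ Measurable.of_discrete,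
          lintegral_indicator_one MeasurableSet.of_discrete, hcoin]
    _ ≤ _ := by
        refine lintegral_mono fun u => ?_
        by_cases hu : u e = true
        · rw [Set.indicator_of_mem (by exact hu), Pi.one_apply, mul_one]
          refine (hhalf (selecting u l)).trans (measure_mono fun S hS => ?_)
          exact ⟨hu, hS⟩
        · rw [Set.indicator_of_notMem (by exact hu), mul_zero]
          exact zero_le

theorem inv_two_mul_le_one {m : ℕ} (h : 1 ≤ m) : (2 * (m : ℝ≥0∞))⁻¹ ≤ 1 := by
  rw [ENNReal.inv_le_one]
  have : (1 : ℝ≥0∞) ≤ m := by exact_mod_cast h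
  calc (1 : ℝ≥0∞) = 1 * 1 := (one_mul 1).symm
    _ ≤ 2 * m := by gcongr; norm_num

/-- What happens to the failed packets of station `e` during a frame. -/
theorem Suitable.exists_frameExpectation_le (h : Suitable m T φ δ n n' ε) {a : ℕ → Fin m → ℕ}
    {f : ℕ} {b : Config m T φ δ n n'} (hb : Boundary a f b) :
    ∃ (Ω : Type) (_ : MeasurableSpace Ω) (ν : Measure Ω) (_ : IsProbabilityMeasure ν)
      (_ : DiscreteMeasurableSpace Ω) (l : Ω → Fin m → List ℕ),
      (∀ ω e, ∃ w, w.Sublist (st b e).waiting ∧ l ω e = (st b e).failed ++ w) ∧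
      (∑ e, (st b e).waiting.length ≤ n → ∀ e, ν {ω | l ω e ≠ (st b e).failed} ≤ ε) ∧
      (∀ Q : Config m T φ δ n n' → Prop, (∀ c, Boundary a (f + 1) c → Q c) →
        frameExpectation a (f * T) b (Set.indicator {c | ¬ Q c} 1) = 0) ∧
      ∀ (F : List ℕ → ℝ≥0∞) (e : Fin m), (∀ l : List ℕ, l.Nodup → F l.tail ≤ F l) →
        frameExpectation a (f * T) b (fun c => F (st c e).failed) ≤
          ∫⁻ ω, ((2 * (m : ℝ≥0∞))⁻¹ * F (l ω e).tail + (1 - (2 * (m : ℝ≥0∞))⁻¹) * F (l ω e)) ∂ν := by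
  have ht : f * T % T = 0 := Nat.mul_mod_left f T
  have hmod : (f * T + StaticMAC.length φ δ n) % T = StaticMAC.length φ δ n := by
    rw [Nat.add_comm, Nat.add_mul_mod_self_right, Nat.mod_eq_of_lt h.length_lt]
  obtain ⟨Ω, _, ν, _, _, S, hS, hmain⟩ :=
    exists_lintegral_drawMeasure_start ht b hb.waiting_nodup
  set R : Ω → Finset (Σ _ : Fin m, ℕ) := fun ω =>
    remFrom (packets (waitingLists b)) (patterns (S ω)) 0 (StaticMAC.length φ δ n)
  have hexp : ∀ G, frameExpectation a (f * T) b G =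
      ∫⁻ ω, ∫⁻ x, G (frameResult a (f * T) b (S ω) x.1 x.2) ∂cleanLaw m φ δ n' ∂ν := by
    intro G
    unfold frameExpectation
    simp_rw [lintegral_drawMeasure_cleanUp h.length_pos.ne' hmod]
    rw [hS]
    rfl
  have hspec := fun ω => frameResult_spec hb h.length_lt h.length_add_le (S ω)
  refine ⟨Ω, inferInstance, ν, inferInstance, inferInstance, fun ω => failedAfterMain b (R ω),
    fun ω e => ⟨_, List.filter_sublist, rfl⟩, fun hn e => ?_, fun Q hQ => ?_, fun F e hF => ?_⟩
  · refine (measure_mono fun ω hω => ?_).trans (hmain ε h.main hn)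
    intro hemp
    apply hω
    change failedAfterMain b (R ω) e = _
    rw [show R ω = ∅ from hemp]
    simp [failedAfterMain]
  · rw [hexp]
    have : ∀ ω (x : (Fin m → Bool) × (Fin m → Finset ℕ)), Set.indicator {c | ¬ Q c} (1 : Config m T φ δ n n' → ℝ≥0∞)
        (frameResult a (f * T) b (S ω) x.1 x.2) = 0 := fun ω x =>
      Set.indicator_of_notMem (fun hn : ¬ Q _ => hn (hQ _ (hspec ω x.1 x.2).1)) _
    simp [this]
  · rw [hexp]
    refine lintegral_mono fun ω => ?_
    set l := failedAfterMain b (R ω)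
    have hnd : (l e).Nodup := by
      refine List.Nodup.append (hb.failed_nodup e) ((hb.waiting_nodup e).filter _) ?_
      intro j hj hj'
      exact hb.disjoint hj (List.mem_of_mem_filter hj')
    have hFl := hF (l e) hnd
    set μ : ℝ≥0∞ := (2 * (m : ℝ≥0∞))⁻¹
    have hμ1 : μ ≤ 1 := inv_two_mul_le_one h.one_le
    set E : Set ((Fin m → Bool) × (Fin m → Finset ℕ)) :=
      {x | x.1 e = true ∧ remFrom (selecting x.1 l) x.2 0 (StaticMAC.length φ δ n') = ∅}
    have hE : μ ≤ cleanLaw m φ δ n' E := h.le_cleanLaw l e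
    set p := cleanLaw m φ δ n' E
    have hp1 : p ≤ 1 := prob_le_one
    have hEc : cleanLaw m φ δ n' Eᶜ = 1 - p := prob_compl_eq_one_sub MeasurableSet.of_discrete
    calc _ ≤ ∫⁻ x, (E.indicator (fun _ => F (l e).tail) x + Eᶜ.indicator (fun _ => F (l e)) x)
          ∂cleanLaw m φ δ n' := by
          refine lintegral_mono fun x => ?_
          obtain ⟨-, h1, h2⟩ := hspec ω x.1 x.2
          by_cases hx : x ∈ E
          · rw [Set.indicator_of_mem hx, Set.indicator_of_notMem (by simpa using hx), add_zero,
              h2 hx.2 e hx.1]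
          · rw [Set.indicator_of_notMem hx, Set.indicator_of_mem (by exact hx), zero_add]
            rcases h1 e with h1 | h1
            · rw [h1]
            · rw [h1]
              exact hFl
      _ = p * F (l e).tail + (1 - p) * F (l e) := by
          rw [lintegral_add_left Measurable.of_discrete,
            lintegral_indicator_const MeasurableSet.of_discrete,
            lintegral_indicator_const MeasurableSet.of_discrete, hEc, mul_comm, mul_comm (F (l e))]
      -- The excess `p - μ` of the success probability is given away, using `F (l e).tail ≤ F (l
      -- e)`.
      _ = (μ + (p - μ)) * F (l e).tail + (1 - p) * F (l e) := by
          rw [add_tsub_cancel_of_le hE]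
      _ ≤ μ * F (l e).tail + ((p - μ) * F (l e) + (1 - p) * F (l e)) := by
          rw [add_mul, add_assoc]
          gcongr
      _ = _ := by
          rw [← add_mul]
          congr 2
          rw [add_comm, tsub_add_tsub_cancel hp1 hE]

/-- The frame maps every boundary configuration to one for the next frame, whatever is drawn, so the
invariant is violated with probability 0. -/
theorem Suitable.ae_boundary (h : Suitable m T φ δ n n' ε) (a : ℕ → Fin m → ℕ) (f : ℕ) :
    ∀ᵐ b ∂pre (T := T) (φ := φ) (δ := δ) (n := n) (n' := n') a (f * T), Boundary a f b := by
  induction f with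
  | zero =>
    rw [zero_mul, pre, ae_dirac_iff MeasurableSet.of_discrete]
    exact boundary_initConfig a
  | succ f ih =>
    rw [ae_iff, ← lintegral_indicator_one MeasurableSet.of_discrete, h.lintegral_pre_frame]
    rw [lintegral_congr_ae (g := 0)]
    · simp
    · filter_upwards [ih] with b hb
      obtain ⟨_, _, _, _, _, _, -, -, h1, -⟩ := h.exists_frameExpectation_le hb
      exact h1 _ fun _ hc => hc

end FrameProtocol

/-! ### Queue lengths and latencies for a fixed injection sequence -/

namespace FrameProtocol

open StaticMAC SymmetricProtocol

variable {m T : ℕ} {φ δ : ℝ} {n n' : ℕ} {ε : ℝ≥0∞}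

/-- The number of packets injected in the frame with index `f`. -/
def frameArrivals (a : ℕ → Fin m → ℕ) (T f : ℕ) : ℕ := ∑ e, injectedIn a (f * T) T e

/-- The number of packets on which the main phase of the frame with index `f` is executed. -/
def mainArrivals (a : ℕ → Fin m → ℕ) (T : ℕ) : ℕ → ℕ
  | 0 => 0
  | f + 1 => frameArrivals a T f

theorem Boundary.sum_length_waiting {a : ℕ → Fin m → ℕ} {f : ℕ} {b : Config m T φ δ n n'}
    (h : Boundary a f b) : ∑ e, (st b e).waiting.length = mainArrivals a T f := by
  simp_rw [h.length_waiting]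
  cases f with
  | zero => simp [mainArrivals]
  | succ f =>
    rw [mainArrivals, frameArrivals]
    refine Finset.sum_congr rfl fun e _ => ?_
    rw [Nat.add_sub_cancel, add_mul, one_mul, firstIndex_add, Nat.add_sub_cancel_left]

/-- The exponential potential of a list of failed packets. -/
noncomputable def weight (θ : ℝ) (l : List ℕ) : ℝ≥0∞ := ENNReal.ofReal (Real.exp (θ * l.length))

/-- The factor by which the main phase on `M` packets can increase the expected potential. -/
noncomputable def growth (n : ℕ) (ε : ℝ≥0∞) (θ : ℝ) (M : ℕ) : ℝ≥0∞ :=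
  if M ≤ n then 1 + ε * ENNReal.ofReal (Real.exp (θ * n)) else ENNReal.ofReal (Real.exp (θ * M))

/-- The factor by which the clean-up phase decreases the expected potential. -/
noncomputable def shrink (m : ℕ) (θ : ℝ) : ℝ := 1 - (1 - Real.exp (-θ)) / (2 * m)

/-- A bound on the expected potential at the beginning of the frames. -/
noncomputable def potentialBound (n : ℕ) (ε : ℝ≥0∞) (m : ℕ) (θ : ℝ) (M : ℕ → ℕ) : ℕ → ℝ≥0∞
  | 0 => 1
  | f + 1 => 1 + ENNReal.ofReal (shrink m θ) * (growth n ε θ (M f) * potentialBound n ε m θ M f)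

theorem inv_two_mul_eq_ofReal (hm : 1 ≤ m) : (2 * (m : ℝ≥0∞))⁻¹ = ENNReal.ofReal (1 / (2 * m)) := by
  have : (0 : ℝ) < m := by exact_mod_cast hm
  rw [one_div, ENNReal.ofReal_inv_of_pos (by positivity), ENNReal.ofReal_mul (by norm_num),
    ENNReal.ofReal_natCast, ENNReal.ofReal_ofNat]

theorem weight_tail_le {θ : ℝ} (hθ : 0 ≤ θ) (l : List ℕ) : weight θ l.tail ≤ weight θ l := by
  unfold weight
  gcongr
  simp

theorem weight_append (θ : ℝ) (l w : List ℕ) :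
    weight θ (l ++ w) = weight θ l * ENNReal.ofReal (Real.exp (θ * w.length)) := by
  rw [weight, weight, ← ENNReal.ofReal_mul (by positivity), ← Real.exp_add, List.length_append]
  congr 2
  push_cast
  ring

/-- The effect of the clean-up phase on the potential. -/
theorem weight_cleanUp_le (hm : 1 ≤ m) {θ : ℝ} (hθ : 0 ≤ θ) (l : List ℕ) :
    (2 * (m : ℝ≥0∞))⁻¹ * weight θ l.tail + (1 - (2 * (m : ℝ≥0∞))⁻¹) * weight θ l ≤
      1 + ENNReal.ofReal (shrink m θ) * weight θ l := by
  have hm0 : (1 : ℝ) ≤ m := by exact_mod_cast hm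
  rcases l with _ | ⟨j, r⟩
  -- An empty list has weight 1 and cannot shrink; the summand `1` on the right pays for this case.
  · simp only [List.tail_nil]
    rw [← add_mul, add_tsub_cancel_of_le (inv_two_mul_le_one hm)]
    simp [weight]
  · have hμ0 : (0 : ℝ) ≤ 1 / (2 * m) := by positivity
    have hμ1 : 1 / (2 * (m : ℝ)) ≤ 1 := by
      rw [div_le_one (by positivity)]
      linarith
    have hexp : weight θ (j :: r) = ENNReal.ofReal (Real.exp θ) * weight θ r := by
      rw [weight, weight, ← ENNReal.ofReal_mul (by positivity), ← Real.exp_add]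
      congr 2
      simp
      ring
    have h1 : 1 - (2 * (m : ℝ≥0∞))⁻¹ = ENNReal.ofReal (1 - 1 / (2 * m)) := by
      rw [inv_two_mul_eq_ofReal hm, ENNReal.ofReal_sub _ hμ0, ENNReal.ofReal_one]
    refine le_trans (le_of_eq ?_) le_add_self
    rw [List.tail_cons, hexp, h1, inv_two_mul_eq_ofReal hm, ← mul_assoc, ← mul_assoc, ← add_mul]
    congr 1
    have hs : 0 ≤ shrink m θ := by
      have h2 : 0 ≤ 1 - Real.exp (-θ) := by simp [hθ]
      have h3 : (1 - Real.exp (-θ)) / (2 * m) ≤ 1 := by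
        rw [div_le_one (by positivity)]
        linarith [Real.exp_pos (-θ)]
      rw [shrink]
      linarith
    rw [← ENNReal.ofReal_mul (by linarith), ← ENNReal.ofReal_add hμ0
      (mul_nonneg (by linarith) (Real.exp_pos _).le), ← ENNReal.ofReal_mul hs]
    congr 1
    have h4 : Real.exp (-θ) * Real.exp θ = 1 := by rw [← Real.exp_add]; simp
    rw [shrink]
    linear_combination (-1 / (2 * (m : ℝ))) * h4

/-- With at most `n` waiting packets the list grows only with probability `ε`, and then its weight
gains at most `exp(θ n)`. With more of them all are assumed to fail. Clean-up then contracts the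
result. -/
theorem Suitable.frameExpectation_weight_le (h : Suitable m T φ δ n n' ε) {a : ℕ → Fin m → ℕ}
    {f : ℕ} {b : Config m T φ δ n n'} (hb : Boundary a f b) {θ : ℝ} (hθ : 0 ≤ θ) (e : Fin m) :
    frameExpectation a (f * T) b (fun c => weight θ (st c e).failed) ≤
      1 + ENNReal.ofReal (shrink m θ) *
        (growth n ε θ (mainArrivals a T f) * weight θ (st b e).failed) := by
  obtain ⟨Ω, _, ν, _, _, l, hl, hν, -, hF⟩ := h.exists_frameExpectation_le hb
  have hlen : (st b e).waiting.length ≤ mainArrivals a T f := by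
    rw [← hb.sum_length_waiting]
    exact Finset.single_le_sum (f := fun e => (st b e).waiting.length) (fun _ _ => Nat.zero_le _)
      (Finset.mem_univ e)
  have hmain : ∫⁻ ω, weight θ (l ω e) ∂ν ≤
      growth n ε θ (mainArrivals a T f) * weight θ (st b e).failed := by
    unfold growth
    split_ifs with hn
    · set K : ℝ≥0∞ := ENNReal.ofReal (Real.exp (θ * n))
      calc _ ≤ ∫⁻ ω, (weight θ (st b e).failed + {ω | l ω e ≠ (st b e).failed}.indicator
            (fun _ => weight θ (st b e).failed * K) ω) ∂ν := by
            refine lintegral_mono fun ω => ?_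
            by_cases hω : l ω e = (st b e).failed
            · rw [hω]
              exact le_self_add
            · rw [Set.indicator_of_mem (by exact hω)]
              refine le_trans ?_ le_add_self
              obtain ⟨w, hw, hlw⟩ := hl ω e
              rw [hlw, weight_append]
              simp only [K]
              gcongr
              exact hw.length_le.trans (hlen.trans hn)
        _ = weight θ (st b e).failed +
            weight θ (st b e).failed * K * ν {ω | l ω e ≠ (st b e).failed} := by
            rw [lintegral_add_left Measurable.of_discrete, lintegral_const, measure_univ, mul_one,
              lintegral_indicator_const MeasurableSet.of_discrete]
        _ ≤ weight θ (st b e).failed + weight θ (st b e).failed * K * ε := by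
            gcongr
            exact hν (by rwa [hb.sum_length_waiting]) e
        _ = _ := by ring
    · calc _ ≤ ∫⁻ _, weight θ (st b e).failed *
            ENNReal.ofReal (Real.exp (θ * mainArrivals a T f)) ∂ν := by
            refine lintegral_mono fun ω => ?_
            obtain ⟨w, hw, hlw⟩ := hl ω e
            simp only
            rw [hlw, weight_append]
            gcongr
            exact hw.length_le.trans hlen
        _ = _ := by
            rw [lintegral_const, measure_univ, mul_one, mul_comm]
  calc _ ≤ _ := hF (weight θ) e fun l _ => weight_tail_le hθ l
    _ ≤ ∫⁻ ω, (1 + ENNReal.ofReal (shrink m θ) * weight θ (l ω e)) ∂ν :=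
        lintegral_mono fun ω => weight_cleanUp_le h.one_le hθ _
    _ = 1 + ENNReal.ofReal (shrink m θ) * ∫⁻ ω, weight θ (l ω e) ∂ν := by
        rw [lintegral_add_left measurable_const, lintegral_const, measure_univ, mul_one,
          lintegral_const_mul _ Measurable.of_discrete]
    _ ≤ _ := by gcongr

theorem Suitable.lintegral_weight_le (h : Suitable m T φ δ n n' ε) (a : ℕ → Fin m → ℕ) {θ : ℝ}
    (hθ : 0 ≤ θ) (e : Fin m) (f : ℕ) :
    ∫⁻ b, weight θ (st b e).failed
        ∂pre (T := T) (φ := φ) (δ := δ) (n := n) (n' := n') a (f * T) ≤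
      potentialBound n ε m θ (mainArrivals a T) f := by
  induction f with
  | zero =>
    rw [zero_mul, pre, lintegral_dirac]
    simp [weight, st, initConfig, potentialBound]
  | succ f ih =>
    rw [h.lintegral_pre_frame a f fun b => weight θ (st b e).failed, potentialBound]
    calc _ ≤ ∫⁻ b, (1 + ENNReal.ofReal (shrink m θ) *
          (growth n ε θ (mainArrivals a T f) * weight θ (st b e).failed)) ∂pre a (f * T) := by
          refine lintegral_mono_ae ?_
          filter_upwards [h.ae_boundary a f] with b hb
          exact h.frameExpectation_weight_le hb hθ e
      _ ≤ _ := by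
          rw [lintegral_add_left measurable_const, lintegral_const, measure_univ, mul_one,
            lintegral_const_mul _ Measurable.of_discrete,
            lintegral_const_mul _ Measurable.of_discrete]
          gcongr

theorem natCast_length_le_weight {θ : ℝ} (hθ : 0 < θ) (l : List ℕ) :
    (l.length : ℝ≥0∞) ≤ ENNReal.ofReal θ⁻¹ * weight θ l := by
  rw [weight, ← ENNReal.ofReal_mul (by positivity), ← ENNReal.ofReal_natCast]
  refine ENNReal.ofReal_le_ofReal ?_
  rw [inv_mul_eq_div, le_div_iff₀ hθ]
  have := Real.add_one_le_exp (θ * l.length)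
  linarith

theorem Suitable.lintegral_length_failed_le (h : Suitable m T φ δ n n' ε) (a : ℕ → Fin m → ℕ)
    {θ : ℝ} (hθ : 0 < θ) (e : Fin m) (f : ℕ) :
    ∫⁻ b, ((st b e).failed.length : ℝ≥0∞)
        ∂pre (T := T) (φ := φ) (δ := δ) (n := n) (n' := n') a (f * T) ≤
      ENNReal.ofReal θ⁻¹ * potentialBound n ε m θ (mainArrivals a T) f := by
  calc _ ≤ ∫⁻ b, ENNReal.ofReal θ⁻¹ * weight θ (st b e).failed ∂pre a (f * T) :=
        lintegral_mono fun b => natCast_length_le_weight hθ _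
    _ ≤ _ := by
        rw [lintegral_const_mul _ Measurable.of_discrete]
        gcongr
        exact h.lintegral_weight_le a hθ.le e f

/-! #### The number of undelivered packets -/

theorem ae_injected (a : ℕ → Fin m → ℕ) (t : ℕ) :
    ∀ᵐ b ∂pre (T := T) (φ := φ) (δ := δ) (n := n) (n' := n') a t,
      ∀ e, (b e).injected = firstIndex a t e := by
  induction t with
  | zero =>
    rw [pre, ae_dirac_iff MeasurableSet.of_discrete]
    intro e
    simp [initConfig, firstIndex]
  | succ t ih =>
    rw [ae_iff, ← lintegral_indicator_one MeasurableSet.of_discrete, lintegral_pre_succ,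
      lintegral_congr_ae (g := 0)]
    · simp
    · filter_upwards [ih] with b hb
      rw [lintegral_congr_ae (g := 0)]
      · simp
      · filter_upwards [ae_drawMeasure t b] with c hc
        refine Set.indicator_of_notMem
          (fun hn : ¬ ∀ e, (c e).injected + a t e = firstIndex a (t + 1) e => hn fun e => ?_) _
        rw [(hc e).1, hb e, firstIndex, firstIndex, Finset.sum_range_succ]

theorem recordAll_pending_subset (t : ℕ) (a : Fin m → ℕ) (c : Config m T φ δ n n') (e : Fin m) :
    (recordAll t a c e).pending ⊆
      (c e).pending ∪ Finset.Ico (c e).injected ((c e).injected + a e) := by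
  change (frameProtocol m T φ δ n n').pendingAfter t a c e ⊆ _
  unfold pendingAfter
  refine Finset.union_subset_union ?_ subset_rfl
  split_ifs
  · exact Finset.sdiff_subset
  · exact subset_rfl

/-- The number of undelivered packets in a configuration. -/
def undelivered (c : Config m T φ δ n n') : ℕ := ∑ e, (c e).pending.card

/-- Inside a frame pending sets grow by injections only, so bounds at frame boundaries suffice. -/
theorem lintegral_undelivered_add_le (a : ℕ → Fin m → ℕ) (t i : ℕ) :
    ∫⁻ b, (undelivered b : ℝ≥0∞)
        ∂pre (T := T) (φ := φ) (δ := δ) (n := n) (n' := n') a (t + i) ≤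
      ∫⁻ b, (undelivered b : ℝ≥0∞)
        ∂pre (T := T) (φ := φ) (δ := δ) (n := n) (n' := n') a t + (∑ e, injectedIn a t i e : ℕ) := by
  induction i with
  | zero => simp
  | succ i ih =>
    rw [← add_assoc, lintegral_pre_succ]
    have hstep : ∀ c : Config m T φ δ n n', undelivered (recordAll (t + i) (a (t + i)) c) ≤
        undelivered c + ∑ e, a (t + i) e := by
      intro c
      rw [undelivered, undelivered, ← Finset.sum_add_distrib]
      refine Finset.sum_le_sum fun e _ => ?_
      refine (Finset.card_le_card (recordAll_pending_subset _ _ c e)).trans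
        ((Finset.card_union_le _ _).trans ?_)
      simp
    calc _ ≤ ∫⁻ b, ∫⁻ c, ((undelivered c : ℝ≥0∞) + (∑ e, a (t + i) e : ℕ)) ∂drawMeasure (t + i) b
          ∂pre (T := T) (φ := φ) (δ := δ) (n := n) (n' := n') a (t + i) :=
          lintegral_mono fun b => lintegral_mono fun c => by
            rw [← Nat.cast_add]
            exact Nat.cast_le.2 (hstep c)
      _ = ∫⁻ b, (undelivered b : ℝ≥0∞) ∂pre a (t + i) + (∑ e, a (t + i) e : ℕ) := by
          have : ∀ b : Config m T φ δ n n', ∫⁻ c, ((undelivered c : ℝ≥0∞) +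
              (∑ e, a (t + i) e : ℕ)) ∂drawMeasure (t + i) b =
              (undelivered b : ℝ≥0∞) + (∑ e, a (t + i) e : ℕ) := fun b =>
            lintegral_drawMeasure_pending (t + i) b
              fun Q => (((∑ e, (Q e).card : ℕ) : ℝ≥0∞) + (∑ e, a (t + i) e : ℕ))
          simp_rw [this]
          rw [lintegral_add_right _ measurable_const, lintegral_const, measure_univ, mul_one]
      _ ≤ _ := by
          refine (add_le_add_left ih _).trans (le_of_eq ?_)
          rw [add_assoc]
          congr 1
          rw [← Nat.cast_add, ← Finset.sum_add_distrib]
          congr 1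
          refine Finset.sum_congr rfl fun e _ => ?_
          exact (Finset.sum_range_succ _ _).symm

theorem Suitable.lintegral_undelivered_boundary_le (h : Suitable m T φ δ n n' ε)
    (a : ℕ → Fin m → ℕ) {θ : ℝ} (hθ : 0 < θ) (f : ℕ) :
    ∫⁻ b, (undelivered b : ℝ≥0∞)
        ∂pre (T := T) (φ := φ) (δ := δ) (n := n) (n' := n') a (f * T) ≤
      m * (ENNReal.ofReal θ⁻¹ * potentialBound n ε m θ (mainArrivals a T) f) +
        mainArrivals a T f := by
  calc _ ≤ ∫⁻ b, (∑ e, ((st b e).failed.length : ℝ≥0∞) + mainArrivals a T f) ∂pre a (f * T) := by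
        refine lintegral_mono_ae ?_
        filter_upwards [h.ae_boundary a f] with b hb
        rw [← hb.sum_length_waiting]
        have : undelivered b ≤ ∑ e, (st b e).failed.length + ∑ e, (st b e).waiting.length := by
          rw [undelivered, ← Finset.sum_add_distrib]
          refine Finset.sum_le_sum fun e _ => ?_
          have hsub : (b e).pending ⊆ (st b e).failed.toFinset ∪ (st b e).waiting.toFinset := by
            intro j hj
            simpa using (hb.mem_pending e j).1 hj
          exact (Finset.card_le_card hsub).trans ((Finset.card_union_le _ _).trans
            (add_le_add (List.toFinset_card_le _) (List.toFinset_card_le _)))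
        exact_mod_cast this
    _ ≤ _ := by
        rw [lintegral_add_right _ measurable_const, lintegral_const, measure_univ, mul_one,
          lintegral_finsetSum _ fun _ _ => Measurable.of_discrete]
        gcongr
        refine (Finset.sum_le_card_nsmul _ _ _ fun e _ =>
          h.lintegral_length_failed_le a hθ e f).trans (le_of_eq ?_)
        rw [Finset.card_univ, Fintype.card_fin, nsmul_eq_mul]

/-- The expected number of undelivered packets. -/
theorem Suitable.lintegral_queueLength_le (h : Suitable m T φ δ n n' ε) (a : ℕ → Fin m → ℕ)
    {θ : ℝ} (hθ : 0 < θ) (t : ℕ) :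
    ∫⁻ τ, (queueLength τ t : ℝ≥0∞) ∂(frameProtocol m T φ δ n n').law a ≤
      m * (ENNReal.ofReal θ⁻¹ * potentialBound n ε m θ (mainArrivals a T) (t / T)) +
        mainArrivals a T (t / T) + frameArrivals a T (t / T) := by
  have h1 := lintegral_law_pending (T := T) (φ := φ) (δ := δ) (n := n) (n' := n') a t
    fun Q => ((∑ e, (Q e).card : ℕ) : ℝ≥0∞)
  refine h1.trans_le ?_
  have h2 := lintegral_undelivered_add_le (T := T) (φ := φ) (δ := δ) (n := n) (n' := n') a
    (t / T * T) (t % T)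
  rw [Nat.div_add_mod'] at h2
  refine h2.trans (add_le_add (h.lintegral_undelivered_boundary_le a hθ _) ?_)
  have h3 : ∑ e, injectedIn a (t / T * T) (t % T) e ≤ frameArrivals a T (t / T) :=
    Finset.sum_le_sum fun e _ => Finset.sum_le_sum_of_subset
      (Finset.range_subset_range.2 (Nat.mod_lt _ h.pos).le)
  exact_mod_cast h3

end FrameProtocol

/-! ### Latencies for a fixed injection sequence -/

namespace FrameProtocol

open StaticMAC SymmetricProtocol

variable {m T : ℕ} {φ δ : ℝ} {n n' : ℕ} {ε : ℝ≥0∞}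

/-- The expected number of clean-up phases until packet `j` is removed from the list, up to
constants. -/
noncomputable def rank (m j : ℕ) (l : List ℕ) : ℝ≥0∞ :=
  if j ∈ l then ((l.idxOf j + 1 : ℕ) : ℝ≥0∞) * (2 * m) else 0

theorem rank_of_notMem {j : ℕ} {l : List ℕ} (h : j ∉ l) : rank m j l = 0 := if_neg h

/-- Removing the head moves `j` up by one place; if `j` is the head, it leaves and its rank falls
from `2m` to `0`. -/
theorem rank_eq_rank_tail_add {j : ℕ} {l : List ℕ} (hl : l.Nodup) (h : j ∈ l) :
    rank m j l = rank m j l.tail + 2 * m := by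
  rcases l with _ | ⟨i, r⟩
  · simp at h
  · rw [List.nodup_cons] at hl
    by_cases hij : i = j
    · subst hij
      rw [List.tail_cons, rank_of_notMem hl.1, rank, if_pos h, List.idxOf_cons_self]
      simp
    · have hr : j ∈ r := (List.mem_cons.1 h).resolve_left fun h => hij h.symm
      rw [List.tail_cons, rank, rank, if_pos h, if_pos hr, List.idxOf_cons_ne _ hij]
      push_cast
      ring

theorem rank_tail_le {j : ℕ} {l : List ℕ} (hl : l.Nodup) : rank m j l.tail ≤ rank m j l := by
  by_cases h : j ∈ l
  · rw [rank_eq_rank_tail_add hl h]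
    exact le_self_add
  · rw [rank_of_notMem fun h' => h (List.mem_of_mem_tail h')]
    exact bot_le

/-- Later failures queue up behind `j` and do not delay it. -/
theorem rank_append {j : ℕ} {l w : List ℕ} (h : j ∉ w) : rank m j (l ++ w) = rank m j l := by
  by_cases hl : j ∈ l
  · rw [rank, rank, if_pos hl, if_pos (List.mem_append_left _ hl), List.idxOf_append_of_mem hl]
  · rw [rank_of_notMem hl, rank_of_notMem (by simp [hl, h])]

theorem rank_le (j : ℕ) (l : List ℕ) : rank m j l ≤ 2 * m * l.length := by
  unfold rank
  split_ifs with h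
  · rw [mul_comm]
    gcongr
    exact List.idxOf_lt_length_iff.2 h
  · exact bot_le

/-- A loss of `2m` with probability `1/(2m)` is an expected loss of 1. -/
theorem rank_cleanUp_le (hm : 1 ≤ m) {j : ℕ} {l : List ℕ} (hl : l.Nodup) :
    (2 * (m : ℝ≥0∞))⁻¹ * rank m j l.tail + (1 - (2 * (m : ℝ≥0∞))⁻¹) * rank m j l +
      (if j ∈ l then 1 else 0) ≤ rank m j l := by
  by_cases h : j ∈ l
  · have hm0 : (2 * (m : ℝ≥0∞)) ≠ 0 := by
      have : (m : ℝ≥0∞) ≠ 0 := by exact_mod_cast (by omega : m ≠ 0)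
      simp [this]
    have hm1 : (2 * (m : ℝ≥0∞)) ≠ ⊤ := ENNReal.mul_ne_top (by simp) (by simp)
    rw [if_pos h, ← ENNReal.inv_mul_cancel hm0 hm1]
    refine le_of_eq ?_
    calc _ = (2 * (m : ℝ≥0∞))⁻¹ * (rank m j l.tail + 2 * m) +
          ((2 * (m : ℝ≥0∞))⁻¹ * (2 * m) - (2 * (m : ℝ≥0∞))⁻¹) * rank m j l := by ring
      _ = rank m j l := by
        rw [← rank_eq_rank_tail_add hl h, ← add_mul, ENNReal.inv_mul_cancel hm0 hm1,
          add_tsub_cancel_of_le (inv_two_mul_le_one hm), one_mul]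
  · rw [if_neg h, rank_of_notMem h, rank_of_notMem fun h' => h (List.mem_of_mem_tail h')]
    simp

theorem Boundary.notMem_waiting {a : ℕ → Fin m → ℕ} {f : ℕ} {b : Config m T φ δ n n'}
    (h : Boundary a f b) {e : Fin m} {j : ℕ} (hj : j < firstIndex a ((f - 1) * T) e) :
    j ∉ (st b e).waiting := by
  rw [h.waiting e, List.mem_range'_1]
  omega

/-- By `hj` the main phase for `j` is over: `j` is pending only if it is in the failed queue, and
the current main phase merely appends other packets. So the rank is a supermartingale that pays 1
per frame while `j` is pending. -/
theorem Suitable.frameExpectation_rank_add_le (h : Suitable m T φ δ n n' ε) {a : ℕ → Fin m → ℕ}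
    {f : ℕ} {b : Config m T φ δ n n'} (hb : Boundary a f b) {e : Fin m} {j : ℕ}
    (hj : j < firstIndex a ((f - 1) * T) e) :
    frameExpectation a (f * T) b (fun c => rank m j (st c e).failed) +
      (if j ∈ (b e).pending then 1 else 0) ≤ rank m j (st b e).failed := by
  obtain ⟨Ω, _, ν, _, _, l, hl, -, -, hF⟩ := h.exists_frameExpectation_le hb
  have hw := hb.notMem_waiting hj
  have hpen : j ∈ (b e).pending ↔ j ∈ (st b e).failed := by
    rw [hb.mem_pending]
    exact or_iff_left hw
  have hl' : ∀ ω, (l ω e).Nodup ∧ rank m j (l ω e) = rank m j (st b e).failed ∧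
      (j ∈ l ω e ↔ j ∈ (b e).pending) := by
    intro ω
    obtain ⟨w, hsub, hlw⟩ := hl ω e
    have hjw : j ∉ w := fun h' => hw (hsub.subset h')
    refine ⟨?_, ?_, ?_⟩
    · rw [hlw, List.nodup_append]
      refine ⟨hb.failed_nodup e, hsub.nodup ?_, ?_⟩
      · rw [hb.waiting e]
        exact List.nodup_range'
      · rintro x hx y hy rfl
        exact hb.notMem_waiting (hb.failed_lt e x hx) (hsub.subset hy)
    · rw [hlw, rank_append hjw]
    · rw [hlw, hpen, List.mem_append]
      exact or_iff_left hjw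
  calc _ ≤ ∫⁻ ω, ((2 * (m : ℝ≥0∞))⁻¹ * rank m j (l ω e).tail +
          (1 - (2 * (m : ℝ≥0∞))⁻¹) * rank m j (l ω e)) ∂ν + (if j ∈ (b e).pending then 1 else 0) := by
        gcongr
        exact hF (rank m j) e fun _ => rank_tail_le
    _ = ∫⁻ ω, ((2 * (m : ℝ≥0∞))⁻¹ * rank m j (l ω e).tail +
          (1 - (2 * (m : ℝ≥0∞))⁻¹) * rank m j (l ω e) + (if j ∈ l ω e then 1 else 0)) ∂ν := by
        simp_rw [(hl' _).2.2]
        rw [lintegral_add_right _ measurable_const, lintegral_const, measure_univ, mul_one]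
    _ ≤ ∫⁻ _, rank m j (st b e).failed ∂ν := by
        refine lintegral_mono fun ω => ?_
        simp only
        rw [← (hl' ω).2.1]
        exact rank_cleanUp_le h.one_le (hl' ω).1
    _ = _ := by rw [lintegral_const, measure_univ, mul_one]

theorem Suitable.frameExpectation_length_le (h : Suitable m T φ δ n n' ε) {a : ℕ → Fin m → ℕ}
    {f : ℕ} {b : Config m T φ δ n n'} (hb : Boundary a f b) (e : Fin m) :
    frameExpectation a (f * T) b (fun c => ((st c e).failed.length : ℝ≥0∞)) ≤
      (st b e).failed.length + mainArrivals a T f := by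
  obtain ⟨Ω, _, ν, _, _, l, hl, -, -, hF⟩ := h.exists_frameExpectation_le hb
  refine (hF (fun l => (l.length : ℝ≥0∞)) e fun l _ => by simp).trans ?_
  calc _ ≤ ∫⁻ _, ((st b e).failed.length + mainArrivals a T f : ℝ≥0∞) ∂ν := by
        refine lintegral_mono fun ω => ?_
        have h1 : (((l ω e).tail.length : ℕ) : ℝ≥0∞) ≤ (l ω e).length := by simp
        calc _ ≤ (2 * (m : ℝ≥0∞))⁻¹ * (l ω e).length +
              (1 - (2 * (m : ℝ≥0∞))⁻¹) * (l ω e).length := by gcongr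
          _ = (l ω e).length := by
              rw [← add_mul, add_tsub_cancel_of_le (inv_two_mul_le_one h.one_le), one_mul]
          _ ≤ _ := by
              obtain ⟨w, hw, hlw⟩ := hl ω e
              rw [hlw, List.length_append, ← hb.sum_length_waiting]
              have h2 : (st b e).waiting.length ≤ ∑ e, (st b e).waiting.length :=
                Finset.single_le_sum (f := fun e => (st b e).waiting.length)
                  (fun _ _ => Nat.zero_le _) (Finset.mem_univ e)
              exact_mod_cast Nat.add_le_add_left (hw.length_le.trans h2) _
    _ = _ := by rw [lintegral_const, measure_univ, mul_one]

/-- The probability that packet `j` of station `e` is pending before slot `t`. -/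
noncomputable def pendingProb (m T : ℕ) (φ δ : ℝ) (n n' : ℕ) (a : ℕ → Fin m → ℕ) (e : Fin m)
    (j t : ℕ) : ℝ≥0∞ :=
  ∫⁻ b, (if j ∈ (b e).pending then 1 else 0)
    ∂pre (T := T) (φ := φ) (δ := δ) (n := n) (n' := n') a t

theorem pendingProb_le_one (a : ℕ → Fin m → ℕ) (e : Fin m) (j t : ℕ) :
    pendingProb m T φ δ n n' a e j t ≤ 1 := by
  calc _ ≤ ∫⁻ _, (1 : ℝ≥0∞) ∂pre (T := T) (φ := φ) (δ := δ) (n := n) (n' := n') a t :=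
        lintegral_mono fun b => by split_ifs <;> simp
    _ = 1 := by simp

/-- By `hj` the packet has been injected before slot `t`; from then on it can leave the pending set
but not enter it. -/
theorem pendingProb_le {a : ℕ → Fin m → ℕ} {e : Fin m} {j t t' : ℕ} (htt' : t ≤ t')
    (hj : j < firstIndex a t e) :
    pendingProb m T φ δ n n' a e j t' ≤ pendingProb m T φ δ n n' a e j t := by
  induction t', htt' using Nat.le_induction with
  | base => exact le_rfl
  | succ t' htt' ih =>
    refine le_trans ?_ ih
    unfold pendingProb
    rw [lintegral_pre_succ]
    refine lintegral_mono_ae ?_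
    filter_upwards [ae_injected (T := T) (φ := φ) (δ := δ) (n := n) (n' := n') a t'] with b hb
    calc _ ≤ ∫⁻ _, (if j ∈ (b e).pending then 1 else 0 : ℝ≥0∞) ∂drawMeasure t' b := by
          refine lintegral_mono_ae ?_
          filter_upwards [ae_drawMeasure t' b] with c hc
          have h1 : j ∈ (recordAll t' (a t') c e).pending → j ∈ (b e).pending := by
            intro h1
            have h2 := recordAll_pending_subset _ _ _ _ h1
            rw [(hc e).1, (hc e).2, hb e, Finset.mem_union, Finset.mem_Ico] at h2
            exact h2.resolve_right fun h3 =>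
              absurd (hj.trans_le (firstIndex_mono a e htt')) (not_lt.2 h3.1)
          split_ifs with h2 h3 h3
          · exact le_rfl
          · exact absurd (h1 h2) h3
          · simp
          · exact le_rfl
      _ = _ := by rw [lintegral_const, measure_univ, mul_one]

/-- The supermartingale inequality telescopes from boundary `f + 2`, the first one at which `j` can
no longer be waiting. The queue length there is traced back to boundary `f + 1`, because the
potential bound for that time does not involve the arrivals of frame `f`; conditioning on the
injection of `j` needs this. -/
theorem Suitable.tsum_pendingProb_le (h : Suitable m T φ δ n n' ε) {a : ℕ → Fin m → ℕ} {θ : ℝ}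
    (hθ : 0 < θ) {e : Fin m} {j f : ℕ} (hj : j < firstIndex a ((f + 1) * T) e) :
    ∑' i, pendingProb m T φ δ n n' a e j ((f + 2 + i) * T) ≤
      2 * m * (ENNReal.ofReal θ⁻¹ * potentialBound n ε m θ (mainArrivals a T) (f + 1) +
        frameArrivals a T f) := by
  set H : ℕ → ℝ≥0∞ := fun i => ∫⁻ b, rank m j (st b e).failed
    ∂pre (T := T) (φ := φ) (δ := δ) (n := n) (n' := n') a ((f + 2 + i) * T)
  have hstep : ∀ i, H (i + 1) + pendingProb m T φ δ n n' a e j ((f + 2 + i) * T) ≤ H i := by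
    intro i
    simp only [H, pendingProb]
    rw [← add_assoc, h.lintegral_pre_frame a _ fun b => rank m j (st b e).failed,
      ← lintegral_add_left Measurable.of_discrete]
    refine lintegral_mono_ae ?_
    filter_upwards [h.ae_boundary a (f + 2 + i)] with b hb
    refine h.frameExpectation_rank_add_le hb (hj.trans_le (firstIndex_mono a e ?_))
    exact Nat.mul_le_mul_right _ (by omega)
  have hsum : ∀ N, ∑ i ∈ Finset.range N, pendingProb m T φ δ n n' a e j ((f + 2 + i) * T) + H N ≤
      H 0 := by
    intro N
    induction N with
    | zero => simp
    | succ N ih =>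
      rw [Finset.sum_range_succ]
      refine le_trans ?_ ih
      rw [add_assoc, add_comm (pendingProb _ _ _ _ _ _ _ _ _ _)]
      gcongr
      exact hstep N
  refine (ENNReal.tsum_le_of_sum_range_le fun N => le_self_add.trans (hsum N)).trans ?_
  calc H 0 ≤ ∫⁻ b, 2 * m * ((st b e).failed.length : ℝ≥0∞) ∂pre a ((f + 2) * T) :=
        lintegral_mono fun b => rank_le _ _
    _ = 2 * m * ∫⁻ b, frameExpectation a ((f + 1) * T) b
          (fun c => ((st c e).failed.length : ℝ≥0∞)) ∂pre a ((f + 1) * T) := by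
        rw [lintegral_const_mul _ Measurable.of_discrete,
          h.lintegral_pre_frame a (f + 1) fun b => ((st b e).failed.length : ℝ≥0∞)]
    _ ≤ 2 * m * ∫⁻ b, ((st b e).failed.length + frameArrivals a T f) ∂pre a ((f + 1) * T) := by
        gcongr 2 * m * ?_
        refine lintegral_mono_ae ?_
        filter_upwards [h.ae_boundary a (f + 1)] with b hb
        exact h.frameExpectation_length_le hb e
    _ ≤ _ := by
        rw [lintegral_add_right _ measurable_const, lintegral_const, measure_univ, mul_one]
        gcongr
        exact h.lintegral_length_failed_le a hθ e (f + 1)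

theorem tsum_comp_div (hT : 0 < T) (B : ℕ → ℝ≥0∞) : ∑' k, B (k / T) = T * ∑' i, B i := by
  have : NeZero T := ⟨hT.ne'⟩
  calc ∑' k, B (k / T) = ∑' p : ℕ × Fin T, B p.1 :=
        (Nat.divModEquiv T).tsum_eq fun p : ℕ × Fin T => B p.1
    _ = ∑' i, ∑' _ : Fin T, B i := ENNReal.tsum_prod' (f := fun p : ℕ × Fin T => B p.1)
    _ = _ := by
        rw [← ENNReal.tsum_mul_left]
        refine tsum_congr fun i => ?_
        rw [tsum_fintype, Finset.sum_const, Finset.card_univ, Fintype.card_fin, nsmul_eq_mul]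

/-- The expected latency of a packet. -/
theorem Suitable.lintegral_latency_le (h : Suitable m T φ δ n n' ε) {a : ℕ → Fin m → ℕ} {θ : ℝ}
    (hθ : 0 < θ) {e : Fin m} {j t : ℕ} (hj : j < firstIndex a (t + 1) e) :
    ∫⁻ τ, latency τ e j t ∂(frameProtocol m T φ δ n n').law a ≤
      T * (2 + 2 * m * (ENNReal.ofReal θ⁻¹ *
        potentialBound n ε m θ (mainArrivals a T) (t / T + 1) + frameArrivals a T (t / T))) := by
  set f := t / T with hf
  have hT := h.pos
  have htf : t < (f + 1) * T := by
    rw [mul_comm]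
    exact Nat.lt_mul_div_succ t hT
  have hft : f * T ≤ t := Nat.div_mul_le_self t T
  have hj' : ∀ g, f + 1 ≤ g → j < firstIndex a (g * T) e := fun g hg =>
    hj.trans_le (firstIndex_mono a e (htf.trans_le (Nat.mul_le_mul_right T hg)))
  -- The injection frame and the main-phase frame are charged fully; in a later frame every slot is
  -- charged the pending probability at the beginning of that frame.
  set B : ℕ → ℝ≥0∞ := fun i =>
    if i < 2 then 1 else pendingProb m T φ δ n n' a e j ((f + i) * T)
  refine (SymmetricProtocol.lintegral_latency_le a e j t).trans ?_
  calc _ = ∑' d, pendingProb m T φ δ n n' a e j (t + d + 1) := tsum_congr fun d =>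
        lintegral_law_pending a (t + d + 1) fun Q => if j ∈ Q e then 1 else 0
    _ ≤ ∑' d, B ((t + d + 1 - f * T) / T) := by
        refine ENNReal.tsum_le_tsum fun d => ?_
        simp only [B]
        split_ifs with hlt
        · exact pendingProb_le_one _ _ _ _
        · set i := (t + d + 1 - f * T) / T with hi
          refine pendingProb_le ?_ (hj' _ (by omega))
          have := Nat.div_mul_le_self (t + d + 1 - f * T) T
          rw [← hi] at this
          rw [add_mul]
          omega
    _ ≤ ∑' k, B (k / T) := ENNReal.tsum_comp_le_tsum_of_injective
        (f := fun d => t + d + 1 - f * T) (fun x y hxy => by simp only at hxy; omega)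
        fun k => B (k / T)
    _ = T * (2 + ∑' i, pendingProb m T φ δ n n' a e j ((f + 2 + i) * T)) := by
        rw [tsum_comp_div hT, tsum_eq_zero_add' ENNReal.summable,
          tsum_eq_zero_add' ENNReal.summable, ← add_assoc]
        congr 2
        · simp only [B]
          norm_num
        · refine tsum_congr fun i => ?_
          simp only [B]
          rw [if_neg (by omega)]
          congr 2
          omega
    _ ≤ _ := by
        gcongr
        exact h.tsum_pendingProb_le hθ (hj' _ le_rfl)

end FrameProtocol

/-! ### The choice of the parameters and stability against adversaries -/

namespace FrameProtocol

open StaticMAC SymmetricProtocol Filter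

variable {m T : ℕ} {φ δ : ℝ} {n n' : ℕ} {ε : ℝ≥0∞}

theorem length_pos (hδ : 0 < δ) (hφ : 1 ≤ φ) (hn : 2 ≤ n) : 0 < StaticMAC.length φ δ n := by
  have h1 : 0 < Real.log n := Real.log_pos (by exact_mod_cast hn)
  have h2 := one_lt_s hδ hφ hn
  refine Nat.add_pos_right _ (Nat.ceil_pos.2 ?_)
  positivity

theorem suitable_of_le (hm : 1 ≤ m) (hδ : 0 < δ) (hφ : 1 ≤ φ) (hn : 2 ≤ n) (hn' : 2 ≤ n')
    (hlen : StaticMAC.length φ δ n + StaticMAC.length φ δ n' ≤ T)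
    (hmain : ∀ (ι : Type) [Fintype ι] [DecidableEq ι] (A : Finset ι), A.card ≤ n →
      (Measure.pi fun _ : ι => (pattern φ δ n).toMeasure)
        {S | remFrom A S 0 (StaticMAC.length φ δ n) ≠ ∅} ≤ ε)
    (hcleanUp : ∀ A : Finset (Fin m), (Measure.pi fun _ : Fin m => (pattern φ δ n').toMeasure)
      {S | remFrom A S 0 (StaticMAC.length φ δ n') ≠ ∅} ≤ 1 / 2) :
    Suitable m T φ δ n n' ε where
  one_le := hm
  length_pos := length_pos hδ hφ hn
  length_lt := by
    have := length_pos hδ hφ hn'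
    omega
  length_add_le := hlen
  main := hmain
  cleanUp := hcleanUp

/-- The leading term is `αcT` with `αc < 1`. One half of the gap `(1 - αc)T` pays for the squared
logarithm, the other for `L` and the rounding in `n`. -/
theorem eventually_length_add_le (hδ : 0 < δ) (hφ : 1 ≤ φ) {c : ℝ} (hc : 0 < c)
    (hcδ : Real.exp 1 * (1 + δ) * c < 1) (L : ℕ) :
    ∀ᶠ T : ℕ in atTop, StaticMAC.length φ δ ⌈c * T⌉₊ + L ≤ T := by
  obtain ⟨C, hC, hlen⟩ := exists_length_le hδ
  set α := (1 + δ) * Real.exp 1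
  have hgap : 0 < 1 - α * c := by
    simp only [α]
    linarith
  have hlim : Tendsto (fun T : ℕ => ⌈c * (T : ℝ)⌉₊) atTop atTop :=
    tendsto_nat_ceil_atTop.comp (tendsto_natCast_atTop_atTop.const_mul_atTop hc)
  -- Chosen so that `(Cφ² + 1) η 2cT` is half of the gap; the `+ 1` keeps the denominator positive
  -- even if `C = 0`.
  set η := (1 - α * c) / (4 * (C * φ ^ 2 + 1) * c) with hη
  have hη0 : 0 < η := by positivity
  have hlog := (hlim.eventually (tendsto_natCast_atTop_atTop.eventually
    ((Real.isLittleO_pow_log_id_atTop (n := 2)).bound hη0)))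
  filter_upwards [hlog, hlim.eventually_ge_atTop 2, tendsto_natCast_atTop_atTop.eventually_ge_atTop
    ((L + α) * (2 / (1 - α * c))), tendsto_natCast_atTop_atTop.eventually_ge_atTop (1 / c)]
    with T h1 h2 h3 h4
  set n := ⌈c * (T : ℝ)⌉₊
  have hn1 : (n : ℝ) ≤ c * T + 1 := (Nat.ceil_lt_add_one (by positivity)).le
  have hcT : 1 ≤ c * T := by
    rw [div_le_iff₀ hc] at h4
    linarith
  have h5 := hlen φ hφ n h2
  rw [Real.norm_of_nonneg (by positivity), id, Real.norm_of_nonneg (by positivity)] at h1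
  have h6 : C * (φ ^ 2 * Real.log n ^ 2) ≤ (1 - α * c) / 2 * T := by
    calc C * (φ ^ 2 * Real.log n ^ 2) ≤ (C * φ ^ 2 + 1) * Real.log n ^ 2 := by
          nlinarith [sq_nonneg (Real.log n)]
      _ ≤ (C * φ ^ 2 + 1) * (η * (2 * (c * T))) := by
          gcongr
          exact h1.trans (by gcongr; linarith)
      _ = _ := by
          rw [hη]
          field_simp
          ring
  have h7 : L + α ≤ (1 - α * c) / 2 * T := by
    have : L + α = (1 - α * c) / 2 * ((L + α) * (2 / (1 - α * c))) := by
      field_simp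
    rw [this]
    gcongr
  have h8 : α * n ≤ α * (c * T + 1) := by
    have : 0 < α := by positivity
    gcongr
  have : ((StaticMAC.length φ δ n + L : ℕ) : ℝ) ≤ T := by
    push_cast
    linarith
  exact_mod_cast this

/-- The parameters of the dynamic protocol. -/
theorem exists_eventually_suitable (hm : 1 ≤ m) {lam : ℝ} (h0 : 0 ≤ lam)
    (h1 : lam < 1 / Real.exp 1) :
    ∃ (c δ : ℝ) (n' : ℕ), lam < c ∧ c < 1 ∧ 0 < δ ∧ 2 ≤ n' ∧
      ∀ᶠ T : ℕ in atTop, 2 ≤ ⌈c * T⌉₊ ∧ 48 * m ≤ ⌈c * T⌉₊ ∧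
        StaticMAC.length 2 δ ⌈c * T⌉₊ + StaticMAC.length 2 δ n' ≤ T ∧
        Suitable m T 2 δ ⌈c * T⌉₊ n' (ENNReal.ofReal ((⌈c * T⌉₊ : ℝ) ^ 2)⁻¹) := by
  have he : 2 < Real.exp 1 := lt_trans (by norm_num) Real.exp_one_gt_d9
  have hrpow : ∀ n : ℕ, (n : ℝ) ^ (-2 : ℝ) = ((n : ℝ) ^ 2)⁻¹ := fun n => by
    rw [Real.rpow_neg (by positivity), Real.rpow_two]
  obtain ⟨c, hc1, hc2⟩ := exists_between h1
  have hc0 : 0 < c := h0.trans_lt hc1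
  have hc3 : c < 1 := hc2.trans (by
    rw [div_lt_one (by positivity)]
    linarith)
  have hec : Real.exp 1 * c < 1 := by
    rwa [lt_div_iff₀ (by positivity), mul_comm] at hc2
  -- `u` is the future `1 + δ`, strictly between `1` and `1/(ec)`.
  obtain ⟨u, hu1, hu2⟩ := exists_between ((one_lt_div (by positivity)).2 hec)
  have hδ : 0 < u - 1 := by linarith
  obtain ⟨n₀, hn₀, hmain⟩ := exists_forall_measure_pattern_le hδ one_le_two
  have hcu : Real.exp 1 * (1 + (u - 1)) * c < 1 := by
    rw [lt_div_iff₀ (by positivity)] at hu2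
    linarith
  -- A clean-up phase involves at most `m ≤ n'` packets, and it fails with probability at most
  -- `n'^(-2) ≤ 1/2`. This `n'` does not depend on `T`, so the clean-up length is negligible.
  refine ⟨c, u - 1, max n₀ m, hc1, hc3, hδ, hn₀.trans (le_max_left _ _), ?_⟩
  have hlim : Tendsto (fun T : ℕ => ⌈c * (T : ℝ)⌉₊) atTop atTop :=
    tendsto_nat_ceil_atTop.comp (tendsto_natCast_atTop_atTop.const_mul_atTop hc0)
  filter_upwards [eventually_length_add_le hδ one_le_two hc0 hcu (StaticMAC.length 2 (u - 1)
    (max n₀ m)), hlim.eventually_ge_atTop n₀, hlim.eventually_ge_atTop (48 * m)] with T h2 h3 h4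
  refine ⟨hn₀.trans h3, h4, h2, suitable_of_le hm hδ one_le_two (hn₀.trans h3)
    (hn₀.trans (le_max_left _ _)) h2 ?_ ?_⟩
  · rw [← hrpow]
    exact hmain _ h3
  · intro A
    refine (hmain _ (le_max_left _ _) (Fin m) A ?_).trans ?_
    · exact (Finset.card_le_univ A).trans (by simp)
    · rw [hrpow, ← ENNReal.ofReal_one, ← ENNReal.ofReal_ofNat 2,
        ← ENNReal.ofReal_div_of_pos (by norm_num)]
      refine ENNReal.ofReal_le_ofReal ?_
      have : (2 : ℝ) ≤ (max n₀ m : ℕ) := by exact_mod_cast hn₀.trans (le_max_left _ _)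
      rw [one_div]
      gcongr
      nlinarith

/-- The potential stays bounded if it grows by a factor close to `1` in the main phases. -/
theorem one_add_shrink_mul_le (hm : 1 ≤ m) (hn : 1 ≤ n) {g x : ℝ≥0∞}
    (hg : g ≤ ENNReal.ofReal (1 + 1 / (8 * m * n))) (hx : x ≤ ENNReal.ofReal (8 * m * n)) :
    1 + ENNReal.ofReal (shrink m (n : ℝ)⁻¹) * (g * x) ≤ ENNReal.ofReal (8 * m * n) := by
  have hm1 : (1 : ℝ) ≤ m := by exact_mod_cast hm
  have hn1 : (1 : ℝ) ≤ n := by exact_mod_cast hn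
  set K : ℝ := 8 * m * n with hK
  have hK8 : 8 ≤ K := by nlinarith
  -- `1 - exp(-1/n) ≥ 1/(2n)`, and `1/(4mn) = 2/K`. The choice of `K` then works because `1 + (1 -
  -- 2/K)(1 + 1/K)K = K - 2/K`.
  have hs : shrink m (n : ℝ)⁻¹ ≤ 1 - 2 / K := by
    have h1 : (n : ℝ)⁻¹ ≤ 1 := inv_le_one_of_one_le₀ hn1
    have h2 : 0 < (n : ℝ)⁻¹ := by positivity
    have h3 : Real.exp (-(n : ℝ)⁻¹) ≤ 1 - (n : ℝ)⁻¹ / 2 := by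
      have h4 := Real.add_one_le_exp (n : ℝ)⁻¹
      rw [Real.exp_neg, inv_le_iff_one_le_mul₀ (Real.exp_pos _)]
      nlinarith
    have h8 : 2 / K = ((n : ℝ)⁻¹ / 2) / (2 * m) := by
      rw [hK]
      field_simp
      norm_num
    rw [shrink, h8]
    gcongr
    linarith
  calc _ ≤ ENNReal.ofReal 1 + ENNReal.ofReal (1 - 2 / K) *
        (ENNReal.ofReal (1 + 1 / K) * ENNReal.ofReal K) := by
        rw [ENNReal.ofReal_one]
        gcongr
    _ = ENNReal.ofReal (1 + (1 - 2 / K) * ((1 + 1 / K) * K)) := by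
        have h1 : 0 ≤ 1 - 2 / K := by
          rw [sub_nonneg, div_le_one (by linarith)]
          linarith
        rw [← ENNReal.ofReal_mul (by positivity), ← ENNReal.ofReal_mul h1, ENNReal.ofReal_add
          (by norm_num) (by positivity)]
    _ ≤ _ := by
        refine ENNReal.ofReal_le_ofReal ?_
        have h1 : 1 + (1 - 2 / K) * ((1 + 1 / K) * K) = K - 2 / K := by
          field_simp
          ring
        rw [h1]
        have : 0 < 2 / K := by positivity
        linarith

theorem one_le_ofReal_mul (hm : 1 ≤ m) (hn : 1 ≤ n) : 1 ≤ ENNReal.ofReal (8 * m * n) := by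
  have hm1 : (1 : ℝ) ≤ m := by exact_mod_cast hm
  have hn1 : (1 : ℝ) ≤ n := by exact_mod_cast hn
  rw [← ENNReal.ofReal_one]
  exact ENNReal.ofReal_le_ofReal (by nlinarith)

/-- The growth factor of the potential is `1` plus the following quantity if not too many packets
arrive. -/
theorem one_add_mul_exp_le (hm : 1 ≤ m) (hn : 48 * m ≤ n) :
    1 + ENNReal.ofReal ((n : ℝ) ^ 2)⁻¹ * ENNReal.ofReal (Real.exp ((n : ℝ)⁻¹ * n)) ≤
      ENNReal.ofReal (1 + 1 / (16 * m * n)) := by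
  have hm1 : (1 : ℝ) ≤ m := by exact_mod_cast hm
  have hn1 : (48 * m : ℝ) ≤ n := by exact_mod_cast hn
  have hn0 : (0 : ℝ) < n := by linarith
  rw [← ENNReal.ofReal_mul (by positivity), ← ENNReal.ofReal_one, ← ENNReal.ofReal_add (by norm_num)
    (by positivity), inv_mul_cancel₀ hn0.ne']
  refine ENNReal.ofReal_le_ofReal ?_
  -- The excess is `e/n² ≤ 3/n²`, at most `1/(16mn)` as `n ≥ 48m`. Half of the permitted `1/(8mn)`
  -- stays free for the overloaded frames of the stochastic model.
  have he : Real.exp 1 ≤ 3 := Real.exp_one_lt_d9.le.trans (by norm_num)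
  gcongr
  rw [inv_mul_eq_div, div_le_div_iff₀ (by positivity) (by positivity)]
  nlinarith [Real.exp_pos 1, mul_le_mul_of_nonneg_right he (by positivity : (0 : ℝ) ≤ 16 * m * n)]

theorem growth_le_of_le (hm : 1 ≤ m) (hn : 48 * m ≤ n) {M : ℕ} (hM : M ≤ n) :
    growth n (ENNReal.ofReal ((n : ℝ) ^ 2)⁻¹) (n : ℝ)⁻¹ M ≤
      ENNReal.ofReal (1 + 1 / (8 * m * n)) := by
  have hm1 : (1 : ℝ) ≤ m := by exact_mod_cast hm
  have hn1 : (48 * m : ℝ) ≤ n := by exact_mod_cast hn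
  have hn0 : (0 : ℝ) < n := by linarith
  rw [growth, if_pos hM]
  refine (one_add_mul_exp_le hm hn).trans (ENNReal.ofReal_le_ofReal ?_)
  gcongr
  norm_num

theorem potentialBound_le_of_le (hm : 1 ≤ m) (hn : 48 * m ≤ n) {M : ℕ → ℕ} (hM : ∀ f, M f ≤ n)
    (f : ℕ) :
    potentialBound n (ENNReal.ofReal ((n : ℝ) ^ 2)⁻¹) m (n : ℝ)⁻¹ M f ≤
      ENNReal.ofReal (8 * m * n) := by
  induction f with
  | zero => exact one_le_ofReal_mul hm (by omega)
  | succ f ih => exact one_add_shrink_mul_le hm (by omega) (growth_le_of_le hm hn (hM f)) ih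

/-! ### Arrivals per frame under a bounded adversary -/

theorem frameArrivals_eq_sum (a : ℕ → Fin m → ℕ) (T f : ℕ) :
    frameArrivals a T f = ∑ i ∈ Finset.range T, ∑ e, a (f * T + i) e := by
  rw [frameArrivals, Finset.sum_comm]
  rfl

theorem _root_.IsBoundedAdversary.sum_range_le {w : ℕ} {lam : ℝ} {a : ℕ → Fin m → ℕ}
    (h : IsBoundedAdversary w lam a) (t k : ℕ) :
    ((∑ i ∈ Finset.range (k * w), ∑ e, a (t + i) e : ℕ) : ℝ) ≤ k * (w * lam) := by
  induction k with
  | zero => simp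
  | succ k ih =>
    have h1 := h (t + k * w)
    rw [Finset.sum_Ico_eq_sum_range, Nat.add_sub_cancel_left] at h1
    rw [add_mul, one_mul, Finset.sum_range_add]
    simp_rw [← add_assoc]
    push_cast at h1 ih ⊢
    linarith

/-- A frame is covered by `T / w + 1` windows of `w` slots, which overshoot it by at most one
window. -/
theorem _root_.IsBoundedAdversary.frameArrivals_le {w : ℕ} {lam : ℝ} {a : ℕ → Fin m → ℕ}
    (h : IsBoundedAdversary w lam a) (hw : 1 ≤ w) (h0 : 0 ≤ lam) (T f : ℕ) :
    (frameArrivals a T f : ℝ) ≤ lam * (T + w) := by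
  have h1 : T ≤ (T / w + 1) * w := by
    rw [mul_comm]
    exact (Nat.lt_mul_div_succ T hw).le
  have h2 : frameArrivals a T f ≤
      ∑ i ∈ Finset.range ((T / w + 1) * w), ∑ e, a (f * T + i) e := by
    rw [frameArrivals_eq_sum]
    exact Finset.sum_le_sum_of_subset (Finset.range_subset_range.2 h1)
  have h3 : ((T / w * w : ℕ) : ℝ) ≤ T := by exact_mod_cast Nat.div_mul_le_self T w
  push_cast at h3
  calc (frameArrivals a T f : ℝ) ≤ ((T / w + 1 : ℕ) : ℝ) * (w * lam) :=
        (Nat.cast_le.2 h2).trans (h.sum_range_le _ _)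
    _ = lam * (((T / w : ℕ) : ℝ) * w + w) := by
        push_cast
        ring
    _ ≤ _ := by
        gcongr

theorem exists_usesStaticAlgorithm_adversariallyStable {lam : ℝ} (h0 : 0 ≤ lam)
    (h1 : lam < 1 / Real.exp 1) (hm : 1 ≤ m) {w : ℕ} (hw : 1 ≤ w) :
    ∃ P : SymmetricProtocol, UsesStaticAlgorithm P m ∧ AdversariallyStable P m w lam := by
  obtain ⟨c, δ, n', hc, -, hδ, hn', hev⟩ := exists_eventually_suitable hm h0 h1
  -- `T ≥ lam w / (c - lam)` gives `lam (T + w) ≤ cT ≤ n`, so no main phase is ever overloaded.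
  obtain ⟨T, ⟨hn, hnm, hlen, hsuit⟩, hT⟩ := (hev.and (tendsto_natCast_atTop_atTop.eventually_ge_atTop
    (lam * w / (c - lam)))).exists
  have hnT : c * T ≤ (⌈c * (T : ℝ)⌉₊ : ℝ) := Nat.le_ceil _
  set n := ⌈c * (T : ℝ)⌉₊
  have hn0 : (0 : ℝ) < n := by exact_mod_cast (by omega : 0 < n)
  set Bq : ℝ≥0∞ := m * (ENNReal.ofReal ((n : ℝ)⁻¹)⁻¹ * ENNReal.ofReal (8 * m * n)) + n + n with hBq
  set Bl : ℝ≥0∞ := T * (2 + 2 * m * (ENNReal.ofReal ((n : ℝ)⁻¹)⁻¹ * ENNReal.ofReal (8 * m * n) + n))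
    with hBl
  have hfin : Bq + Bl ≠ ⊤ := by finiteness
  refine ⟨frameProtocol m T 2 δ n n', ⟨T, 2, δ, n, n', one_le_two, hδ, hn, hn', hlen, rfl⟩,
    (Bq + Bl).toNNReal, fun a ha => ?_⟩
  rw [ENNReal.coe_toNNReal hfin]
  have hN : ∀ f, frameArrivals a T f ≤ n := by
    intro f
    have h2 : lam * (T + w) ≤ c * T := by
      rw [div_le_iff₀ (by linarith)] at hT
      linarith
    exact_mod_cast (ha.frameArrivals_le hw h0 T f).trans (h2.trans hnT)
  have hM : ∀ f, mainArrivals a T f ≤ n := by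
    rintro (_ | f)
    · exact Nat.zero_le _
    · exact hN f
  have hpot := potentialBound_le_of_le hm hnm hM
  refine ⟨fun t => ?_, fun t e i hi => ?_⟩
  · refine ((hsuit.lintegral_queueLength_le a (inv_pos.2 hn0) t).trans ?_).trans le_self_add
    rw [hBq]
    gcongr
    · exact hpot _
    · exact hM _
    · exact hN _
  · have hj : firstIndex a t e + i < firstIndex a (t + 1) e := by
      rw [firstIndex, firstIndex, Finset.sum_range_succ]
      omega
    refine ((hsuit.lintegral_latency_le (inv_pos.2 hn0) hj).trans ?_).trans le_add_self
    rw [hBl]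
    gcongr
    · exact hpot _
    · exact hN _

end FrameProtocol

/-! ### Independence in the stochastic injection model -/

open FrameProtocol SymmetricProtocol

namespace IsStochasticInjection

variable {Ω : Type*} [MeasurableSpace Ω] {μ : Measure Ω} {m k : ℕ}
  {inj : ℕ → Fin k → Ω → Option (Fin m)} {lam : ℝ}

theorem measurable_inj (h : IsStochasticInjection μ inj lam) (q : ℕ × Fin k) :
    Measurable[_, ⊤] (inj q.1 q.2) :=
  let _ : MeasurableSpace (Option (Fin m)) := ⊤
  measurable_to_countable' fun x => h.measurable q.1 q.2 x

/-- Extend a partial injection pattern by empty slots. -/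
def extendNone (A : Finset (ℕ × Fin k)) (y : A → Option (Fin m)) (t : ℕ) (g : Fin k) :
    Option (Fin m) :=
  if h : (t, g) ∈ A then y ⟨(t, g), h⟩ else none

/-- The value of `F` is determined by the injections of the generators and slots in `A`. -/
def Determined (F : (ℕ → Fin k → Option (Fin m)) → ℝ≥0∞) (A : Finset (ℕ × Fin k)) : Prop :=
  ∀ x y : ℕ → Fin k → Option (Fin m), (∀ q ∈ A, x q.1 q.2 = y q.1 q.2) → F x = F y

theorem Determined.eq_extendNone {F : (ℕ → Fin k → Option (Fin m)) → ℝ≥0∞}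
    {A : Finset (ℕ × Fin k)} (hF : Determined F A) (x : ℕ → Fin k → Option (Fin m)) :
    F x = F (extendNone A fun q => x q.1.1 q.1.2) :=
  hF _ _ fun q hq => by rw [extendNone, dif_pos hq]

theorem measurable_comp (h : IsStochasticInjection μ inj lam)
    {F : (ℕ → Fin k → Option (Fin m)) → ℝ≥0∞} {A : Finset (ℕ × Fin k)} (hF : Determined F A) :
    Measurable fun ω => F fun t g => inj t g ω := by
  let _ : MeasurableSpace (Option (Fin m)) := ⊤
  simp_rw [fun ω => hF.eq_extendNone fun t g => inj t g ω]
  exact (Measurable.of_discrete (f := fun y : A → Option (Fin m) => F (extendNone A y))).comp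
    (measurable_pi_lambda _ fun q => h.measurable_inj q.1)

theorem lintegral_mul (h : IsStochasticInjection μ inj lam)
    {F G : (ℕ → Fin k → Option (Fin m)) → ℝ≥0∞} {A B : Finset (ℕ × Fin k)} (hF : Determined F A)
    (hG : Determined G B) (hAB : Disjoint A B) :
    ∫⁻ ω, (F fun t g => inj t g ω) * (G fun t g => inj t g ω) ∂μ =
      (∫⁻ ω, F fun t g => inj t g ω ∂μ) * ∫⁻ ω, G fun t g => inj t g ω ∂μ := by
  let _ : MeasurableSpace (Option (Fin m)) := ⊤
  refine lintegral_mul_eq_lintegral_mul_lintegral_of_indepFun (h.measurable_comp hF)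
    (h.measurable_comp hG) ?_
  simp_rw [fun ω => hF.eq_extendNone fun t g => inj t g ω,
    fun ω => hG.eq_extendNone fun t g => inj t g ω]
  exact (iIndepFun.indepFun_finset A B hAB h.indep h.measurable_inj).comp
    (φ := fun y : A → Option (Fin m) => F (extendNone A y))
    (ψ := fun y : B → Option (Fin m) => G (extendNone B y)) Measurable.of_discrete
    Measurable.of_discrete

theorem sum_arrivals (t : ℕ) (x : ℕ → Fin k → Option (Fin m)) :
    ∑ e, arrivals x t e = ∑ g, if (x t g).isSome then 1 else 0 := by
  simp_rw [arrivals, Finset.card_filter]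
  rw [Finset.sum_comm]
  refine Finset.sum_congr rfl fun g _ => ?_
  cases x t g with
  | none => simp
  | some e => simp

/-- The generators and slots of a frame. -/
def frameSlots (T k f : ℕ) : Finset (ℕ × Fin k) := Finset.Ico (f * T) (f * T + T) ×ˢ Finset.univ

theorem frameArrivals_arrivals (T f : ℕ) (x : ℕ → Fin k → Option (Fin m)) :
    frameArrivals (arrivals x) T f =
      ∑ q ∈ frameSlots T k f, if (x q.1 q.2).isSome then 1 else 0 := by
  rw [frameArrivals_eq_sum, frameSlots, Finset.sum_product, Finset.sum_Ico_eq_sum_range,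
    Nat.add_sub_cancel_left]
  exact Finset.sum_congr rfl fun i _ => sum_arrivals _ _

theorem determined_frameArrivals (T f : ℕ) (u : ℕ → ℝ≥0∞) :
    Determined (m := m) (k := k) (fun x => u (frameArrivals (arrivals x) T f))
      (frameSlots T k f) := by
  intro x y hxy
  simp only [frameArrivals_arrivals]
  congr 1
  exact Finset.sum_congr rfl fun q hq => by rw [hxy q hq]

theorem _root_.FrameProtocol.potentialBound_congr {n : ℕ} {ε : ℝ≥0∞} {θ : ℝ} {M M' : ℕ → ℕ} (f : ℕ)
    (h : ∀ i < f, M i = M' i) : potentialBound n ε m θ M f = potentialBound n ε m θ M' f := by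
  induction f with
  | zero => rfl
  | succ f ih =>
    rw [potentialBound, potentialBound, ih fun i hi => h i (hi.trans f.lt_succ_self),
      h f f.lt_succ_self]

/-- Packets wait one frame: the main phases up to frame `f` treat only packets injected before slot
`f * T`. Hence this bound is independent of everything injected in frame `f`. -/
theorem determined_potentialBound (n : ℕ) (ε : ℝ≥0∞) (θ : ℝ) (T f : ℕ) :
    Determined (m := m) (k := k)
      (fun x => potentialBound n ε m θ (mainArrivals (arrivals x) T) (f + 1))
      (Finset.range (f * T) ×ˢ Finset.univ) := by
  intro x y hxy
  refine potentialBound_congr _ fun i hi => ?_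
  cases i with
  | zero => rfl
  | succ i =>
    simp only [mainArrivals, frameArrivals_arrivals]
    refine Finset.sum_congr rfl fun q hq => ?_
    rw [hxy q]
    rw [frameSlots, Finset.mem_product, Finset.mem_Ico] at hq
    have h1 : i * T + T ≤ f * T := by
      rw [← Nat.succ_mul]
      exact Nat.mul_le_mul_right T (by omega)
    simp only [Finset.mem_product, Finset.mem_range, Finset.mem_univ, and_true]
    omega

theorem disjoint_frameSlots (T k f : ℕ) :
    Disjoint (frameSlots T k f) (Finset.range (f * T) ×ˢ Finset.univ) := by
  rw [Finset.disjoint_left]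
  intro q hq hq'
  simp only [frameSlots, Finset.mem_product, Finset.mem_Ico, Finset.mem_range] at hq hq'
  omega

/-- The probability that generator `q.2` injects a packet in slot `q.1`. -/
noncomputable def injectionProb (μ : Measure Ω) (inj : ℕ → Fin k → Ω → Option (Fin m))
    (q : ℕ × Fin k) : ℝ≥0∞ :=
  ∫⁻ ω, (if (inj q.1 q.2 ω).isSome then 1 else 0) ∂μ

/-! ### Moments of the injections in a frame -/

variable [IsProbabilityMeasure μ]

theorem injectionProb_le_one (q : ℕ × Fin k) : injectionProb μ inj q ≤ 1 := by
  calc injectionProb μ inj q ≤ ∫⁻ _, 1 ∂μ := lintegral_mono fun ω => by split_ifs <;> simp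
    _ = 1 := by simp

theorem sum_injectionProb_le (h : IsStochasticInjection μ inj lam) (t : ℕ) :
    ∑ g, injectionProb μ inj (t, g) ≤ ENNReal.ofReal lam := by
  have h1 : ∀ g, injectionProb μ inj (t, g) = ∑ e, μ {ω | inj t g ω = some e} := by
    intro g
    have h2 : ∀ ω, (if (inj t g ω).isSome then 1 else 0 : ℝ≥0∞) =
        ∑ e, {ω | inj t g ω = some e}.indicator 1 ω := by
      intro ω
      simp only [Set.indicator_apply, Set.mem_ofPred_eq, Pi.one_apply]
      cases inj t g ω with
      | none => simp
      | some e => simp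
    simp only [injectionProb, h2]
    rw [lintegral_finsetSum _ fun e _ => measurable_one.indicator (h.measurable t g _)]
    exact Finset.sum_congr rfl fun e _ => lintegral_indicator_one (h.measurable t g _)
  simp_rw [h1]
  rw [Finset.sum_comm]
  refine le_trans (le_of_eq ?_) (ENNReal.ofReal_le_ofReal (h.rate_le t))
  rw [ENNReal.ofReal_sum_of_nonneg fun _ _ => Finset.sum_nonneg fun _ _ => measureReal_nonneg]
  refine Finset.sum_congr rfl fun e _ => ?_
  rw [ENNReal.ofReal_sum_of_nonneg fun _ _ => measureReal_nonneg]
  exact Finset.sum_congr rfl fun g _ => (ofReal_measureReal (measure_ne_top _ _)).symm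

theorem sum_frameSlots_injectionProb_le (h : IsStochasticInjection μ inj lam) (T f : ℕ) :
    ∑ q ∈ frameSlots T k f, injectionProb μ inj q ≤ T * ENNReal.ofReal lam := by
  rw [frameSlots, Finset.sum_product]
  refine (Finset.sum_le_card_nsmul _ _ _ fun t _ => h.sum_injectionProb_le t).trans ?_
  rw [Nat.card_Ico, Nat.add_sub_cancel_left, nsmul_eq_mul]

theorem measurable_isSome (h : IsStochasticInjection μ inj lam) (q : ℕ × Fin k) :
    Measurable fun ω => (if (inj q.1 q.2 ω).isSome then 1 else 0 : ℝ≥0∞) :=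
  let _ : MeasurableSpace (Option (Fin m)) := ⊤
  (Measurable.of_discrete (f := fun o : Option (Fin m) => (if o.isSome then 1 else 0 : ℝ≥0∞))).comp
    (h.measurable_inj q)

theorem lintegral_frameArrivals_le (h : IsStochasticInjection μ inj lam) (T f : ℕ) :
    ∫⁻ ω, (frameArrivals (arrivals fun t g => inj t g ω) T f : ℝ≥0∞) ∂μ ≤
      T * ENNReal.ofReal lam := by
  simp_rw [frameArrivals_arrivals, Nat.cast_sum, Nat.cast_ite, Nat.cast_one, Nat.cast_zero]
  rw [lintegral_finsetSum _ fun q _ => h.measurable_isSome q]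
  exact h.sum_frameSlots_injectionProb_le T f

/-- The moment generating function of the number of packets injected in a frame. -/
theorem lintegral_exp_frameArrivals_le (h : IsStochasticInjection μ inj lam) (h0 : 0 ≤ lam)
    {η : ℝ} (hη : 0 ≤ η) (T f : ℕ) :
    ∫⁻ ω, ENNReal.ofReal (Real.exp (η * frameArrivals (arrivals fun t g => inj t g ω) T f)) ∂μ ≤
      ENNReal.ofReal (Real.exp ((Real.exp η - 1) * (T * lam))) := by
  let _ : MeasurableSpace (Option (Fin m)) := ⊤
  have hc : 0 ≤ Real.exp η - 1 := by
    have := Real.one_le_exp hη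
    linarith
  set c := Real.exp η - 1 with hcdef
  -- For a 0-1 variable, `exp(ηX) = 1 + (exp η - 1)X`; the expectation `1 + cp` of each factor is at
  -- most `exp(cp)`.
  set u : Option (Fin m) → ℝ≥0∞ := fun o =>
    1 + ENNReal.ofReal c * (if o.isSome then 1 else 0) with hu
  have hexp : ∀ ω, ENNReal.ofReal
      (Real.exp (η * frameArrivals (arrivals fun t g => inj t g ω) T f)) =
      ∏ q ∈ frameSlots T k f, u (inj q.1 q.2 ω) := by
    intro ω
    rw [frameArrivals_arrivals, Nat.cast_sum, Finset.mul_sum, Real.exp_sum,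
      ENNReal.ofReal_prod_of_nonneg fun _ _ => (Real.exp_pos _).le]
    refine Finset.prod_congr rfl fun q _ => ?_
    simp only [hu]
    split_ifs
    · rw [Nat.cast_one, mul_one, mul_one, ← ENNReal.ofReal_one, ← ENNReal.ofReal_add one_pos.le hc,
        hcdef]
      congr 1
      ring
    · simp
  simp_rw [hexp]
  have hind : iIndepFun (fun (q : ℕ × Fin k) ω => u (inj q.1 q.2 ω)) μ :=
    h.indep.comp (fun _ => u) fun _ => Measurable.of_discrete
  rw [lintegral_prod_eq_prod_lintegral_of_indepFun _ _ hind fun q =>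
    (Measurable.of_discrete (f := u)).comp (h.measurable_inj q)]
  calc _ ≤ ∏ q ∈ frameSlots T k f,
        ENNReal.ofReal (Real.exp (c * (injectionProb μ inj q).toReal)) := by
        refine Finset.prod_le_prod' fun q _ => ?_
        simp only [hu]
        rw [lintegral_add_left measurable_const, lintegral_const_mul _ (h.measurable_isSome q),
          lintegral_const, measure_univ, mul_one]
        change 1 + ENNReal.ofReal c * injectionProb μ inj q ≤ _
        rw [← ENNReal.ofReal_toReal (ne_top_of_le_ne_top ENNReal.one_ne_top
          (injectionProb_le_one (μ := μ) (inj := inj) q)), ENNReal.toReal_ofReal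
          ENNReal.toReal_nonneg, ← ENNReal.ofReal_mul hc, ← ENNReal.ofReal_one,
          ← ENNReal.ofReal_add one_pos.le (by positivity)]
        refine ENNReal.ofReal_le_ofReal ?_
        rw [add_comm]
        exact Real.add_one_le_exp _
    _ = ENNReal.ofReal (Real.exp (c * (∑ q ∈ frameSlots T k f, injectionProb μ inj q).toReal)) := by
        rw [ENNReal.toReal_sum fun q _ => ne_top_of_le_ne_top ENNReal.one_ne_top
          (injectionProb_le_one q), Finset.mul_sum, Real.exp_sum,
          ENNReal.ofReal_prod_of_nonneg fun _ _ => (Real.exp_pos _).le]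
    _ ≤ _ := by
        gcongr
        refine ENNReal.toReal_le_of_le_ofReal (by positivity)
          ((h.sum_frameSlots_injectionProb_le T f).trans (le_of_eq ?_))
        rw [ENNReal.ofReal_mul (by positivity), ENNReal.ofReal_natCast]

/-- The expected growth of the potential in a main phase. -/
theorem lintegral_growth_le (h : IsStochasticInjection μ inj lam) (h0 : 0 ≤ lam) (hm : 1 ≤ m)
    {n T : ℕ} (hn : 48 * m ≤ n) {η : ℝ} (hη : (n : ℝ)⁻¹ ≤ η)
    (htail : Real.exp (1 - η * n + (Real.exp η - 1) * (T * lam)) ≤ 1 / (16 * m * n)) (f : ℕ) :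
    ∫⁻ ω, growth n (ENNReal.ofReal ((n : ℝ) ^ 2)⁻¹) (n : ℝ)⁻¹
        (frameArrivals (arrivals fun t g => inj t g ω) T f) ∂μ ≤
      ENNReal.ofReal (1 + 1 / (8 * m * n)) := by
  have hn0 : (0 : ℝ) < n := by exact_mod_cast (by omega : 0 < n)
  have hm0 : (0 : ℝ) < m := by exact_mod_cast hm
  have hη0 : 0 ≤ η := (inv_pos.2 hn0).le.trans hη
  -- For `M > n` and `1/n ≤ η` one has `M/n = 1 + (M - n)/n ≤ 1 + η(M - n)`, so an overloaded frame
  -- is charged to the moment generating function.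
  have hgrowth : ∀ M : ℕ, growth n (ENNReal.ofReal ((n : ℝ) ^ 2)⁻¹) (n : ℝ)⁻¹ M ≤
      ENNReal.ofReal (1 + 1 / (16 * m * n)) +
        ENNReal.ofReal (Real.exp (1 - η * n)) * ENNReal.ofReal (Real.exp (η * M)) := by
    intro M
    rw [growth]
    split_ifs with hM
    · exact (one_add_mul_exp_le hm hn).trans le_self_add
    · refine le_trans ?_ le_add_self
      rw [← ENNReal.ofReal_mul (Real.exp_pos _).le, ← Real.exp_add]
      refine ENNReal.ofReal_le_ofReal (Real.exp_le_exp.2 ?_)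
      have h1 : (n : ℝ) ≤ M := by exact_mod_cast (not_le.1 hM).le
      have h2 : (n : ℝ)⁻¹ * n = 1 := inv_mul_cancel₀ hn0.ne'
      nlinarith [mul_nonneg (sub_nonneg.2 hη) (sub_nonneg.2 h1)]
  calc _ ≤ _ := lintegral_mono fun ω => hgrowth _
    _ = ENNReal.ofReal (1 + 1 / (16 * m * n)) + ENNReal.ofReal (Real.exp (1 - η * n)) *
        ∫⁻ ω, ENNReal.ofReal
          (Real.exp (η * frameArrivals (arrivals fun t g => inj t g ω) T f)) ∂μ := by
        rw [lintegral_add_left measurable_const, lintegral_const, measure_univ, mul_one,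
          lintegral_const_mul _ (h.measurable_comp (determined_frameArrivals T f
            fun M => ENNReal.ofReal (Real.exp (η * M))))]
    _ ≤ ENNReal.ofReal (1 + 1 / (16 * m * n)) + ENNReal.ofReal (Real.exp (1 - η * n)) *
        ENNReal.ofReal (Real.exp ((Real.exp η - 1) * (T * lam))) := by
        gcongr
        exact h.lintegral_exp_frameArrivals_le h0 hη0 T f
    _ ≤ _ := by
        rw [← ENNReal.ofReal_mul (Real.exp_pos _).le, ← Real.exp_add,
          ← ENNReal.ofReal_add (by positivity) (Real.exp_pos _).le]
        refine ENNReal.ofReal_le_ofReal ?_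
        have h1 : 1 / (8 * (m : ℝ) * n) = 1 / (16 * m * n) + 1 / (16 * m * n) := by
          field_simp
          norm_num
        rw [h1]
        linarith

/-- The growth factor in each recursion step depends on the arrivals of frame `f`, the preceding
potential bound on earlier slots. By independence the expectation of the product factors and the
deterministic recursion applies; the initial frame has no arrivals and is separate. -/
theorem lintegral_potentialBound_le (h : IsStochasticInjection μ inj lam) (h0 : 0 ≤ lam)
    (hm : 1 ≤ m) {n T : ℕ} (hn : 48 * m ≤ n) {η : ℝ} (hη : (n : ℝ)⁻¹ ≤ η)
    (htail : Real.exp (1 - η * n + (Real.exp η - 1) * (T * lam)) ≤ 1 / (16 * m * n)) (f : ℕ) :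
    ∫⁻ ω, potentialBound n (ENNReal.ofReal ((n : ℝ) ^ 2)⁻¹) m (n : ℝ)⁻¹
        (mainArrivals (arrivals fun t g => inj t g ω) T) f ∂μ ≤ ENNReal.ofReal (8 * m * n) := by
  have hn1 : 1 ≤ n := by omega
  induction f with
  | zero =>
    simp only [potentialBound, lintegral_const, measure_univ, mul_one]
    exact one_le_ofReal_mul hm hn1
  | succ f ih =>
    cases f with
    | zero =>
      simp only [potentialBound, mainArrivals, lintegral_const, measure_univ, mul_one]
      simpa using one_add_shrink_mul_le hm hn1 (growth_le_of_le hm hn (Nat.zero_le n))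
        (one_le_ofReal_mul hm hn1)
    | succ f =>
      have hF := determined_frameArrivals (m := m) (k := k) T f
        (growth n (ENNReal.ofReal ((n : ℝ) ^ 2)⁻¹) (n : ℝ)⁻¹)
      have hG := determined_potentialBound (m := m) (k := k) n (ENNReal.ofReal ((n : ℝ) ^ 2)⁻¹)
        (n : ℝ)⁻¹ T f
      have hstep : ∀ M : ℕ → ℕ, potentialBound n (ENNReal.ofReal ((n : ℝ) ^ 2)⁻¹) m (n : ℝ)⁻¹ M
          (f + 1 + 1) = 1 + ENNReal.ofReal (shrink m (n : ℝ)⁻¹) *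
            (growth n (ENNReal.ofReal ((n : ℝ) ^ 2)⁻¹) (n : ℝ)⁻¹ (M (f + 1)) *
              potentialBound n (ENNReal.ofReal ((n : ℝ) ^ 2)⁻¹) m (n : ℝ)⁻¹ M (f + 1)) :=
        fun _ => rfl
      simp only [hstep]
      rw [lintegral_add_left measurable_const, lintegral_const, measure_univ, mul_one,
        lintegral_const_mul' _ _ ENNReal.ofReal_ne_top,
        show ∫⁻ ω, growth n (ENNReal.ofReal ((n : ℝ) ^ 2)⁻¹) (n : ℝ)⁻¹
              (mainArrivals (arrivals fun t g => inj t g ω) T (f + 1)) *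
            potentialBound n (ENNReal.ofReal ((n : ℝ) ^ 2)⁻¹) m (n : ℝ)⁻¹
              (mainArrivals (arrivals fun t g => inj t g ω) T) (f + 1) ∂μ = _
          from h.lintegral_mul hF hG (disjoint_frameSlots T k f)]
      exact one_add_shrink_mul_le hm hn1 (h.lintegral_growth_le h0 hm hn hη htail f) ih

/-! #### Conditioning on an injection -/

theorem determined_indicator (t : ℕ) (g : Fin k) (e : Fin m) :
    Determined (m := m) (k := k) (fun x => if x t g = some e then 1 else 0) {(t, g)} := by
  intro x y hxy
  simp only [hxy (t, g) (Finset.mem_singleton_self _)]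

/-- An injection at `(t, g)` carries no information about the other generators and slots. -/
theorem setLIntegral_eq (h : IsStochasticInjection μ inj lam) (t : ℕ) (g : Fin k) (e : Fin m)
    {G : (ℕ → Fin k → Option (Fin m)) → ℝ≥0∞} {B : Finset (ℕ × Fin k)} (hG : Determined G B)
    (hB : (t, g) ∉ B) :
    ∫⁻ ω in {ω | inj t g ω = some e}, (G fun t g => inj t g ω) ∂μ =
      μ {ω | inj t g ω = some e} * ∫⁻ ω, G fun t g => inj t g ω ∂μ := by
  have h1 := h.lintegral_mul (determined_indicator t g e) hG (by simpa using hB)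
  have h2 : ∀ ω, (if inj t g ω = some e then 1 else 0 : ℝ≥0∞) =
      {ω | inj t g ω = some e}.indicator 1 ω := fun ω => by
    simp only [Set.indicator_apply, Set.mem_ofPred_eq, Pi.one_apply]
  rw [← lintegral_indicator (h.measurable t g _)]
  simp only [h2, lintegral_indicator_one (h.measurable t g (some e))] at h1
  rw [← h1]
  refine lintegral_congr fun ω => ?_
  simp only [Set.indicator_apply, Pi.one_apply]
  split_ifs <;> simp

/-- Conditioning affects only the summand of `(t, g)` itself, which is at most 1. -/
theorem setLIntegral_frameArrivals_le (h : IsStochasticInjection μ inj lam) (t : ℕ) (g : Fin k)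
    (e : Fin m) (T f : ℕ) :
    ∫⁻ ω in {ω | inj t g ω = some e},
        (frameArrivals (arrivals fun t g => inj t g ω) T f : ℝ≥0∞) ∂μ ≤
      μ {ω | inj t g ω = some e} * (T * ENNReal.ofReal lam + 1) := by
  set E := {ω | inj t g ω = some e}
  have hq : ∀ q : ℕ × Fin k, ∫⁻ ω in E, (if (inj q.1 q.2 ω).isSome then 1 else 0) ∂μ ≤
      μ E * injectionProb μ inj q + if q = (t, g) then μ E else 0 := by
    intro q
    split_ifs with hqt
    · refine le_trans ?_ le_add_self
      calc _ ≤ ∫⁻ _ in E, 1 ∂μ := lintegral_mono fun ω => by split_ifs <;> simp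
        _ = μ E := by simp
    · rw [add_zero]
      refine le_of_eq (h.setLIntegral_eq t g e (B := {q})
        (G := fun x => if (x q.1 q.2).isSome then 1 else 0) ?_ ?_)
      · intro x y hxy
        simp only [hxy q (Finset.mem_singleton_self _)]
      · rw [Finset.mem_singleton]
        exact fun h' => hqt h'.symm
  simp_rw [frameArrivals_arrivals, Nat.cast_sum, Nat.cast_ite, Nat.cast_one, Nat.cast_zero]
  rw [lintegral_finsetSum _ fun q _ => h.measurable_isSome q, mul_add, mul_one]
  refine (Finset.sum_le_sum fun q _ => hq q).trans ?_
  rw [Finset.sum_add_distrib, ← Finset.mul_sum]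
  gcongr
  · exact h.sum_frameSlots_injectionProb_le T f
  · rw [Finset.sum_ite_eq']
    split_ifs <;> simp

end IsStochasticInjection

theorem packetIndex_lt {m k : ℕ} {x : ℕ → Fin k → Option (Fin m)} {t : ℕ} {g : Fin k} {e : Fin m}
    (h : x t g = some e) : packetIndex x t g e < firstIndex (arrivals x) (t + 1) e := by
  rw [packetIndex, firstIndex, firstIndex, Finset.sum_range_succ, arrivals]
  refine Nat.add_lt_add_left (Finset.card_lt_card ?_) _
  rw [Finset.ssubset_iff_of_subset (Finset.monotone_filter_right _ fun _ _ h => h.2)]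
  exact ⟨g, by simp [h], by simp⟩

/-! ### Stability under stochastic injection -/

namespace FrameProtocol

open StaticMAC SymmetricProtocol Filter

variable {m : ℕ}

/-- With `c = lam + 2η` and `exp η - 1 ≤ η + η²` the exponent is at most `1 - η²T(2 - lam) ≤ 1 -
η²T`, and exponential decay beats `1/T`. -/
theorem eventually_exp_tail_le (hm : 1 ≤ m) {lam c η : ℝ} (h0 : 0 ≤ lam) (hc : lam < c) (hc1 : c < 1)
    (hη : η = (c - lam) / 2) :
    ∀ᶠ T : ℕ in atTop, Real.exp (1 - η * ⌈c * T⌉₊ + (Real.exp η - 1) * (T * lam)) ≤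
      1 / (16 * m * ⌈c * T⌉₊) := by
  have hη0 : 0 < η := by linarith
  have hc0 : 0 < c := by linarith
  have hm0 : (0 : ℝ) < m := by exact_mod_cast hm
  have hlim : Tendsto (fun T : ℕ => η ^ 2 * (T : ℝ)) atTop atTop :=
    tendsto_natCast_atTop_atTop.const_mul_atTop (by positivity)
  have hsmall := (((Real.tendsto_pow_mul_exp_neg_atTop_nhds_zero 1).comp hlim).eventually_lt_const
    (by positivity : 0 < η ^ 2 / (32 * m * Real.exp 1)))
  filter_upwards [hsmall, eventually_ge_atTop 1,
    tendsto_natCast_atTop_atTop.eventually_gt_atTop (1 / c)] with T h1 h2 h3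
  have hT : (1 : ℝ) ≤ T := by exact_mod_cast h2
  set n := ⌈c * (T : ℝ)⌉₊
  have hn0 : c * T ≤ n := Nat.le_ceil _
  have hn1 : (n : ℝ) ≤ 2 * T := by
    have := (Nat.ceil_lt_add_one (by positivity : 0 ≤ c * (T : ℝ))).le
    nlinarith
  have hnpos : (0 : ℝ) < n := by
    have : 0 < c * T := by positivity
    linarith
  have hexp : Real.exp η - 1 ≤ η + η ^ 2 := by
    have := (abs_le.1 (Real.abs_exp_sub_one_sub_id_le (x := η) (by rw [abs_le]; constructor <;>
      linarith))).2
    linarith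
  have hexponent : 1 - η * n + (Real.exp η - 1) * (T * lam) ≤ 1 + -(η ^ 2 * T) := by
    have h4 : (Real.exp η - 1) * (T * lam) ≤ (η + η ^ 2) * (T * lam) := by gcongr
    have h5 : η * (c * T) ≤ η * n := by gcongr
    have h6 : c = lam + 2 * η := by linarith
    have h7 : η ^ 2 * T * lam ≤ η ^ 2 * T := mul_le_of_le_one_right (by positivity) (by linarith)
    rw [h6] at h5
    nlinarith
  rw [Function.comp_apply, pow_one, lt_div_iff₀ (by positivity)] at h1
  have h8 : T * Real.exp (-(η ^ 2 * T)) * (32 * m * Real.exp 1) ≤ 1 := by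
    have : η ^ 2 * (T * Real.exp (-(η ^ 2 * T)) * (32 * m * Real.exp 1)) ≤ η ^ 2 * 1 := by linarith
    exact le_of_mul_le_mul_left this (by positivity)
  calc _ ≤ Real.exp (1 + -(η ^ 2 * T)) := Real.exp_le_exp.2 hexponent
    _ ≤ 1 / (16 * m * (2 * T)) := by
        rw [Real.exp_add, le_div_iff₀ (by positivity)]
        linarith
    _ ≤ _ := by gcongr

theorem exists_usesStaticAlgorithm_stochasticallyStable {lam : ℝ} (h0 : 0 ≤ lam)
    (h1 : lam < 1 / Real.exp 1) (hm : 1 ≤ m) :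
    ∃ P : SymmetricProtocol, UsesStaticAlgorithm P m ∧ StochasticallyStable.{u} P m lam := by
  obtain ⟨c, δ, n', hc, hc1, hδ, hn', hev⟩ := exists_eventually_suitable hm h0 h1
  set η := (c - lam) / 2 with hηdef
  have hη0 : 0 < η := by linarith
  have hlim : Tendsto (fun T : ℕ => ((⌈c * (T : ℝ)⌉₊ : ℕ) : ℝ)) atTop atTop :=
    tendsto_natCast_atTop_atTop.comp (tendsto_nat_ceil_atTop.comp
      (tendsto_natCast_atTop_atTop.const_mul_atTop (h0.trans_lt hc)))
  -- All parameters and the bounds below are fixed before the probability space and the generators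
  -- are introduced, so the final bound does not depend on them.
  obtain ⟨T, ⟨⟨hn, hnm, hlen, hsuit⟩, htail⟩, hηn⟩ := ((hev.and
    (eventually_exp_tail_le hm h0 hc hc1 hηdef)).and (hlim.eventually_ge_atTop η⁻¹)).exists
  set n := ⌈c * (T : ℝ)⌉₊
  have hn0 : (0 : ℝ) < n := by exact_mod_cast (by omega : 0 < n)
  have hη : (n : ℝ)⁻¹ ≤ η := inv_le_of_inv_le₀ hη0 hηn
  set R : ℝ≥0∞ := ENNReal.ofReal (8 * m * n)
  set N : ℝ≥0∞ := T * ENNReal.ofReal lam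
  set Bq : ℝ≥0∞ := m * (ENNReal.ofReal ((n : ℝ)⁻¹)⁻¹ * R) + N + N with hBq
  set Bl : ℝ≥0∞ := T * (2 + 2 * m * (ENNReal.ofReal ((n : ℝ)⁻¹)⁻¹ * R + (N + 1))) with hBl
  have hfin : Bq + Bl ≠ ⊤ := by
    have hR : R ≠ ⊤ := ENNReal.ofReal_ne_top
    have hN : N ≠ ⊤ := ENNReal.mul_ne_top (by simp) ENNReal.ofReal_ne_top
    finiteness
  refine ⟨frameProtocol m T 2 δ n n', ⟨T, 2, δ, n, n', one_le_two, hδ, hn, hn', hlen, rfl⟩,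
    (Bq + Bl).toNNReal, fun Ω _ μ _ k inj h => ?_⟩
  rw [ENNReal.coe_toNNReal hfin]
  set a : Ω → ℕ → Fin m → ℕ := fun ω => arrivals fun t g => inj t g ω with ha
  have hpot : ∀ f, ∫⁻ ω, potentialBound n (ENNReal.ofReal ((n : ℝ) ^ 2)⁻¹) m (n : ℝ)⁻¹
      (mainArrivals (a ω) T) f ∂μ ≤ R := h.lintegral_potentialBound_le h0 hm hnm hη htail
  have hN : ∀ f, ∫⁻ ω, (frameArrivals (a ω) T f : ℝ≥0∞) ∂μ ≤ N := h.lintegral_frameArrivals_le T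
  have hmN : ∀ f, Measurable fun ω => (frameArrivals (a ω) T f : ℝ≥0∞) := fun f =>
    h.measurable_comp (IsStochasticInjection.determined_frameArrivals T f fun M => M)
  refine ⟨fun t => ?_, fun t g e => ?_⟩
  · have hM : ∀ f, ∫⁻ ω, (mainArrivals (a ω) T f : ℝ≥0∞) ∂μ ≤ N := by
      rintro (_ | f)
      · simp [mainArrivals]
      · exact hN f
    refine le_trans ?_ (le_self_add : Bq ≤ Bq + Bl)
    calc _ ≤ ∫⁻ ω, (m * (ENNReal.ofReal ((n : ℝ)⁻¹)⁻¹ *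
            potentialBound n (ENNReal.ofReal ((n : ℝ) ^ 2)⁻¹) m (n : ℝ)⁻¹ (mainArrivals (a ω) T)
              (t / T)) + mainArrivals (a ω) T (t / T) + frameArrivals (a ω) T (t / T)) ∂μ :=
          lintegral_mono fun ω => hsuit.lintegral_queueLength_le (a ω) (inv_pos.2 hn0) t
      _ ≤ _ := by
          have hmM : Measurable fun ω => (mainArrivals (a ω) T (t / T) : ℝ≥0∞) := by
            cases t / T with
            | zero => simp [mainArrivals]
            | succ f => exact hmN f
          rw [lintegral_add_right _ (hmN _), lintegral_add_right _ hmM,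
            lintegral_const_mul' _ _ (by simp), lintegral_const_mul' _ _ ENNReal.ofReal_ne_top, hBq]
          gcongr
          · exact hpot _
          · exact hM _
          · exact hN _
  · set E := {ω | inj t g ω = some e}
    have hE : MeasurableSet E := h.measurable t g _
    have hdet := IsStochasticInjection.determined_potentialBound (m := m) (k := k) n
      (ENNReal.ofReal ((n : ℝ) ^ 2)⁻¹) (n : ℝ)⁻¹ T (t / T)
    -- The potential bound at the next boundary depends only on slots before the frame of `t`, so
    -- conditioning on the injection leaves its mean unchanged.
    have hpotE : ∫⁻ ω in E, potentialBound n (ENNReal.ofReal ((n : ℝ) ^ 2)⁻¹) m (n : ℝ)⁻¹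
        (mainArrivals (a ω) T) (t / T + 1) ∂μ ≤ μ E * R := by
      refine (h.setLIntegral_eq t g e hdet ?_).trans_le ?_
      · simp [Nat.div_mul_le_self]
      · gcongr
        exact hpot _
    calc _ ≤ ∫⁻ ω in E, T * (2 + 2 * m * (ENNReal.ofReal ((n : ℝ)⁻¹)⁻¹ *
            potentialBound n (ENNReal.ofReal ((n : ℝ) ^ 2)⁻¹) m (n : ℝ)⁻¹ (mainArrivals (a ω) T)
              (t / T + 1) + frameArrivals (a ω) T (t / T))) ∂μ :=
          setLIntegral_mono' hE fun ω hω =>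
            hsuit.lintegral_latency_le (inv_pos.2 hn0) (packetIndex_lt hω)
      _ ≤ T * (2 * μ E + 2 * m * (ENNReal.ofReal ((n : ℝ)⁻¹)⁻¹ * (μ E * R) + μ E * (N + 1))) := by
          rw [lintegral_const_mul' _ _ (by simp), lintegral_add_left measurable_const,
            setLIntegral_const, lintegral_const_mul' _ _ (by finiteness),
            lintegral_add_right _ (hmN _), lintegral_const_mul' _ _ ENNReal.ofReal_ne_top]
          gcongr
          exact h.setLIntegral_frameArrivals_le t g e T _
      _ = Bl * μ E := by
          rw [hBl]
          ring
      _ ≤ _ := by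
          gcongr
          exact le_add_self

end FrameProtocol

theorem mainTheorem9 :
    -- the static algorithm
    (∀ δ : ℝ, 0 < δ →
      (∃ C : ℝ, ∀ φ : ℝ, 1 ≤ φ → ∀ n : ℕ, 2 ≤ n →
        (StaticMAC.length φ δ n : ℝ) ≤
          (1 + δ) * Real.exp 1 * n + C * (φ ^ 2 * Real.log n ^ 2)) ∧
      ∀ φ : ℝ, 1 ≤ φ → ∃ n₀ : ℕ, ∀ n : ℕ, n₀ ≤ n → ∀ k : ℕ, k ≤ n →
        1 - 1 / (n : ℝ) ^ φ ≤ StaticMAC.successProb φ δ n k) ∧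
    -- the dynamic protocol
    (∀ lam : ℝ, 0 ≤ lam → lam < 1 / Real.exp 1 → ∀ m : ℕ, 1 ≤ m →
      (∃ P : SymmetricProtocol, UsesStaticAlgorithm P m ∧ StochasticallyStable.{u} P m lam) ∧
      ∀ w : ℕ, 1 ≤ w →
        ∃ P : SymmetricProtocol, UsesStaticAlgorithm P m ∧ AdversariallyStable P m w lam) := by
  refine ⟨fun δ hδ => ⟨?_, fun φ hφ => StaticMAC.exists_forall_le_successProb hδ hφ⟩,
    fun lam h0 h1 m hm =>
      ⟨FrameProtocol.exists_usesStaticAlgorithm_stochasticallyStable h0 h1 hm, fun w hw =>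
        FrameProtocol.exists_usesStaticAlgorithm_adversariallyStable h0 h1 hm hw⟩⟩
  obtain ⟨C, -, hC⟩ := StaticMAC.exists_length_le hδ
  exact ⟨C, hC⟩
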